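/- An instance of Capacitated Sum of Radii with uniform capacities consists of a set $P$ of $n\ge 1$ points in an arbitrary metric space, given by its pairwise distances, an integer $k\ge 1$ and a capacity $U\in\mathbb{N}$. A solution consists of a set $C\subseteq P$ of exactly $k$ distinct centers, a radius $r_q\ge 0$ for each $q\in C$, and an assignment $\mu:P\to C$ such that $\mathrm{dist}(p,\mu(p))\le r_{\mu(p)}$ for every $p\in P$ and $|\mu^{-1}(q)|\le U$ for every $q\in C$. Its cost is $\sum_{q\in C} r_q$, and $\mathrm{OPT}$ denotes the minimum cost of a solution. Theorem. For every constant $\epsilon>0$ there is a randomized algorithm which, on every instance that has a solution, outputs with probability at least $1/2$ a solution (centers, radii and assignment) of cost at most $(4+\epsilon)\cdot\mathrm{OPT}$; if all distances are integers, then the radii in this output are integers as well. On every instance, and for every outcome of its random choices, the algorithm runs in time $2^{\mathcal{O}(k\log(k/\epsilon))}\cdot n^3$, with an absolute constant in the $\mathcal{O}$. (Here $k\log(k/\epsilon)$ is read as $k\log(2+k/\min(\epsilon,1))$, so that the bound makes sense for all $k\ge 1$ and $\epsilon>0$.) Time is the number of unit-cost instructions of a randomized real RAM: distances are real numbers that can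 be added, subtracted, multiplied, divided and compared, but not rounded, and all integers that the machine handles have $\mathcal{O}(k\log(k/\epsilon)+\log(n+U))$ bits. -/

import Mathlib

noncomputable section

/-- An instance of Capacitated Sum of Radii: a set of `n` points `pt 0, …, pt (n - 1)` of a metric
space `X`, the number `k` of centers, and the capacity `cap q` of each point. -/
structure CSRInstance (X : Type*) [MetricSpace X] where
  n : ℕ
  k : ℕ
  pt : Fin n ↪ X
  cap : Fin n → ℕ

namespace CSRInstance

variable {X : Type*} [MetricSpace X] (I : CSRInstance X)

/-- The pairwise distances of the points of the instance. -/
def d (p q : Fin I.n) : ℝ := dist (I.pt p) (I.pt q)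

/-- All capacities are equal to `U`. -/
def UniformCap (U : ℕ) : Prop := ∀ q, I.cap q = U

/-- `(C, r, μ)` is a solution: `C` consists of exactly `k` (distinct) points, `r q ≥ 0` is the
radius of the ball centered at `q ∈ C`, and `μ` assigns every point to a center whose ball
contains it, so that no center `q` is assigned more than `cap q` points. (The values of `r`
outside `C` play no role.) -/
structure IsSolution (C : Finset (Fin I.n)) (r : Fin I.n → ℝ) (μ : Fin I.n → Fin I.n) :
    Prop where
  card_centers : C.card = I.k
  radius_nonneg : ∀ q ∈ C, 0 ≤ r q
  assign_mem : ∀ p, μ p ∈ C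
  dist_le : ∀ p, I.d p (μ p) ≤ r (μ p)
  load_le : ∀ q ∈ C, (Finset.univ.filter (fun p => μ p = q)).card ≤ I.cap q

/-- The sum of the radii. -/
def cost (C : Finset (Fin I.n)) (r : Fin I.n → ℝ) : ℝ := ∑ q ∈ C, r q

/-- The instance has a solution. -/
def Feasible : Prop := ∃ C r μ, I.IsSolution C r μ

/-- The optimal cost (used for feasible instances only). -/
def opt : ℝ := sInf {c : ℝ | ∃ C r μ, I.IsSolution C r μ ∧ c = I.cost C r}

/-- All pairwise distances are integers. -/
def IntegerDistances : Prop := ∀ p q, ∃ m : ℕ, I.d p q = m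

end CSRInstance

/-! ### The machine model: a randomized real RAM

A machine has word registers and a word memory (natural numbers), and real registers and a real
memory (real numbers). Registers are addressed by constants of the program, memory cells by the
contents of word registers. Every instruction costs one step. Reals can be added, subtracted,
multiplied, divided and compared; they cannot be rounded or converted to words. -/
namespace RAM

/-- Arithmetic on words: truncated subtraction, quotient and remainder as usual. -/
inductive WordOp where
  | add | sub | mul | div | mod

def WordOp.eval : WordOp → ℕ → ℕ → ℕ
  | .add, a, b => a + b
  | .sub, a, b => a - b
  | .mul, a, b => a * b
  | .div, a, b => a / b
  | .mod, a, b => a % b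

inductive RealOp where
  | add | sub | mul | div

def RealOp.eval : RealOp → ℝ → ℝ → ℝ
  | .add, a, b => a + b
  | .sub, a, b => a - b
  | .mul, a, b => a * b
  | .div, a, b => a / b

/-- Instructions. The arguments are register numbers, except for the constant `c` in `const` and
the jump targets `l`. -/
inductive Instr where
  /-- `word x := c` -/
  | const (x c : ℕ)
  /-- `word x := word y ∘ word z` -/
  | wordOp (o : WordOp) (x y z : ℕ)
  /-- `word x := wordMem[word y]` -/
  | load (x y : ℕ)
  /-- `wordMem[word x] := word y` -/
  | store (x y : ℕ)
  /-- `word x :=` a uniformly random element of `{0, …, word y - 1}` (and `0` if `word y = 0`) -/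
  | rand (x y : ℕ)
  /-- `real x := word y` -/
  | cast (x y : ℕ)
  /-- `real x := real y ∘ real z` -/
  | realOp (o : RealOp) (x y z : ℕ)
  /-- `real x := realMem[word y]` -/
  | realLoad (x y : ℕ)
  /-- `realMem[word x] := real y` -/
  | realStore (x y : ℕ)
  /-- `goto l` -/
  | jump (l : ℕ)
  /-- `if word x < word y then goto l` -/
  | jumpLt (x y l : ℕ)
  /-- `if real x < real y then goto l` -/
  | realJumpLt (x y l : ℕ)
  | halt

/-- A program is a finite list of instructions. -/
abbrev Program := List Instr

structure State where
  pc : ℕ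
  word : ℕ → ℕ
  real : ℕ → ℝ
  wordMem : ℕ → ℕ
  realMem : ℕ → ℝ

namespace State

/-- Go to the next instruction. -/
def next (s : State) : State := { s with pc := s.pc + 1 }

def setWord (s : State) (x v : ℕ) : State := { s with word := Function.update s.word x v }

def setReal (s : State) (x : ℕ) (v : ℝ) : State := { s with real := Function.update s.real x v }

def setWordMem (s : State) (a v : ℕ) : State :=
  { s with wordMem := Function.update s.wordMem a v }

def setRealMem (s : State) (a : ℕ) (v : ℝ) : State :=
  { s with realMem := Function.update s.realMem a v }

end State

/-- The uniform distribution on `{0, …, m - 1}`, and the point mass at `0` if `m = 0`. -/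
def uniformBelow (m : ℕ) : PMF ℕ :=
  if h : 0 < m then
    PMF.uniformOfFinset (Finset.range m) (Finset.nonempty_range_iff.mpr h.ne')
  else PMF.pure 0

open scoped Classical in
/-- The distribution of the state after executing one instruction. -/
def exec (s : State) : Instr → PMF State
  | .const x c => PMF.pure (s.setWord x c).next
  | .wordOp o x y z => PMF.pure (s.setWord x (o.eval (s.word y) (s.word z))).next
  | .load x y => PMF.pure (s.setWord x (s.wordMem (s.word y))).next
  | .store x y => PMF.pure (s.setWordMem (s.word x) (s.word y)).next
  | .rand x y => (uniformBelow (s.word y)).map (fun v => (s.setWord x v).next)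
  | .cast x y => PMF.pure (s.setReal x (s.word y)).next
  | .realOp o x y z => PMF.pure (s.setReal x (o.eval (s.real y) (s.real z))).next
  | .realLoad x y => PMF.pure (s.setReal x (s.realMem (s.word y))).next
  | .realStore x y => PMF.pure (s.setRealMem (s.word x) (s.real y)).next
  | .jump l => PMF.pure { s with pc := l }
  | .jumpLt x y l => PMF.pure (if s.word x < s.word y then { s with pc := l } else s.next)
  | .realJumpLt x y l => PMF.pure (if s.real x < s.real y then { s with pc := l } else s.next)
  | .halt => PMF.pure s

/-- The machine has stopped: it is at a `halt` instruction or outside the program. -/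
def Halted (M : Program) (s : State) : Prop := M[s.pc]? = none ∨ M[s.pc]? = some .halt

/-- One step of the program `M`; a stopped machine does not change its state. -/
def step (M : Program) (s : State) : PMF State :=
  match M[s.pc]? with
  | none => PMF.pure s
  | some i => exec s i

/-- The distribution of the state after `t` steps from the state `s`. -/
def run (M : Program) (s : State) : ℕ → PMF State
  | 0 => PMF.pure s
  | t + 1 => (run M s t).bind (step M)

end RAM

namespace CSRInstance

variable {X : Type*} [MetricSpace X] (I : CSRInstance X)

/-- The initial state: `n` and `k` are in the word registers `0` and `1`, the capacity of point `i`
is in the word memory cell `i`, and the distance of the points `i` and `j` is in the real memory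
cell `i * n + j`. Everything else is `0`, and the program starts at its first instruction. -/
def input : RAM.State where
  pc := 0
  word := fun x => if x = 0 then I.n else if x = 1 then I.k else 0
  real := fun _ => 0
  wordMem := fun a => if h : a < I.n then I.cap ⟨a, h⟩ else 0
  realMem := fun a =>
    if h : a / I.n < I.n ∧ a % I.n < I.n then I.d ⟨a / I.n, h.1⟩ ⟨a % I.n, h.2⟩ else 0

/-- The centers that are output in a final state: `q` is a center if the word memory cell `q`
contains `1`. -/
def outCenters (s : RAM.State) : Finset (Fin I.n) :=
  Finset.univ.filter (fun q : Fin I.n => s.wordMem q = 1)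

/-- The radius of the center `q` is output in the real memory cell `q`. -/
def outRadius (s : RAM.State) (q : Fin I.n) : ℝ := s.realMem q

/-- The final state `s` outputs an `α`-approximate solution: the word memory cells `n + p`, for
`p < n`, contain the assignment `μ` of the points to the centers, which together with the centers
and radii in the output is a solution of cost at most `α * opt`. If the distances
are integers, then the radii have to be integers, too. -/
def OutputsApprox (α : ℝ) (s : RAM.State) : Prop :=
  ∃ μ : Fin I.n → Fin I.n, (∀ p : Fin I.n, s.wordMem (I.n + p) = μ p) ∧
    I.IsSolution (I.outCenters s) (I.outRadius s) μ ∧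
    I.cost (I.outCenters s) (I.outRadius s) ≤ α * I.opt ∧
    (I.IntegerDistances → ∀ q ∈ I.outCenters s, ∃ m : ℕ, I.outRadius s q = m)

end CSRInstance

/-- The function `2 ^ (C * k * log (k / ε))`, written so that it makes sense for all `k ≥ 1` and
`ε > 0`: `ε` is replaced by `min ε 1`, and the argument of the logarithm is increased by `2`. -/
def fptFactor (C : ℕ) (k : ℕ) (ε : ℝ) : ℝ :=
  (2 : ℝ) ^ ((C : ℝ) * k * Real.logb 2 (2 + k / min ε 1))

end

/-! Fix an optimal assignment with the least possible radii. It has at most `k` clusters of at most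
`U` points each, so `n ≤ k * U`. Call a cluster light if it has at most `U / k` points; all light
clusters together then fit under a single center. A heavy cluster has more than `n / k ^ 2` points,
so with probability at least `1 / 2` a sample of `12 * k ^ 3` random points contains a point of
every heavy cluster, and two different ones if the cluster has two.

Let the radius of cluster `q` be `L q` units. Clusters are treated by a sequence of balls. For an
untreated heavy cluster `i`, put a ball around a sample point of `i`; the radius `2 * L i` covers
the cluster, and it is increased by the radii of a maximal family `J` of untreated light clusters
that the enlarged ball contains. If `J` is empty, the ball serves `i`. Otherwise it serves `J`,
which respects the capacity, and `i` is served later by a ball of radius `2 * L i` around its second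
sample point. Maximality of `J` keeps the centers of the other untreated light clusters uncovered.
So when only light clusters are left, there is an uncovered point, and it lies in an untreated
cluster, because treated clusters are covered; a ball around it serves that cluster and a family
`J`. Every ball serves a cluster of its own, so there are at most `k` balls; their centers are
distinct, and each cluster pays at most four times its radius (`Par.Clusters.heavy_step`,
`Par.Clusters.light_step`, `Par.Clusters.exists_plan`).

Each center is either a sample point or the last point that the preceding balls leave uncovered.
Hence the balls can be guessed from boundedly many possibilities, provided the radii are multiples
of a known unit. The machine cannot round, so units come from the farthest-first traversal: one of
its `n` scales is within constant factors of the largest optimal radius (`Par.exists_scale`). With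
`e * k` units per scale, rounding up costs at most `8 / e` times the optimum after the factor four.

For each scale and guess the program assigns the points one by one by augmenting paths
(`Prog.augment_spec`). Only valid assignments are recorded, so wrong guesses are harmless, and the
best one is at least as good as the good guess (`Prog.main_spec`). The radii in the output are
distances to assigned points, or zero, hence integers for integer distances. There are `n` scales
and `n` insertions, with `k` rounds over point-ball pairs each, which gives `n ^ 3 * k ^ 2` steps
per guess up to a constant.

The program is written in a small structured language with a verified compiler (`Cmd.code_spec`).
Word sizes and running time follow from a check of the syntax (`Cmd.chk_spec`). Only the drawing of
the sample is random; `sample_outcome` carries a union bound through it. -/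

noncomputable section

namespace RAM

/-! ### Deterministic runs of the machine -/

/-- All words of the state are at most `W`. -/
def Bdd (W : ℕ) (s : State) : Prop := ∀ a, s.word a ≤ W ∧ s.wordMem a ≤ W

/-- The program `M` contains the code `l` at the position `b`. -/
def CodeAt (M : Program) (b : ℕ) (l : List Instr) : Prop :=
  ∃ p q, M = p ++ l ++ q ∧ p.length = b

theorem CodeAt.left {M : Program} {b : ℕ} {l l' : List Instr} (h : CodeAt M b (l ++ l')) :
    CodeAt M b l := by
  obtain ⟨p, q, rfl, hp⟩ := h
  exact ⟨p, l' ++ q, by simp, hp⟩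

theorem CodeAt.right {M : Program} {b : ℕ} {l l' : List Instr} (h : CodeAt M b (l ++ l')) :
    CodeAt M (b + l.length) l' := by
  obtain ⟨p, q, rfl, hp⟩ := h
  exact ⟨p ++ l, q, by simp, by simp [hp]⟩

theorem CodeAt.get {M : Program} {b : ℕ} {i : Instr} {l : List Instr} (h : CodeAt M b (i :: l)) :
    M[b]? = some i := by
  obtain ⟨p, q, rfl, hp⟩ := h
  simp [← hp]

theorem CodeAt.tail {M : Program} {b : ℕ} {i : Instr} {l : List Instr} (h : CodeAt M b (i :: l)) :
    CodeAt M (b + 1) l := by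
  obtain ⟨p, q, rfl, hp⟩ := h
  exact ⟨p ++ [i], q, by simp, by simp [hp]⟩

/-- The machine goes deterministically from `s` to `s'` in `m` steps, through states whose words
are at most `W`. -/
def Run (M : Program) (W : ℕ) : State → ℕ → State → Prop
  | s, 0, s' => s' = s
  | s, m + 1, s' => ∃ s₁, step M s = PMF.pure s₁ ∧ Bdd W s₁ ∧ Run M W s₁ m s'

theorem Run.trans {M : Program} {W m m' : ℕ} {s s' s'' : State} (h : Run M W s m s')
    (h' : Run M W s' m' s'') : Run M W s (m + m') s'' := by
  induction m generalizing s with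
  | zero => cases h; simpa using h'
  | succ m ih =>
    obtain ⟨s₁, h₁, h₂, h₃⟩ := h
    rw [Nat.add_right_comm]
    exact ⟨s₁, h₁, h₂, ih h₃⟩

theorem Run.bdd {M : Program} {W m : ℕ} {s s' : State} (h : Run M W s m s') (hs : Bdd W s) :
    Bdd W s' := by
  induction m generalizing s with
  | zero => cases h; exact hs
  | succ m ih =>
    obtain ⟨s₁, h₁, h₂, h₃⟩ := h
    exact ih h₃ h₂

theorem Run.of_step {M : Program} {W : ℕ} {s s' : State} (h : step M s = PMF.pure s')
    (hb : Bdd W s') : Run M W s 1 s' := ⟨s', h, hb, rfl⟩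

theorem step_of_get {M : Program} {s : State} {i : Instr} (h : M[s.pc]? = some i) :
    step M s = exec s i := by simp [step, h]

/-- Instructions that are neither jumps nor random nor `halt`. -/
def Straight : Instr → Prop
  | .const _ _ | .wordOp _ _ _ _ | .load _ _ | .store _ _ | .cast _ _ | .realOp _ _ _ _
  | .realLoad _ _ | .realStore _ _ => True
  | _ => False

/-- The effect of a straight-line instruction. -/
def sexec (s : State) : Instr → State
  | .const x c => (s.setWord x c).next
  | .wordOp o x y z => (s.setWord x (o.eval (s.word y) (s.word z))).next
  | .load x y => (s.setWord x (s.wordMem (s.word y))).next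
  | .store x y => (s.setWordMem (s.word x) (s.word y)).next
  | .cast x y => (s.setReal x (s.word y)).next
  | .realOp o x y z => (s.setReal x (o.eval (s.real y) (s.real z))).next
  | .realLoad x y => (s.setReal x (s.realMem (s.word y))).next
  | .realStore x y => (s.setRealMem (s.word x) (s.real y)).next
  | _ => s

theorem exec_straight {i : Instr} (h : Straight i) (s : State) :
    exec s i = PMF.pure (sexec s i) := by
  cases i <;> simp_all [Straight, exec, sexec]

theorem sexec_pc {i : Instr} (h : Straight i) (s : State) : (sexec s i).pc = s.pc + 1 := by
  cases i <;> simp_all [Straight, sexec, State.next, State.setWord, State.setReal,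
    State.setWordMem, State.setRealMem]

/-- The straight-line code `l` leads from `s` to `s'` through states with words at most `W`. -/
def SRun (W : ℕ) : List Instr → State → State → Prop
  | [], s, s' => s' = s
  | i :: l, s, s' => Straight i ∧ Bdd W (sexec s i) ∧ SRun W l (sexec s i) s'

theorem SRun.append {W : ℕ} {l l' : List Instr} {s s' s'' : State} (h : SRun W l s s')
    (h' : SRun W l' s' s'') : SRun W (l ++ l') s s'' := by
  induction l generalizing s with
  | nil => cases h; simpa using h'
  | cons i l ih => exact ⟨h.1, h.2.1, ih h.2.2⟩

theorem SRun.bdd {W : ℕ} {l : List Instr} {s s' : State} (h : SRun W l s s') (hs : Bdd W s) :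
    Bdd W s' := by
  induction l generalizing s with
  | nil => cases h; exact hs
  | cons i l ih => exact ih h.2.2 h.2.1

theorem SRun.pc {W : ℕ} {l : List Instr} {s s' : State} (h : SRun W l s s') :
    s'.pc = s.pc + l.length := by
  induction l generalizing s with
  | nil => cases h; rfl
  | cons i l ih => rw [ih h.2.2, sexec_pc h.1, List.length_cons]; omega

theorem SRun.run {M : Program} {W : ℕ} {l : List Instr} {s s' : State} (h : SRun W l s s')
    (hc : CodeAt M s.pc l) : Run M W s l.length s' := by
  induction l generalizing s with
  | nil => exact h
  | cons i l ih =>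
    refine ⟨sexec s i, ?_, h.2.1, ih h.2.2 ?_⟩
    · rw [step_of_get hc.get, exec_straight h.1]
    · rw [sexec_pc h.1]; exact hc.tail

theorem Bdd.setWord {W : ℕ} {s : State} (h : Bdd W s) (x : ℕ) {v : ℕ} (hv : v ≤ W) :
    Bdd W (s.setWord x v).next := fun a => by
  refine ⟨?_, (h a).2⟩
  simp only [State.next, State.setWord, Function.update_apply]
  split
  · exact hv
  · exact (h a).1

theorem Bdd.setWordMem {W : ℕ} {s : State} (h : Bdd W s) (x : ℕ) {v : ℕ} (hv : v ≤ W) :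
    Bdd W (s.setWordMem x v).next := fun a => by
  refine ⟨(h a).1, ?_⟩
  simp only [State.next, State.setWordMem, Function.update_apply]
  split
  · exact hv
  · exact (h a).2

theorem Bdd.setReal {W : ℕ} {s : State} (h : Bdd W s) (x : ℕ) (v : ℝ) :
    Bdd W (s.setReal x v).next := h

theorem Bdd.setRealMem {W : ℕ} {s : State} (h : Bdd W s) (x : ℕ) (v : ℝ) :
    Bdd W (s.setRealMem x v).next := h

theorem Bdd.setPc {W : ℕ} {s : State} (h : Bdd W s) (l : ℕ) : Bdd W { s with pc := l } := h

/-- `s'` differs from `s` only in the program counter and in registers `≥ t` (words) and `≥ u`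
(reals). -/
structure Same (t u : ℕ) (s s' : State) : Prop where
  word : ∀ x < t, s'.word x = s.word x
  real : ∀ x < u, s'.real x = s.real x
  wordMem : s'.wordMem = s.wordMem
  realMem : s'.realMem = s.realMem

theorem Same.refl (t u : ℕ) (s : State) : Same t u s s := ⟨fun _ _ => rfl, fun _ _ => rfl, rfl, rfl⟩

theorem Same.trans {t t' u u' : ℕ} {s s' s'' : State} (h : Same t u s s') (h' : Same t' u' s' s'')
    (ht : t ≤ t') (hu : u ≤ u') : Same t u s s'' :=
  ⟨fun x hx => (h'.word x (hx.trans_le ht)).trans (h.word x hx),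
    fun x hx => (h'.real x (hx.trans_le hu)).trans (h.real x hx),
    h'.wordMem.trans h.wordMem, h'.realMem.trans h.realMem⟩

theorem Same.setWord {t u : ℕ} {s s' : State} (h : Same t u s s') {x : ℕ} (hx : t ≤ x) (v : ℕ) :
    Same t u s (s'.setWord x v).next :=
  ⟨fun y hy => by simp [State.next, State.setWord, (hy.trans_le hx).ne, h.word y hy],
    h.real, h.wordMem, h.realMem⟩

theorem Same.setReal {t u : ℕ} {s s' : State} (h : Same t u s s') {x : ℕ} (hx : u ≤ x) (v : ℝ) :
    Same t u s (s'.setReal x v).next :=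
  ⟨h.word, fun y hy => by simp [State.next, State.setReal, (hy.trans_le hx).ne, h.real y hy],
    h.wordMem, h.realMem⟩

@[simp] theorem word_setWord_self (s : State) (x v : ℕ) : (s.setWord x v).next.word x = v := by
  simp [State.next, State.setWord]

@[simp] theorem real_setReal_self (s : State) (x : ℕ) (v : ℝ) :
    (s.setReal x v).next.real x = v := by
  simp [State.next, State.setReal]

end RAM

/-! ### Structured programs -/

namespace Structured

open RAM

/-- The store of a structured program: word and real variables, and arrays of words and of reals.
The variable `0` contains the number `n` of points and is never changed. -/
structure Store where
  v : ℕ → ℕ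
  rv : ℕ → ℝ
  A : ℕ → ℕ → ℕ
  B : ℕ → ℕ → ℝ

namespace Store

def setV (σ : Store) (x m : ℕ) : Store := { σ with v := Function.update σ.v x m }

def setR (σ : Store) (x : ℕ) (r : ℝ) : Store := { σ with rv := Function.update σ.rv x r }

def setA (σ : Store) (a i m : ℕ) : Store :=
  { σ with A := Function.update σ.A a (Function.update (σ.A a) i m) }

def setB (σ : Store) (a i : ℕ) (r : ℝ) : Store :=
  { σ with B := Function.update σ.B a (Function.update (σ.B a) i r) }

end Store

/-- The array `0` of words has the length `2 * n`, and its indices are taken modulo `2 * n`. -/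
def wix (n a i : ℕ) : ℕ := if a = 0 then i % (2 * n) else i

/-- The array `0` of reals has the length `n * n`, and its indices are taken modulo `n * n`. -/
def rix (n a i : ℕ) : ℕ := if a = 0 then i % (n * n) else i

/-- The address of an entry of an array of words. -/
def wad (n a i : ℕ) : ℕ := if a = 0 then i else 2 * n + 16 * i + a

/-- The address of an entry of an array of reals. -/
def rad (n a i : ℕ) : ℕ := if a = 0 then i else n * n + 16 * i + a

/-- Word expressions. -/
inductive E where
  | c (m : ℕ)
  | v (x : ℕ)
  | op (o : WordOp) (a b : E)
  | arr (a : ℕ) (i : E)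

namespace E

def ev (σ : Store) : E → ℕ
  | c m => m
  | v x => σ.v x
  | op o a b => o.eval (a.ev σ) (b.ev σ)
  | arr a i => σ.A a (wix (σ.v 0) a (i.ev σ))

/-- The values of all subexpressions and the addresses are at most `W`. -/
def Ok (W : ℕ) (σ : Store) : E → Prop
  | c m => m ≤ W
  | v x => x < 64
  | op o a b => a.Ok W σ ∧ b.Ok W σ ∧ o.eval (a.ev σ) (b.ev σ) ≤ W
  | arr a i => a < 16 ∧ i.Ok W σ ∧ 2 * σ.v 0 + 16 * i.ev σ + 16 ≤ W

/-- Code that replaces an index in the register `t` by the address. -/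
def addrCode (a t : ℕ) : List Instr :=
  if a = 0 then [.const (t + 1) 2, .wordOp .mul (t + 1) (t + 1) 0, .wordOp .mod t t (t + 1)]
  else [.const (t + 1) 16, .wordOp .mul t t (t + 1), .const (t + 1) a, .wordOp .add t t (t + 1),
    .wordOp .add t t 0, .wordOp .add t t 0]

/-- Code that computes the value of the expression in the register `t`. -/
def code : E → ℕ → List Instr
  | c m, t => [.const t m]
  -- There is no instruction that copies a register, so zero is added.
  | v x, t => [.const t 0, .wordOp .add t x t]
  | op o a b, t => a.code t ++ b.code (t + 1) ++ [.wordOp o t t (t + 1)]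
  | arr a i, t => i.code t ++ addrCode a t ++ [.load t t]

end E

/-- The store is represented by the state of the machine. -/
structure Rel (σ : Store) (s : State) : Prop where
  word : ∀ x < 64, s.word x = σ.v x
  real : ∀ x < 64, s.real x = σ.rv x
  mem : ∀ a < 16, ∀ i, (a = 0 → i < 2 * σ.v 0) → s.wordMem (wad (σ.v 0) a i) = σ.A a i
  rmem : ∀ a < 16, ∀ i, (a = 0 → i < σ.v 0 * σ.v 0) → s.realMem (rad (σ.v 0) a i) = σ.B a i

theorem Rel.same {σ : Store} {s s' : State} (h : Rel σ s) {t u : ℕ} (hs : Same t u s s')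
    (ht : 64 ≤ t) (hu : 64 ≤ u) : Rel σ s' :=
  ⟨fun x hx => (hs.word x (hx.trans_le ht)).trans (h.word x hx),
    fun x hx => (hs.real x (hx.trans_le hu)).trans (h.real x hx),
    fun a ha i hi => by rw [hs.wordMem]; exact h.mem a ha i hi,
    fun a ha i hi => by rw [hs.realMem]; exact h.rmem a ha i hi⟩

theorem E.addr_spec {W : ℕ} {a t : ℕ} {s : State} (ha : a < 16) (ht : 64 ≤ t) (hb : Bdd W s)
    (hW : 2 * s.word 0 + 16 * s.word t + 16 ≤ W) (u : ℕ) :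
    ∃ s', SRun W (E.addrCode a t) s s' ∧ Same t u s s' ∧
      s'.word t = wad (s.word 0) a (wix (s.word 0) a (s.word t)) := by
  have h0 : t ≠ 0 := by omega
  have h1 : (0 : ℕ) ≠ t := by omega
  have h2 : t ≠ t + 1 := by omega
  by_cases h : a = 0
  · simp only [E.addrCode, h, if_true]
    refine ⟨_, ⟨trivial, ?_, trivial, ?_, trivial, ?_, rfl⟩, ?_, ?_⟩
    · exact hb.setWord _ (by omega)
    · refine (hb.setWord _ (by omega)).setWord _ ?_
      simp [sexec, State.setWord, State.next, WordOp.eval]; omega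
    · refine ((hb.setWord _ (by omega)).setWord _ ?_).setWord _ ?_
      · simp [sexec, State.setWord, State.next, WordOp.eval]; omega
      · simp only [sexec, State.setWord, State.next, WordOp.eval]
        refine (Nat.mod_le _ _).trans ?_
        simp; omega
    · exact (((Same.refl t u s).setWord (by omega) _).setWord (by omega) _).setWord le_rfl _
    · simp [sexec, State.setWord, State.next, WordOp.eval, wad, wix]
  · simp only [E.addrCode, h, if_false]
    have e1 : ∀ x, x * 16 + a + s.word 0 = s.word 0 + 16 * x + a := fun x => by ring
    have h3 : ∀ x y z : ℕ, x ≤ y → y + z ≤ W → x ≤ W := fun x y z _ _ => by omega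
    refine ⟨_, ⟨trivial, ?_, trivial, ?_, trivial, ?_, trivial, ?_, trivial, ?_, trivial, ?_, rfl⟩,
      ?_, ?_⟩
    · exact hb.setWord _ (by omega)
    · refine (hb.setWord _ (by omega)).setWord _ ?_
      simp [sexec, State.setWord, State.next, WordOp.eval]; omega
    · refine ((hb.setWord _ (by omega)).setWord _ ?_).setWord _ (by omega)
      simp [sexec, State.setWord, State.next, WordOp.eval]; omega
    · refine (((hb.setWord _ (by omega)).setWord _ ?_).setWord _ (by omega)).setWord _ ?_ <;>
      · simp [sexec, State.setWord, State.next, WordOp.eval]; omega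
    · refine ((((hb.setWord _ (by omega)).setWord _ ?_).setWord _ (by omega)).setWord _ ?_).setWord
        _ ?_ <;>
      · simp [sexec, State.setWord, State.next, WordOp.eval, h1]; omega
    · refine (((((hb.setWord _ (by omega)).setWord _ ?_).setWord _ (by omega)).setWord _ ?_).setWord
        _ ?_).setWord _ ?_ <;>
      · simp [sexec, State.setWord, State.next, WordOp.eval, h1]; omega
    · exact ((((((Same.refl t u s).setWord (by omega) _).setWord le_rfl _).setWord
        (by omega) _).setWord le_rfl _).setWord le_rfl _).setWord le_rfl _
    · simp [sexec, State.setWord, State.next, WordOp.eval, h1, wad, wix, h]; ring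

/-- This is the purpose of the modulus: accesses to array `0` stay in the region in front of the
interleaved arrays, so the correctness of the compiler needs no conditions on the indices. -/
theorem wix_lt {n a i : ℕ} (hn : 0 < n) : a = 0 → wix n a i < 2 * n := by
  intro h; simp only [wix, h, if_true]; exact Nat.mod_lt _ (by omega)

theorem rix_lt {n a i : ℕ} (hn : 0 < n) : a = 0 → rix n a i < n * n := by
  intro h; simp only [rix, h, if_true]; exact Nat.mod_lt _ (by positivity)

/-- The registers from `t` on serve as a stack. Everything below `t` survives, in particular the
variables, which live below `64`. -/
theorem E.code_spec {W : ℕ} {σ : Store} (hn : 0 < σ.v 0) (u : ℕ) (hu : 64 ≤ u) (e : E) :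
    ∀ (t : ℕ) (s : State), 64 ≤ t → Rel σ s → Bdd W s → e.Ok W σ →
      ∃ s', SRun W (e.code t) s s' ∧ Same t u s s' ∧ s'.word t = e.ev σ := by
  induction e with
  | c m =>
    intro t s ht hr hb ho
    exact ⟨_, ⟨trivial, hb.setWord _ ho, rfl⟩, (Same.refl t u s).setWord le_rfl _, by
      simp [sexec, E.ev]⟩
  | v x =>
    intro t s ht hr hb ho
    have hx : x ≠ t := by simp only [E.Ok] at ho; omega
    refine ⟨_, ⟨trivial, hb.setWord _ (Nat.zero_le _), trivial,
      (hb.setWord _ (Nat.zero_le _)).setWord _ ?_, rfl⟩,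
      ((Same.refl t u s).setWord le_rfl _).setWord le_rfl _, ?_⟩
    · simp [sexec, State.setWord, State.next, WordOp.eval, hx]; exact (hb x).1
    · simp [sexec, State.setWord, State.next, WordOp.eval, hx, E.ev]; exact hr.word x ho
  | op o a b iha ihb =>
    intro t s ht hr hb ho
    obtain ⟨s₁, h₁, h₂, h₃⟩ := iha t s ht hr hb ho.1
    obtain ⟨s₂, k₁, k₂, k₃⟩ := ihb (t + 1) s₁ (by omega) (hr.same h₂ ht hu) (h₁.bdd hb) ho.2.1
    have e₁ : s₂.word t = a.ev σ := (k₂.word t (by omega)).trans h₃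
    refine ⟨_, (h₁.append k₁).append ⟨trivial, (k₁.bdd (h₁.bdd hb)).setWord _ ?_, rfl⟩,
      (h₂.trans k₂ (by omega) le_rfl).setWord le_rfl _, ?_⟩
    · rw [e₁, k₃]; exact ho.2.2
    · simp [sexec, e₁, k₃, E.ev]
  | arr a i ih =>
    intro t s ht hr hb ho
    obtain ⟨s₁, h₁, h₂, h₃⟩ := ih t s ht hr hb ho.2.1
    have hr₁ := hr.same h₂ ht hu
    have e0 : s₁.word 0 = σ.v 0 := hr₁.word 0 (by omega)
    obtain ⟨s₂, k₁, k₂, k₃⟩ := E.addr_spec ho.1 ht (h₁.bdd hb)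
      (by rw [e0, h₃]; exact ho.2.2) u
    have hb₂ := k₁.bdd (h₁.bdd hb)
    refine ⟨_, (h₁.append k₁).append ⟨trivial, hb₂.setWord _ (hb₂ _).2, rfl⟩,
      (h₂.trans k₂ le_rfl le_rfl).setWord le_rfl _, ?_⟩
    simp only [sexec, word_setWord_self, k₃, E.ev, e0, h₃]
    exact (hr₁.same k₂ ht hu).mem a ho.1 _ (wix_lt hn)

/-- Real expressions. -/
inductive RE where
  | v (x : ℕ)
  | cast (e : E)
  | op (o : RealOp) (a b : RE)
  | arr (a : ℕ) (i : E)

namespace RE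

def ev (σ : Store) : RE → ℝ
  | v x => σ.rv x
  | cast e => e.ev σ
  | op o a b => o.eval (a.ev σ) (b.ev σ)
  | arr a i => σ.B a (rix (σ.v 0) a (i.ev σ))

def Ok (W : ℕ) (σ : Store) : RE → Prop
  | v x => x < 64
  | cast e => e.Ok W σ
  | op _ a b => a.Ok W σ ∧ b.Ok W σ
  | arr a i => a < 16 ∧ i.Ok W σ ∧ σ.v 0 * σ.v 0 + 16 * i.ev σ + 16 ≤ W

def addrCode (a t : ℕ) : List Instr :=
  if a = 0 then [.wordOp .mul (t + 1) 0 0, .wordOp .mod t t (t + 1)]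
  else [.const (t + 1) 16, .wordOp .mul t t (t + 1), .const (t + 1) a, .wordOp .add t t (t + 1),
    .wordOp .mul (t + 1) 0 0, .wordOp .add t t (t + 1)]

/-- Code that computes the value of the expression in the real register `t`. -/
def code : RE → ℕ → List Instr
  | v x, t => [.const 64 0, .cast t 64, .realOp .add t x t]
  | cast e, t => e.code 64 ++ [.cast t 64]
  | op o a b, t => a.code t ++ b.code (t + 1) ++ [.realOp o t t (t + 1)]
  | arr a i, t => i.code 64 ++ addrCode a 64 ++ [.realLoad t 64]

end RE

theorem RE.addr_spec {W : ℕ} {a t : ℕ} {s : State} (ha : a < 16) (ht : 64 ≤ t) (hb : Bdd W s)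
    (hW : s.word 0 * s.word 0 + 16 * s.word t + 16 ≤ W) (u : ℕ) :
    ∃ s', SRun W (RE.addrCode a t) s s' ∧ Same t u s s' ∧
      s'.word t = rad (s.word 0) a (rix (s.word 0) a (s.word t)) := by
  have h0 : t ≠ 0 := by omega
  have h1 : (0 : ℕ) ≠ t := by omega
  have h2 : t ≠ t + 1 := by omega
  set N := s.word 0 * s.word 0 with hN
  by_cases h : a = 0
  · simp only [RE.addrCode, h, if_true]
    refine ⟨_, ⟨trivial, ?_, trivial, ?_, rfl⟩, ?_, ?_⟩
    · refine hb.setWord _ ?_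
      simp [WordOp.eval, ← hN]; omega
    · refine (hb.setWord _ ?_).setWord _ ?_
      · simp [WordOp.eval, ← hN]; omega
      · simp only [sexec, State.setWord, State.next, WordOp.eval]
        refine (Nat.mod_le _ _).trans ?_
        simp; omega
    · exact ((Same.refl t u s).setWord (by omega) _).setWord le_rfl _
    · simp [sexec, State.setWord, State.next, WordOp.eval, rad, rix]
  · simp only [RE.addrCode, h, if_false]
    refine ⟨_, ⟨trivial, ?_, trivial, ?_, trivial, ?_, trivial, ?_, trivial, ?_, trivial, ?_, rfl⟩,
      ?_, ?_⟩
    · exact hb.setWord _ (by omega)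
    · refine (hb.setWord _ (by omega)).setWord _ ?_
      simp [sexec, State.setWord, State.next, WordOp.eval]; omega
    · refine ((hb.setWord _ (by omega)).setWord _ ?_).setWord _ (by omega)
      simp [sexec, State.setWord, State.next, WordOp.eval]; omega
    · refine (((hb.setWord _ (by omega)).setWord _ ?_).setWord _ (by omega)).setWord _ ?_ <;>
      · simp [sexec, State.setWord, State.next, WordOp.eval]; omega
    · refine ((((hb.setWord _ (by omega)).setWord _ ?_).setWord _ (by omega)).setWord _ ?_).setWord
        _ ?_ <;>
      · simp [sexec, State.setWord, State.next, WordOp.eval, h1, ← hN]; omega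
    · refine (((((hb.setWord _ (by omega)).setWord _ ?_).setWord _ (by omega)).setWord _ ?_).setWord
        _ ?_).setWord _ ?_ <;>
      · simp [sexec, State.setWord, State.next, WordOp.eval, h1, ← hN]; omega
    · exact ((((((Same.refl t u s).setWord (by omega) _).setWord le_rfl _).setWord
        (by omega) _).setWord le_rfl _).setWord (by omega) _).setWord le_rfl _
    · simp [sexec, State.setWord, State.next, WordOp.eval, h1, rad, rix, h, ← hN]; ring

/-- Only the real registers need a stack that starts at `t`. No word is kept between real
subexpressions, so word indices are always computed from register `64` on. -/
theorem RE.code_spec {W : ℕ} {σ : Store} (hn : 0 < σ.v 0) (e : RE) :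
    ∀ (t : ℕ) (s : State), 64 ≤ t → Rel σ s → Bdd W s → e.Ok W σ →
      ∃ s', SRun W (e.code t) s s' ∧ Same 64 t s s' ∧ s'.real t = e.ev σ := by
  induction e with
  | v x =>
    intro t s ht hr hb ho
    have hx : x ≠ t := by simp only [RE.Ok] at ho; omega
    refine ⟨_, ⟨trivial, hb.setWord _ (Nat.zero_le _), trivial,
      hb.setWord _ (Nat.zero_le _), trivial,
      hb.setWord _ (Nat.zero_le _), rfl⟩,
      (((Same.refl 64 t s).setWord le_rfl _).setReal le_rfl _).setReal le_rfl _, ?_⟩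
    simp [sexec, State.setWord, State.setReal, State.next, RealOp.eval, hx, RE.ev]
    exact hr.real x ho
  | cast e =>
    intro t s ht hr hb ho
    obtain ⟨s₁, h₁, h₂, h₃⟩ := e.code_spec hn t ht 64 s le_rfl hr hb ho
    refine ⟨_, h₁.append ⟨trivial, (h₁.bdd hb).setReal _ _, rfl⟩, h₂.setReal le_rfl _, ?_⟩
    simp [sexec, h₃, RE.ev]
  | op o a b iha ihb =>
    intro t s ht hr hb ho
    obtain ⟨s₁, h₁, h₂, h₃⟩ := iha t s ht hr hb ho.1
    obtain ⟨s₂, k₁, k₂, k₃⟩ := ihb (t + 1) s₁ (by omega) (hr.same h₂ le_rfl ht) (h₁.bdd hb) ho.2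
    have e₁ : s₂.real t = a.ev σ := (k₂.real t (by omega)).trans h₃
    refine ⟨_, (h₁.append k₁).append ⟨trivial, (k₁.bdd (h₁.bdd hb)).setReal _ _, rfl⟩,
      (h₂.trans k₂ le_rfl (by omega)).setReal le_rfl _, ?_⟩
    simp [sexec, e₁, k₃, RE.ev]
  | arr a i =>
    intro t s ht hr hb ho
    obtain ⟨s₁, h₁, h₂, h₃⟩ := i.code_spec hn t ht 64 s le_rfl hr hb ho.2.1
    have hr₁ := hr.same h₂ le_rfl ht
    have e0 : s₁.word 0 = σ.v 0 := hr₁.word 0 (by omega)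
    obtain ⟨s₂, k₁, k₂, k₃⟩ := RE.addr_spec ho.1 (le_refl 64) (h₁.bdd hb)
      (by rw [e0, h₃]; exact ho.2.2) t
    have hb₂ := k₁.bdd (h₁.bdd hb)
    refine ⟨_, (h₁.append k₁).append ⟨trivial, hb₂.setReal _ _, rfl⟩,
      (h₂.trans k₂ le_rfl le_rfl).setReal le_rfl _, ?_⟩
    simp only [sexec, real_setReal_self, k₃, RE.ev, e0, h₃]
    exact (hr₁.same k₂ le_rfl ht).rmem a ho.1 _ (rix_lt hn)

end Structured

/-! ### Commands, their semantics, and the correctness of the compiler. -/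

namespace Structured

open RAM

/-- Structured programs. `loop x y c` executes `c` for `x = 0, …, v y - 1`. -/
inductive Cmd where
  | skip
  | set (x : ℕ) (e : E)
  | rset (x : ℕ) (r : RE)
  | put (a : ℕ) (i e : E)
  | rput (a : ℕ) (i : E) (r : RE)
  | seq (c d : Cmd)
  | ifLt (e e' : E) (c d : Cmd)
  | ifRlt (r r' : RE) (c d : Cmd)
  | loop (x y : ℕ) (c : Cmd)

theorem step_at {M : Program} {s : State} {b : ℕ} {i : Instr} (hp : s.pc = b)
    (h : M[b]? = some i) : step M s = exec s i := step_of_get (hp ▸ h)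

namespace Cmd

/-- The store after `i` iterations of the loop with the body `f` and the loop variable `x`. -/
def iter (f : Store → Store) (x : ℕ) (σ : Store) : ℕ → Store
  | 0 => σ
  | i + 1 => f ((iter f x σ i).setV x i)

open scoped Classical in
def eval : Cmd → Store → Store
  | skip, σ => σ
  | set x e, σ => σ.setV x (e.ev σ)
  | rset x r, σ => σ.setR x (r.ev σ)
  | put a i e, σ => σ.setA a (wix (σ.v 0) a (i.ev σ)) (e.ev σ)
  | rput a i r, σ => σ.setB a (rix (σ.v 0) a (i.ev σ)) (r.ev σ)
  | seq c d, σ => d.eval (c.eval σ)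
  | ifLt e e' c d, σ => if e.ev σ < e'.ev σ then c.eval σ else d.eval σ
  | ifRlt r r' c d, σ => if r.ev σ < r'.ev σ then c.eval σ else d.eval σ
  | loop x y c, σ => (iter c.eval x σ (σ.v y)).setV x (σ.v y)

/-- `x` is assigned to. -/
def modV : Cmd → ℕ → Bool
  | set x _, y => x == y
  | seq c d, y => c.modV y || d.modV y
  | ifLt _ _ c d, y => c.modV y || d.modV y
  | ifRlt _ _ c d, y => c.modV y || d.modV y
  | loop x _ c, y => x == y || c.modV y
  | _, _ => false

/-- The code of a program that starts at the position `b`. -/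
def code : Cmd → ℕ → List Instr
  | skip, _ => []
  | set x e, _ => e.code 64 ++ [.const 65 0, .wordOp .add x 64 65]
  | rset x r, _ => r.code 64 ++ [.const 64 0, .cast 65 64, .realOp .add x 64 65]
  | put a i e, _ => e.code 64 ++ i.code 65 ++ E.addrCode a 65 ++ [.store 65 64]
  | rput a i r, _ => r.code 64 ++ i.code 64 ++ RE.addrCode a 64 ++ [.realStore 64 64]
  | seq c d, b => c.code b ++ d.code (b + (c.code b).length)
  | ifLt e e' c d, b =>
    let p := e.code 64 ++ e'.code 65
    let k := d.code (b + p.length + 1)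
    let l := c.code (b + p.length + 1 + k.length + 1)
    p ++ (.jumpLt 64 65 (b + p.length + 1 + k.length + 1) ::
      (k ++ (.jump (b + p.length + 1 + k.length + 1 + l.length) :: l)))
  | ifRlt r r' c d, b =>
    let p := r.code 64 ++ r'.code 65
    let k := d.code (b + p.length + 1)
    let l := c.code (b + p.length + 1 + k.length + 1)
    p ++ (.realJumpLt 64 65 (b + p.length + 1 + k.length + 1) ::
      (k ++ (.jump (b + p.length + 1 + k.length + 1 + l.length) :: l)))
  | loop x y c, b =>
    let l := c.code (b + 3)
    [.const x 0, .jumpLt x y (b + 3), .jump (b + 3 + l.length + 3)] ++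
      (l ++ [.const 64 1, .wordOp .add x x 64, .jump (b + 1)])

open scoped Classical in
/-- The number of steps. -/
def steps : Cmd → Store → ℕ
  | skip, _ => 0
  | set _ e, _ => (e.code 64).length + 2
  | rset _ r, _ => (r.code 64).length + 3
  | put a i e, _ => (e.code 64 ++ i.code 65 ++ E.addrCode a 65).length + 1
  | rput a i r, _ => (r.code 64 ++ i.code 64 ++ RE.addrCode a 64).length + 1
  | seq c d, σ => c.steps σ + d.steps (c.eval σ)
  | ifLt e e' c d, σ => (e.code 64 ++ e'.code 65).length + 1 +
      if e.ev σ < e'.ev σ then c.steps σ else d.steps σ + 1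
  | ifRlt r r' c d, σ => (r.code 64 ++ r'.code 65).length + 1 +
      if r.ev σ < r'.ev σ then c.steps σ else d.steps σ + 1
  | loop x y c, σ => 1 + (∑ i ∈ Finset.range (σ.v y),
      (1 + c.steps ((iter c.eval x σ i).setV x i) + 3)) + 2

/-- The program is well-formed, and all words that occur are at most `W`. -/
def Ok (W : ℕ) : Cmd → Store → Prop
  | skip, _ => True
  | set x e, σ => 0 < x ∧ x < 64 ∧ e.Ok W σ
  | rset x r, σ => x < 64 ∧ r.Ok W σ
  | put a i e, σ => a < 16 ∧ i.Ok W σ ∧ 2 * σ.v 0 + 16 * i.ev σ + 16 ≤ W ∧ e.Ok W σ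
  | rput a i r, σ => a < 16 ∧ i.Ok W σ ∧ σ.v 0 * σ.v 0 + 16 * i.ev σ + 16 ≤ W ∧ r.Ok W σ
  | seq c d, σ => c.Ok W σ ∧ d.Ok W (c.eval σ)
  | ifLt e e' c d, σ => e.Ok W σ ∧ e'.Ok W σ ∧ (e.ev σ < e'.ev σ → c.Ok W σ) ∧
      (¬e.ev σ < e'.ev σ → d.Ok W σ)
  | ifRlt r r' c d, σ => r.Ok W σ ∧ r'.Ok W σ ∧ (r.ev σ < r'.ev σ → c.Ok W σ) ∧
      (¬r.ev σ < r'.ev σ → d.Ok W σ)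
  | loop x y c, σ => 0 < x ∧ x < 64 ∧ y < 64 ∧ x ≠ y ∧ c.modV x = false ∧ c.modV y = false ∧
      1 ≤ W ∧ ∀ i < σ.v y, c.Ok W ((iter c.eval x σ i).setV x i)

end Cmd

@[simp] theorem Store.setV_v (σ : Store) (x m y : ℕ) :
    (σ.setV x m).v y = if y = x then m else σ.v y := by
  simp [Store.setV, Function.update_apply]

@[simp] theorem Store.setV_rv (σ : Store) (x m : ℕ) : (σ.setV x m).rv = σ.rv := rfl
@[simp] theorem Store.setV_A (σ : Store) (x m : ℕ) : (σ.setV x m).A = σ.A := rfl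
@[simp] theorem Store.setV_B (σ : Store) (x m : ℕ) : (σ.setV x m).B = σ.B := rfl
@[simp] theorem Store.setR_v (σ : Store) (x : ℕ) (r : ℝ) : (σ.setR x r).v = σ.v := rfl
@[simp] theorem Store.setR_A (σ : Store) (x : ℕ) (r : ℝ) : (σ.setR x r).A = σ.A := rfl
@[simp] theorem Store.setR_B (σ : Store) (x : ℕ) (r : ℝ) : (σ.setR x r).B = σ.B := rfl
@[simp] theorem Store.setR_rv (σ : Store) (x : ℕ) (r : ℝ) (y : ℕ) :
    (σ.setR x r).rv y = if y = x then r else σ.rv y := by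
  simp [Store.setR, Function.update_apply]
@[simp] theorem Store.setA_v (σ : Store) (a i m : ℕ) : (σ.setA a i m).v = σ.v := rfl
@[simp] theorem Store.setA_rv (σ : Store) (a i m : ℕ) : (σ.setA a i m).rv = σ.rv := rfl
@[simp] theorem Store.setA_B (σ : Store) (a i m : ℕ) : (σ.setA a i m).B = σ.B := rfl
@[simp] theorem Store.setA_A (σ : Store) (a i m a' i' : ℕ) :
    (σ.setA a i m).A a' i' = if a' = a ∧ i' = i then m else σ.A a' i' := by
  by_cases h : a' = a
  · subst h; simp [Store.setA, Function.update_apply]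
  · simp [Store.setA, h]
@[simp] theorem Store.setB_v (σ : Store) (a i : ℕ) (r : ℝ) : (σ.setB a i r).v = σ.v := rfl
@[simp] theorem Store.setB_rv (σ : Store) (a i : ℕ) (r : ℝ) : (σ.setB a i r).rv = σ.rv := rfl
@[simp] theorem Store.setB_A (σ : Store) (a i : ℕ) (r : ℝ) : (σ.setB a i r).A = σ.A := rfl
@[simp] theorem Store.setB_B (σ : Store) (a i : ℕ) (r : ℝ) (a' i' : ℕ) :
    (σ.setB a i r).B a' i' = if a' = a ∧ i' = i then r else σ.B a' i' := by
  by_cases h : a' = a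
  · subst h; simp [Store.setB, Function.update_apply]
  · simp [Store.setB, h]

theorem Cmd.eval_v (c : Cmd) : ∀ (σ : Store) (y : ℕ), c.modV y = false →
    (c.eval σ).v y = σ.v y := by
  induction c with
  | skip => intro σ y _; rfl
  | set x e => intro σ y h; simp [modV] at h; simp [eval, Ne.symm h]
  | rset x r => intro σ y _; rfl
  | put a i e => intro σ y _; rfl
  | rput a i r => intro σ y _; rfl
  | seq c d hc hd =>
    intro σ y h; simp [modV] at h
    simp only [eval]; rw [hd _ _ h.2, hc _ _ h.1]
  | ifLt e e' c d hc hd =>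
    intro σ y h; simp [modV] at h
    simp only [eval]; split
    · exact hc _ _ h.1
    · exact hd _ _ h.2
  | ifRlt e e' c d hc hd =>
    intro σ y h; simp [modV] at h
    simp only [eval]; split
    · exact hc _ _ h.1
    · exact hd _ _ h.2
  | loop x z c hc =>
    intro σ y h; simp [modV] at h
    have : ∀ i, (iter c.eval x σ i).v y = σ.v y := by
      intro i
      induction i with
      | zero => rfl
      | succ i ih => rw [iter, hc _ _ h.2]; simp [Ne.symm h.1, ih]
    simp [eval, Ne.symm h.1, this]

theorem Cmd.iter_v {c : Cmd} {x y : ℕ} (σ : Store) (hxy : y ≠ x) (h : c.modV y = false) (i : ℕ) :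
    (iter c.eval x σ i).v y = σ.v y := by
  induction i with
  | zero => rfl
  | succ i ih => rw [iter, c.eval_v _ _ h]; simp [hxy, ih]

theorem Rel.setV {σ : Store} {s : State} (h : Rel σ s) {x : ℕ} (hx : 0 < x) (m : ℕ) :
    Rel (σ.setV x m) (s.setWord x m).next := by
  have h0 : (σ.setV x m).v 0 = σ.v 0 := by simp [hx.ne]
  refine ⟨fun y hy => ?_, h.real, ?_, ?_⟩
  · simp [State.setWord, State.next, Function.update_apply, h.word y hy]
  · rw [h0]; exact h.mem
  · rw [h0]; exact h.rmem

theorem Rel.setR {σ : Store} {s : State} (h : Rel σ s) (x : ℕ) (r : ℝ) :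
    Rel (σ.setR x r) (s.setReal x r).next := by
  refine ⟨h.word, fun y hy => ?_, h.mem, h.rmem⟩
  simp [State.setReal, State.next, Function.update_apply, h.real y hy]

theorem Rel.setA {σ : Store} {s : State} (h : Rel σ s) {a : ℕ} (ha : a < 16) (i m : ℕ)
    (hi : a = 0 → i < 2 * σ.v 0) :
    Rel (σ.setA a i m) (s.setWordMem (wad (σ.v 0) a i) m).next := by
  refine ⟨h.word, h.real, fun a' ha' i' hi' => ?_, h.rmem⟩
  simp only [Store.setA_v] at hi'
  -- Array `0` occupies the addresses below `2 * n`; the other arrays are interleaved above it and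
  -- separated by the residue modulo `16`.
  have : wad (σ.v 0) a' i' = wad (σ.v 0) a i ↔ a' = a ∧ i' = i := by
    refine ⟨fun he => ?_, fun he => by rw [he.1, he.2]⟩
    unfold wad at he
    split at he <;> split at he <;> omega
  simp [State.setWordMem, State.next, Function.update_apply, this, h.mem a' ha' i' hi']

theorem Rel.setB {σ : Store} {s : State} (h : Rel σ s) {a : ℕ} (ha : a < 16) (i : ℕ) (r : ℝ)
    (hi : a = 0 → i < σ.v 0 * σ.v 0) :
    Rel (σ.setB a i r) (s.setRealMem (rad (σ.v 0) a i) r).next := by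
  refine ⟨h.word, h.real, h.mem, fun a' ha' i' hi' => ?_⟩
  simp only [Store.setB_v] at hi'
  have : rad (σ.v 0) a' i' = rad (σ.v 0) a i ↔ a' = a ∧ i' = i := by
    refine ⟨fun he => ?_, fun he => by rw [he.1, he.2]⟩
    unfold rad at he
    split at he <;> split at he <;> omega
  simp [State.setRealMem, State.next, Function.update_apply, this, h.rmem a' ha' i' hi']

theorem Rel.setPc {σ : Store} {s : State} (h : Rel σ s) (l : ℕ) : Rel σ { s with pc := l } :=
  ⟨h.word, h.real, h.mem, h.rmem⟩

theorem E.value_le {W : ℕ} {σ : Store} {s : State} (hr : Rel σ s) (hb : Bdd W s)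
    (hn : 0 < σ.v 0) {e : E} (h : e.Ok W σ) : e.ev σ ≤ W := by
  cases e with
  | c m => exact h
  | v x => exact (hr.word x h).symm.le.trans (hb x).1
  | op o a b => exact h.2.2
  | arr a i =>
    simp only [E.ev]
    rw [← hr.mem a h.1 _ (wix_lt hn)]
    exact (hb _).2

theorem Cmd.put_spec {W : ℕ} {σ : Store} {s : State} {a : ℕ} {i e : E} (hr : Rel σ s)
    (hb : Bdd W s) (hn : 0 < σ.v 0) (ho : (put a i e).Ok W σ) (b : ℕ) :
    ∃ s', SRun W ((put a i e).code b) s s' ∧ Rel ((put a i e).eval σ) s' := by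
  obtain ⟨ha, hi, hW, he⟩ := ho
  obtain ⟨s₁, h₁, h₂, h₃⟩ := e.code_spec hn 64 le_rfl 64 s le_rfl hr hb he
  have hr₁ := hr.same h₂ le_rfl le_rfl
  obtain ⟨s₂, k₁, k₂, k₃⟩ := i.code_spec hn 64 le_rfl 65 s₁ (by omega) hr₁ (h₁.bdd hb) hi
  have hr₂ := hr₁.same k₂ (by omega) le_rfl
  have e0 : s₂.word 0 = σ.v 0 := hr₂.word 0 (by omega)
  obtain ⟨s₃, l₁, l₂, l₃⟩ := E.addr_spec (t := 65) ha (by omega) (k₁.bdd (h₁.bdd hb))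
    (by rw [e0, k₃]; exact hW) 64
  have hr₃ := hr₂.same l₂ (by omega) le_rfl
  have hb₃ := l₁.bdd (k₁.bdd (h₁.bdd hb))
  have e₆ : s₃.word 64 = e.ev σ := by
    rw [l₂.word 64 (by omega), k₂.word 64 (by omega), h₃]
  refine ⟨_, ((h₁.append k₁).append l₁).append ⟨trivial, hb₃.setWordMem _ (hb₃ _).1, rfl⟩, ?_⟩
  simp only [sexec, e₆, l₃, k₃, e0]
  exact hr₃.setA ha _ _ (wix_lt hn)

theorem Cmd.set_spec {W : ℕ} {σ : Store} {s : State} {x : ℕ} {e : E} (hr : Rel σ s)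
    (hb : Bdd W s) (hn : 0 < σ.v 0) (ho : (set x e).Ok W σ) (b : ℕ) :
    ∃ s', SRun W ((set x e).code b) s s' ∧ Rel ((set x e).eval σ) s' := by
  obtain ⟨hx, hx', he⟩ := ho
  obtain ⟨s₁, h₁, h₂, h₃⟩ := e.code_spec hn 64 le_rfl 64 s le_rfl hr hb he
  have hs : Same 64 64 s₁ (s₁.setWord 65 0).next := (Same.refl 64 64 s₁).setWord (by omega) _
  have hv : WordOp.add.eval ((s₁.setWord 65 0).next.word 64) ((s₁.setWord 65 0).next.word 65)
      = e.ev σ := by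
    simp [State.setWord, State.next, WordOp.eval, h₃]
  refine ⟨_, h₁.append ⟨trivial, (h₁.bdd hb).setWord _ (Nat.zero_le _), trivial, ?_, rfl⟩, ?_⟩
  · simp only [sexec]
    rw [hv]
    exact ((h₁.bdd hb).setWord _ (Nat.zero_le _)).setWord _ (E.value_le hr hb hn he)
  · simp only [sexec]
    rw [hv]
    exact ((hr.same h₂ le_rfl le_rfl).same hs le_rfl le_rfl).setV hx _

/-- Correctness of the compiler, by induction on the command. The last conjunct is part of the
induction because variable `0` determines the layout of the memory. -/
theorem Cmd.code_spec {W : ℕ} {M : Program} (c : Cmd) : ∀ (b : ℕ) (s : State) (σ : Store),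
    CodeAt M b (c.code b) → s.pc = b → Rel σ s → Bdd W s → 0 < σ.v 0 → c.Ok W σ →
      ∃ s', Run M W s (c.steps σ) s' ∧ s'.pc = b + (c.code b).length ∧ Rel (c.eval σ) s' ∧
        (c.eval σ).v 0 = σ.v 0 := by
  induction c with
  | skip => intro b s σ hc hp hr hb hn ho; exact ⟨s, rfl, hp, hr, rfl⟩
  | set x e =>
    intro b s σ hc hp hr hb hn ho
    obtain ⟨s', h₁, h₂⟩ := set_spec hr hb hn ho b
    refine ⟨s', ?_, by rw [h₁.pc, hp], h₂, by simp [eval, ho.1.ne]⟩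
    have := h₁.run (hp ▸ hc)
    simpa [code, steps] using this
  | rset x r =>
    intro b s σ hc hp hr hb hn ho
    obtain ⟨hx, he⟩ := ho
    obtain ⟨s₁, h₁, h₂, h₃⟩ := r.code_spec hn 64 s le_rfl hr hb he
    have hr₁ := hr.same h₂ le_rfl le_rfl
    have hb₁ := h₁.bdd hb
    have hs : SRun W ((rset x r).code b) s _ := h₁.append
      ⟨trivial, hb₁.setWord _ (Nat.zero_le _), trivial, hb₁.setWord _ (Nat.zero_le _), trivial,
        hb₁.setWord _ (Nat.zero_le _), rfl⟩
    refine ⟨_, ?_, by rw [hs.pc, hp], ?_, rfl⟩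
    · have := hs.run (hp ▸ hc)
      simpa [code, steps] using this
    · have h64 : Same 64 64 s₁ (((s₁.setWord 64 0).next).setReal 65
          ((0 : ℕ) : ℝ)).next :=
        ((Same.refl 64 64 s₁).setWord le_rfl _).setReal (by omega) _
      have := (hr₁.same h64 le_rfl le_rfl).setR x (r.ev σ)
      have e : RealOp.add.eval (((s₁.setWord 64 0).next.setReal 65 ((0 : ℕ) : ℝ)).next.real 64)
          (((s₁.setWord 64 0).next.setReal 65 ((0 : ℕ) : ℝ)).next.real 65) = r.ev σ := by
        simp [State.setWord, State.setReal, State.next, RealOp.eval, h₃]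
      rw [← e] at this
      simpa only [sexec, eval, e, word_setWord_self] using this
  | put a i e =>
    intro b s σ hc hp hr hb hn ho
    obtain ⟨s', h₁, h₂⟩ := put_spec hr hb hn ho b
    refine ⟨s', ?_, by rw [h₁.pc, hp], h₂, rfl⟩
    have := h₁.run (hp ▸ hc)
    simpa [code, steps, add_assoc] using this
  | rput a i r =>
    intro b s σ hc hp hr hb hn ho
    obtain ⟨ha, hi, hW, he⟩ := ho
    obtain ⟨s₁, h₁, h₂, h₃⟩ := r.code_spec hn 64 s le_rfl hr hb he
    have hr₁ := hr.same h₂ le_rfl le_rfl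
    obtain ⟨s₂, k₁, k₂, k₃⟩ := i.code_spec hn 65 (by omega) 64 s₁ le_rfl hr₁ (h₁.bdd hb) hi
    have hr₂ := hr₁.same k₂ le_rfl (by omega)
    have e0 : s₂.word 0 = σ.v 0 := hr₂.word 0 (by omega)
    obtain ⟨s₃, l₁, l₂, l₃⟩ := RE.addr_spec (t := 64) ha le_rfl (k₁.bdd (h₁.bdd hb))
      (by rw [e0, k₃]; exact hW) 65
    have hr₃ := hr₂.same l₂ le_rfl (by omega)
    have hb₃ := l₁.bdd (k₁.bdd (h₁.bdd hb))
    have e₆ : s₃.real 64 = r.ev σ := by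
      rw [l₂.real 64 (by omega), k₂.real 64 (by omega), h₃]
    have hs : SRun W ((rput a i r).code b) s _ :=
      ((h₁.append k₁).append l₁).append ⟨trivial, hb₃.setRealMem _ _, rfl⟩
    refine ⟨_, ?_, by rw [hs.pc, hp], ?_, rfl⟩
    · have := hs.run (hp ▸ hc)
      simpa [code, steps, add_assoc] using this
    · simp only [sexec, e₆, l₃, k₃, e0]
      exact hr₃.setB ha _ _ (rix_lt hn)
  | seq c d hc hd =>
    intro b s σ hC hp hr hb hn ho
    obtain ⟨s₁, h₁, h₂, h₃, h₄⟩ := hc b s σ hC.left hp hr hb hn ho.1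
    obtain ⟨s₂, k₁, k₂, k₃, k₄⟩ := hd _ s₁ _ hC.right h₂ h₃ (h₁.bdd hb) (h₄ ▸ hn) ho.2
    refine ⟨s₂, h₁.trans k₁, ?_, k₃, k₄.trans h₄⟩
    rw [k₂]; simp [code]; omega
  | ifLt e e' c d hc hd =>
    intro b s σ hC hp hr hb hn ho
    obtain ⟨he, he', hO, hO'⟩ := ho
    obtain ⟨s₁, h₁, h₂, h₃⟩ := e.code_spec hn 64 le_rfl 64 s le_rfl hr hb he
    have hr₁ := hr.same h₂ le_rfl le_rfl
    obtain ⟨s₂, k₁, k₂, k₃⟩ := e'.code_spec hn 64 le_rfl 65 s₁ (by omega) hr₁ (h₁.bdd hb) he'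
    have hr₂ := hr₁.same k₂ (by omega) le_rfl
    have hb₂ := k₁.bdd (h₁.bdd hb)
    have e₁ : s₂.word 64 = e.ev σ := (k₂.word 64 (by omega)).trans h₃
    have hS := h₁.append k₁
    simp only [code] at hC
    have hR := hS.run (hp ▸ hC.left)
    have hp₂ : s₂.pc = b + (e.code 64 ++ e'.code 65).length := by rw [hS.pc, hp]
    have hC₂ := hC.right
    have hg := hC₂.get
    have hC₃ := hC₂.tail
    have hC₄ := hC₃.right
    have hg₄ := hC₄.get
    have hC₅ := hC₄.tail
    have hj : step M s₂ = PMF.pure (if s₂.word 64 < s₂.word 65 then _ else s₂.next) :=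
      step_at hp₂ hg
    rw [e₁, k₃] at hj
    by_cases hlt : e.ev σ < e'.ev σ
    · rw [if_pos hlt] at hj
      obtain ⟨s₃, l₁, l₂, l₃, l₄⟩ := hc _ _ σ hC₅ rfl (hr₂.setPc _) (hb₂.setPc _) hn (hO hlt)
      refine ⟨s₃, ?_, ?_, by simpa [eval, hlt] using l₃, by simpa [eval, hlt] using l₄⟩
      · simp only [steps, hlt, if_true]
        exact (hR.trans (Run.of_step hj (hb₂.setPc _))).trans l₁
      · rw [l₂]; simp [code]; omega
    · rw [if_neg hlt] at hj
      have hr₂' : Rel σ s₂.next := hr₂.setPc _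
      have hb₂' : Bdd W s₂.next := hb₂
      obtain ⟨s₃, l₁, l₂, l₃, l₄⟩ := hd _ s₂.next σ hC₃.left (by simp [State.next, hp₂])
        hr₂' hb₂' hn (hO' hlt)
      have hb₃ := l₁.bdd hb₂'
      have hj' : step M s₃ = PMF.pure _ := step_at l₂ hg₄
      have hst : (ifLt e e' c d).steps σ = (e.code 64 ++ e'.code 65).length + 1 +
          (d.steps σ + 1) := by simp [steps, hlt]
      have hev : (ifLt e e' c d).eval σ = d.eval σ := by simp [eval, hlt]
      rw [hst, hev]
      refine ⟨_, (hR.trans (Run.of_step hj hb₂')).trans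
        (l₁.trans (Run.of_step hj' (hb₃.setPc _))), ?_, l₃.setPc _, l₄⟩
      simp [code]; omega
  | ifRlt e e' c d hc hd =>
    intro b s σ hC hp hr hb hn ho
    obtain ⟨he, he', hO, hO'⟩ := ho
    obtain ⟨s₁, h₁, h₂, h₃⟩ := e.code_spec hn 64 s le_rfl hr hb he
    have hr₁ := hr.same h₂ le_rfl le_rfl
    obtain ⟨s₂, k₁, k₂, k₃⟩ := e'.code_spec hn 65 s₁ (by omega) hr₁ (h₁.bdd hb) he'
    have hr₂ := hr₁.same k₂ le_rfl (by omega)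
    have hb₂ := k₁.bdd (h₁.bdd hb)
    have e₁ : s₂.real 64 = e.ev σ := (k₂.real 64 (by omega)).trans h₃
    have hS := h₁.append k₁
    simp only [code] at hC
    have hR := hS.run (hp ▸ hC.left)
    have hp₂ : s₂.pc = b + (e.code 64 ++ e'.code 65).length := by rw [hS.pc, hp]
    have hC₂ := hC.right
    have hg := hC₂.get
    have hC₃ := hC₂.tail
    have hC₄ := hC₃.right
    have hg₄ := hC₄.get
    have hC₅ := hC₄.tail
    have hj : step M s₂ = PMF.pure (if s₂.real 64 < s₂.real 65 then _ else s₂.next) :=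
      step_at hp₂ hg
    rw [e₁, k₃] at hj
    by_cases hlt : e.ev σ < e'.ev σ
    · rw [if_pos hlt] at hj
      obtain ⟨s₃, l₁, l₂, l₃, l₄⟩ := hc _ _ σ hC₅ rfl (hr₂.setPc _) (hb₂.setPc _) hn (hO hlt)
      refine ⟨s₃, ?_, ?_, by simpa [eval, hlt] using l₃, by simpa [eval, hlt] using l₄⟩
      · simp only [steps, hlt, if_true]
        exact (hR.trans (Run.of_step hj (hb₂.setPc _))).trans l₁
      · rw [l₂]; simp [code]; omega
    · rw [if_neg hlt] at hj
      have hr₂' : Rel σ s₂.next := hr₂.setPc _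
      have hb₂' : Bdd W s₂.next := hb₂
      obtain ⟨s₃, l₁, l₂, l₃, l₄⟩ := hd _ s₂.next σ hC₃.left (by simp [State.next, hp₂])
        hr₂' hb₂' hn (hO' hlt)
      have hb₃ := l₁.bdd hb₂'
      have hj' : step M s₃ = PMF.pure _ := step_at l₂ hg₄
      have hst : (ifRlt e e' c d).steps σ = (e.code 64 ++ e'.code 65).length + 1 +
          (d.steps σ + 1) := by simp [steps, hlt]
      have hev : (ifRlt e e' c d).eval σ = d.eval σ := by simp [eval, hlt]
      rw [hst, hev]
      refine ⟨_, (hR.trans (Run.of_step hj hb₂')).trans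
        (l₁.trans (Run.of_step hj' (hb₃.setPc _))), ?_, l₃.setPc _, l₄⟩
      simp [code]; omega
  | loop x y c ih =>
    intro b s σ hC hp hr hb hn ho
    obtain ⟨hx, hx', hy, hxy, hm, hm', hW, hO⟩ := ho
    simp only [code] at hC
    have hg0 := hC.left.get
    have hg1 := hC.left.tail.get
    have hg2 := hC.left.tail.tail.get
    have hCl : CodeAt M (b + 3) (c.code (b + 3)) := hC.right.left
    have hCe := hC.right.right
    simp only [List.length_cons, List.length_nil, zero_add, Nat.reduceAdd] at hCe hg1 hg2
    have hCe0 := hCe.get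
    have hCe1 := hCe.tail.get
    have hCe2 := hCe.tail.tail.get
    -- The invariant holds at the loop test, at position `b + 1`, where the loop variable already
    -- has the value `i`.
    have key : ∀ i ≤ σ.v y, ∃ s', Run M W s (1 + ∑ j ∈ Finset.range i,
        (1 + c.steps ((iter c.eval x σ j).setV x j) + 3)) s' ∧ s'.pc = b + 1 ∧
        Rel ((iter c.eval x σ i).setV x i) s' ∧ (iter c.eval x σ i).v 0 = σ.v 0 := by
      intro i
      induction i with
      | zero =>
        intro _
        refine ⟨_, Run.of_step (step_at hp hg0) (hb.setWord _ (Nat.zero_le _)), ?_,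
          hr.setV hx 0, rfl⟩
        simp [State.next, State.setWord, hp]
      | succ i ihi =>
        intro hi
        obtain ⟨s₁, h₁, h₂, h₃, h₄⟩ := ihi (by omega)
        have hb₁ := h₁.bdd hb
        have ex : s₁.word x = i := by rw [h₃.word x hx']; simp
        have ey : s₁.word y = σ.v y := by
          rw [h₃.word y hy]; simp [Ne.symm hxy, iter_v σ (Ne.symm hxy) hm']
        have hj : step M s₁ = PMF.pure (if s₁.word x < s₁.word y then _ else s₁.next) :=
          step_at h₂ hg1
        rw [ex, ey, if_pos (by omega)] at hj
        have h0 : ((iter c.eval x σ i).setV x i).v 0 = σ.v 0 := by simp [hx.ne, h₄]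
        obtain ⟨s₂, k₁, k₂, k₃, k₄⟩ := ih (b + 3) _ _ hCl rfl (h₃.setPc _) (hb₁.setPc _)
          (h0 ▸ hn) (hO i (by omega))
        have hb₂ := k₁.bdd (hb₁.setPc _)
        have ex₂ : s₂.word x = i := by
          rw [k₃.word x hx', c.eval_v _ _ hm]; simp
        set s₃ : State := ((s₂.setWord 64 1).next.setWord x (i + 1)).next with hs₃
        have he₃ : ((s₂.setWord 64 1).next.setWord x (WordOp.add.eval
            ((s₂.setWord 64 1).next.word x) ((s₂.setWord 64 1).next.word 64))).next = s₃ := by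
          simp [hs₃, State.setWord, State.next, WordOp.eval, hx'.ne, ex₂]
        have hb₃ : Bdd W s₃ :=
          (hb₂.setWord 64 hW).setWord _ (hi.trans (ey.symm.le.trans (hb₁ y).1))
        have hs : SRun W [.const 64 1, .wordOp .add x x 64] s₂ s₃ :=
          ⟨trivial, hb₂.setWord 64 hW, trivial, by simpa only [sexec, he₃] using hb₃,
            by simp only [SRun, sexec, he₃]⟩
        have hCe' : CodeAt M s₂.pc
            ([.const 64 1, .wordOp .add x x 64] ++ [.jump (b + 1)]) := by
          rw [k₂]; exact hCe
        have hR := hs.run hCe'.left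
        have hp₃ := hs.pc
        rw [k₂] at hp₃
        have hj₃ : step M s₃ = PMF.pure _ := step_at hp₃ hCe2
        rw [Finset.sum_range_succ, ← add_assoc]
        exact ⟨_, h₁.trans (((Run.of_step hj (hb₁.setPc _)).trans k₁).trans
          (hR.trans (Run.of_step hj₃ (hb₃.setPc _)))), rfl,
          ((k₃.same ((Same.refl 64 64 s₂).setWord le_rfl _) le_rfl le_rfl).setV hx
            (i + 1)).setPc (b + 1), k₄.trans h0⟩
    obtain ⟨s₁, h₁, h₂, h₃, h₄⟩ := key _ le_rfl
    have hb₁ := h₁.bdd hb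
    have ex : s₁.word x = σ.v y := by rw [h₃.word x hx']; simp
    have ey : s₁.word y = σ.v y := by
      rw [h₃.word y hy]; simp [Ne.symm hxy, iter_v σ (Ne.symm hxy) hm']
    have hj : step M s₁ = PMF.pure (if s₁.word x < s₁.word y then _ else s₁.next) :=
      step_at h₂ hg1
    rw [ex, ey, if_neg (lt_irrefl _)] at hj
    have hj' : step M s₁.next = PMF.pure _ := step_at (b := b + 2) (by
      simp [State.next, h₂]) hg2
    refine ⟨_, h₁.trans ((Run.of_step hj hb₁).trans (Run.of_step hj' (hb₁.setPc _))), ?_,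
      h₃.setPc _, ?_⟩
    · simp [code]; omega
    · simp [eval, hx.ne, h₄]

end Structured

namespace Structured

open RAM

/-! ### Syntactic bounds on words and running times -/

/-- Each variable `x` has a class `cl x`; the variables of the class `i` are bounded by `val i`.
All words are bounded by `val 0`. -/
structure Bnd (cl val : ℕ → ℕ) (σ : Store) : Prop where
  v : ∀ x, σ.v x ≤ val (cl x)
  A : ∀ a i, σ.A a i ≤ val 0

/-- The exponent of a power of `val 0` that bounds the value. -/
def E.deg : E → ℕ
  | c _ => 1
  | v _ => 1
  | op .add a b => max a.deg b.deg + 1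
  | op .mul a b => a.deg + b.deg
  | op .sub a _ => a.deg
  | op .div a _ => a.deg
  | op .mod a _ => a.deg
  | arr _ _ => 1

/-- A class passes through the operations whose result cannot exceed their first argument; of all
other expressions that are stored only the bound `val 0` is known. -/
def E.cls (cl : ℕ → ℕ) : E → ℕ
  | v x => cl x
  | op .sub a _ => a.cls cl
  | op .div a _ => a.cls cl
  | op .mod a _ => a.cls cl
  | _ => 0

/-- The constants are at most `2` because `val 0` is only assumed to be at least `2`. The degree
bound `3` leads to the word bound `64 * val 0 ^ 3`. -/
def E.chk : E → Bool
  | c m => m ≤ 2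
  | v x => x < 64
  | op o a b => a.chk && b.chk && (op o a b).deg ≤ 3
  | arr a i => a < 16 && i.chk

theorem E.deg_pos (e : E) : 1 ≤ e.deg := by
  induction e with
  | c m => exact le_rfl
  | v x => exact le_rfl
  | op o a b iha ihb => cases o <;> simp only [E.deg] <;> omega
  | arr a i => exact le_rfl

theorem E.deg_le {e : E} (h : e.chk = true) : e.deg ≤ 3 := by
  cases e with
  | c m => simp [E.deg]
  | v x => simp [E.deg]
  | op o a b => simp only [E.chk, Bool.and_eq_true, decide_eq_true_eq] at h; exact h.2
  | arr a i => simp [E.deg]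

theorem E.ev_le {cl val : ℕ → ℕ} (hv : ∀ i, val i ≤ val 0) (h2 : 2 ≤ val 0) {σ : Store}
    (hσ : Bnd cl val σ) (e : E) (he : e.chk = true) : e.ev σ ≤ val 0 ^ e.deg := by
  induction e with
  | c m => simp only [E.chk, decide_eq_true_eq] at he; simp only [E.ev, E.deg, pow_one]; omega
  | v x => simpa [E.ev, E.deg] using (hσ.v x).trans (hv _)
  | op o a b iha ihb =>
    simp only [E.chk, Bool.and_eq_true, decide_eq_true_eq] at he
    have ha := iha he.1.1
    have hb := ihb he.1.2
    cases o with
    | add =>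
      simp only [E.ev, E.deg, WordOp.eval]
      calc a.ev σ + b.ev σ ≤ val 0 ^ max a.deg b.deg + val 0 ^ max a.deg b.deg :=
            add_le_add (ha.trans (Nat.pow_le_pow_right (by omega) (le_max_left _ _)))
              (hb.trans (Nat.pow_le_pow_right (by omega) (le_max_right _ _)))
        _ ≤ val 0 ^ (max a.deg b.deg + 1) := by
              rw [pow_succ, ← mul_two]; exact Nat.mul_le_mul_left _ h2
    | mul =>
      simp only [E.ev, E.deg, WordOp.eval, pow_add]
      exact Nat.mul_le_mul ha hb
    | sub => exact (Nat.sub_le _ _).trans ha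
    | div => exact (Nat.div_le_self _ _).trans ha
    | mod => exact (Nat.mod_le _ _).trans ha
  | arr a i => simpa [E.ev, E.deg] using hσ.A _ _

theorem E.ev_le_cls {cl val : ℕ → ℕ} (h2 : 2 ≤ val 0) {σ : Store}
    (hσ : Bnd cl val σ) (e : E) (he : e.chk = true) (hd : e.deg ≤ 1) :
    e.ev σ ≤ val (e.cls cl) := by
  induction e with
  | c m => simp only [E.chk, decide_eq_true_eq] at he; simp only [E.ev, E.cls]; omega
  | v x => exact hσ.v x
  | op o a b iha ihb =>
    have he' := he
    simp only [E.chk, Bool.and_eq_true, decide_eq_true_eq] at he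
    have := a.deg_pos
    have := b.deg_pos
    cases o with
    | add => simp only [E.deg] at hd; omega
    | mul => simp only [E.deg] at hd; omega
    | sub => exact (Nat.sub_le _ _).trans (iha he.1.1 hd)
    | div => exact (Nat.div_le_self _ _).trans (iha he.1.1 hd)
    | mod => exact (Nat.mod_le _ _).trans (iha he.1.1 hd)
  | arr a i => simpa [E.ev, E.cls] using hσ.A _ _

theorem pow_bounds {Z d : ℕ} (h2 : 2 ≤ Z) (hd : d ≤ 3) : Z ^ d ≤ Z ^ 3 ∧ Z ≤ Z ^ 3 ∧ Z * Z ≤ Z ^ 3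
    ∧ 1 ≤ Z ^ 3 :=
  ⟨Nat.pow_le_pow_right (by omega) hd, Nat.le_self_pow (by omega) _,
    (pow_two Z).symm.le.trans (Nat.pow_le_pow_right (by omega) (by omega)),
    Nat.one_le_pow _ _ (by omega)⟩

theorem E.ok_of_chk {cl val : ℕ → ℕ} (hv : ∀ i, val i ≤ val 0) (h2 : 2 ≤ val 0) {σ : Store}
    (hσ : Bnd cl val σ) (e : E) (he : e.chk = true) : e.Ok (64 * val 0 ^ 3) σ := by
  induction e with
  | c m =>
    simp only [E.chk, decide_eq_true_eq] at he
    have := (pow_bounds h2 (le_refl 3)).2.2.2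
    simp only [E.Ok]; omega
  | v x => simpa [E.chk, E.Ok] using he
  | op o a b iha ihb =>
    have h := E.ev_le hv h2 hσ _ he
    have hd := (pow_bounds h2 (E.deg_le he)).1
    simp only [E.chk, Bool.and_eq_true, decide_eq_true_eq] at he
    refine ⟨iha he.1.1, ihb he.1.2, ?_⟩
    simp only [E.ev] at h
    omega
  | arr a i ih =>
    simp only [E.chk, Bool.and_eq_true, decide_eq_true_eq] at he
    have h := E.ev_le hv h2 hσ i he.2
    obtain ⟨h3, h4, h5, h6⟩ := pow_bounds h2 (E.deg_le he.2)
    have h0 := (hσ.v 0).trans (hv _)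
    refine ⟨he.1, ih he.2, by omega⟩

def RE.chk : RE → Bool
  | v x => x < 64
  | cast e => e.chk
  | op _ a b => a.chk && b.chk
  | arr a i => a < 16 && i.chk

/-- Indices are at most `val 0 ^ 3`, and so are `val 0 * val 0` and `1`; the factor `64` exceeds the
sum of the coefficients. -/
theorem rix_ok {cl val : ℕ → ℕ} (hv : ∀ i, val i ≤ val 0) (h2 : 2 ≤ val 0) {σ : Store}
    (hσ : Bnd cl val σ) (i : E) (he : i.chk = true) :
    2 * σ.v 0 + 16 * i.ev σ + 16 ≤ 64 * val 0 ^ 3 ∧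
      σ.v 0 * σ.v 0 + 16 * i.ev σ + 16 ≤ 64 * val 0 ^ 3 := by
  have h := E.ev_le hv h2 hσ i he
  obtain ⟨h3, h4, h5, h6⟩ := pow_bounds h2 (E.deg_le he)
  have h0 := (hσ.v 0).trans (hv _)
  have h7 : σ.v 0 * σ.v 0 ≤ val 0 * val 0 := Nat.mul_le_mul h0 h0
  omega

theorem RE.ok_of_chk {cl val : ℕ → ℕ} (hv : ∀ i, val i ≤ val 0) (h2 : 2 ≤ val 0) {σ : Store}
    (hσ : Bnd cl val σ) (e : RE) (he : e.chk = true) : e.Ok (64 * val 0 ^ 3) σ := by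
  induction e with
  | v x => simpa [RE.chk, RE.Ok] using he
  | cast e => exact E.ok_of_chk hv h2 hσ e he
  | op o a b iha ihb =>
    simp only [RE.chk, Bool.and_eq_true] at he
    exact ⟨iha he.1, ihb he.2⟩
  | arr a i =>
    simp only [RE.chk, Bool.and_eq_true, decide_eq_true_eq] at he
    exact ⟨he.1, E.ok_of_chk hv h2 hσ i he.2, (rix_ok hv h2 hσ i he.2).2⟩

namespace Cmd

def chk (cl : ℕ → ℕ) : Cmd → Bool
  | skip => true
  | set x e => 0 < x && x < 64 && e.chk && e.deg ≤ 1 && (cl x == 0 || cl x == e.cls cl)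
  | rset x r => x < 64 && r.chk
  | put a i e => a < 16 && i.chk && e.chk && e.deg ≤ 1
  | rput a i r => a < 16 && i.chk && r.chk
  | seq c d => c.chk cl && d.chk cl
  | ifLt e e' c d => e.chk && e'.chk && c.chk cl && d.chk cl
  | ifRlt r r' c d => r.chk && r'.chk && c.chk cl && d.chk cl
  | loop x y c => 0 < x && x < 64 && y < 64 && x != y && !c.modV x && !c.modV y && c.chk cl &&
      (cl x == 0 || cl x == cl y)

def time (cl val : ℕ → ℕ) : Cmd → ℕ
  | skip => 0
  | set _ e => (e.code 64).length + 2
  | rset _ r => (r.code 64).length + 3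
  | put a i e => (e.code 64 ++ i.code 65 ++ E.addrCode a 65).length + 1
  | rput a i r => (r.code 64 ++ i.code 64 ++ RE.addrCode a 64).length + 1
  | seq c d => c.time cl val + d.time cl val
  | ifLt e e' c d => (e.code 64 ++ e'.code 65).length + 1 + c.time cl val + d.time cl val + 1
  | ifRlt r r' c d => (r.code 64 ++ r'.code 65).length + 1 + c.time cl val + d.time cl val + 1
  | loop _ y c => val (cl y) * (c.time cl val + 4) + 3

/-- Stored words have degree at most `1`, so stored values never grow past their bounds, however
often a loop is executed. Word sizes and running time are thereby reduced to evaluating `chk` and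
`time` on the syntax. -/
theorem chk_spec {cl val : ℕ → ℕ} (hv : ∀ i, val i ≤ val 0) (h2 : 2 ≤ val 0) (c : Cmd) :
    ∀ σ : Store, Bnd cl val σ → c.chk cl = true →
      Bnd cl val (c.eval σ) ∧ c.Ok (64 * val 0 ^ 3) σ ∧ c.steps σ ≤ c.time cl val := by
  induction c with
  | skip => intro σ hσ _; exact ⟨hσ, trivial, le_rfl⟩
  | set x e =>
    intro σ hσ h
    simp only [chk, Bool.and_eq_true, Bool.or_eq_true, decide_eq_true_eq, beq_iff_eq] at h
    refine ⟨⟨fun y => ?_, hσ.A⟩, ⟨h.1.1.1.1, h.1.1.1.2, E.ok_of_chk hv h2 hσ e h.1.1.2⟩, le_rfl⟩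
    simp only [eval, Store.setV_v]
    split
    · next hy =>
      subst hy
      have := E.ev_le_cls h2 hσ e h.1.1.2 h.1.2
      rcases h.2 with h' | h'
      · rw [h']; exact this.trans (hv _)
      · rw [h']; exact this
    · exact hσ.v y
  | rset x r =>
    intro σ hσ h
    simp only [chk, Bool.and_eq_true, decide_eq_true_eq] at h
    exact ⟨⟨hσ.v, hσ.A⟩, ⟨h.1, RE.ok_of_chk hv h2 hσ r h.2⟩, le_rfl⟩
  | put a i e =>
    intro σ hσ h
    simp only [chk, Bool.and_eq_true, decide_eq_true_eq] at h
    refine ⟨⟨hσ.v, fun a' i' => ?_⟩, ⟨h.1.1.1, E.ok_of_chk hv h2 hσ i h.1.1.2,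
      (rix_ok hv h2 hσ i h.1.1.2).1, E.ok_of_chk hv h2 hσ e h.1.2⟩, le_rfl⟩
    simp only [eval, Store.setA_A]
    split
    · exact (E.ev_le_cls h2 hσ e h.1.2 h.2).trans (hv _)
    · exact hσ.A _ _
  | rput a i r =>
    intro σ hσ h
    simp only [chk, Bool.and_eq_true, decide_eq_true_eq] at h
    exact ⟨⟨hσ.v, hσ.A⟩, ⟨h.1.1, E.ok_of_chk hv h2 hσ i h.1.2, (rix_ok hv h2 hσ i h.1.2).2,
      RE.ok_of_chk hv h2 hσ r h.2⟩, le_rfl⟩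
  | seq c d hc hd =>
    intro σ hσ h
    simp only [chk, Bool.and_eq_true] at h
    obtain ⟨h₁, h₂, h₃⟩ := hc σ hσ h.1
    obtain ⟨k₁, k₂, k₃⟩ := hd _ h₁ h.2
    exact ⟨k₁, ⟨h₂, k₂⟩, add_le_add h₃ k₃⟩
  | ifLt e e' c d hc hd =>
    intro σ hσ h
    simp only [chk, Bool.and_eq_true] at h
    obtain ⟨h₁, h₂, h₃⟩ := hc σ hσ h.1.2
    obtain ⟨k₁, k₂, k₃⟩ := hd σ hσ h.2
    refine ⟨?_, ⟨E.ok_of_chk hv h2 hσ e h.1.1.1, E.ok_of_chk hv h2 hσ e' h.1.1.2, fun _ => h₂,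
      fun _ => k₂⟩, ?_⟩
    · simp only [eval]; split <;> assumption
    · simp only [steps, time]; split <;> omega
  | ifRlt e e' c d hc hd =>
    intro σ hσ h
    simp only [chk, Bool.and_eq_true] at h
    obtain ⟨h₁, h₂, h₃⟩ := hc σ hσ h.1.2
    obtain ⟨k₁, k₂, k₃⟩ := hd σ hσ h.2
    refine ⟨?_, ⟨RE.ok_of_chk hv h2 hσ e h.1.1.1, RE.ok_of_chk hv h2 hσ e' h.1.1.2, fun _ => h₂,
      fun _ => k₂⟩, ?_⟩
    · simp only [eval]; split <;> assumption
    · simp only [steps, time]; split <;> omega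
  | loop x y c ih =>
    intro σ hσ h
    simp only [chk, Bool.and_eq_true, Bool.or_eq_true, decide_eq_true_eq, beq_iff_eq,
      bne_iff_ne, Bool.not_eq_true'] at h
    obtain ⟨⟨⟨⟨⟨⟨⟨hx, hx'⟩, hy⟩, hxy⟩, hm⟩, hm'⟩, hc⟩, hcl⟩ := h
    have hset : ∀ τ : Store, Bnd cl val τ → ∀ i ≤ σ.v y, Bnd cl val (τ.setV x i) := by
      intro τ hτ i hi
      refine ⟨fun z => ?_, hτ.A⟩
      simp only [Store.setV_v]
      split
      · next hz =>
        subst hz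
        have := hi.trans (hσ.v y)
        rcases hcl with h' | h'
        · rw [h']; exact this.trans (hv _)
        · rw [h']; exact this
      · exact hτ.v z
    have hit : ∀ i ≤ σ.v y, Bnd cl val (iter c.eval x σ i) := by
      intro i
      induction i with
      | zero => intro _; exact hσ
      | succ i ihi =>
        intro hi
        exact (ih _ (hset _ (ihi (by omega)) i (by omega)) hc).1
    refine ⟨hset _ (hit _ le_rfl) _ le_rfl, ⟨hx, hx', hy, hxy, hm, hm', ?_, fun i hi => ?_⟩, ?_⟩
    · have := (pow_bounds h2 (le_refl 3)).2.2.2; omega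
    · exact (ih _ (hset _ (hit i hi.le) i hi.le) hc).2.1
    · simp only [steps, time]
      have : ∑ i ∈ Finset.range (σ.v y), (1 + c.steps ((iter c.eval x σ i).setV x i) + 3) ≤
          σ.v y * (c.time cl val + 4) := by
        rw [← Finset.card_range (σ.v y), ← smul_eq_mul, Finset.card_range]
        refine (Finset.sum_le_card_nsmul _ _ (c.time cl val + 4) fun i hi => ?_).trans_eq
          (by rw [Finset.card_range])
        have hi' := Finset.mem_range.mp hi
        have := (ih _ (hset _ (hit i hi'.le) i hi'.le) hc).2.2
        omega
      have h3 : σ.v y * (c.time cl val + 4) ≤ val (cl y) * (c.time cl val + 4) :=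
        Nat.mul_le_mul_right _ (hσ.v y)
      omega

/-! ### Frames and loop invariants -/

def modR : Cmd → ℕ → Bool
  | rset x _, y => x == y
  | seq c d, y => c.modR y || d.modR y
  | ifLt _ _ c d, y => c.modR y || d.modR y
  | ifRlt _ _ c d, y => c.modR y || d.modR y
  | loop _ _ c, y => c.modR y
  | _, _ => false

def modA : Cmd → ℕ → Bool
  | put a _ _, y => a == y
  | seq c d, y => c.modA y || d.modA y
  | ifLt _ _ c d, y => c.modA y || d.modA y
  | ifRlt _ _ c d, y => c.modA y || d.modA y
  | loop _ _ c, y => c.modA y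
  | _, _ => false

def modB : Cmd → ℕ → Bool
  | rput a _ _, y => a == y
  | seq c d, y => c.modB y || d.modB y
  | ifLt _ _ c d, y => c.modB y || d.modB y
  | ifRlt _ _ c d, y => c.modB y || d.modB y
  | loop _ _ c, y => c.modB y
  | _, _ => false

/-- The stores agree on everything that `c` does not assign to. -/
structure Agree (c : Cmd) (σ τ : Store) : Prop where
  v : ∀ x, c.modV x = false → τ.v x = σ.v x
  r : ∀ x, c.modR x = false → τ.rv x = σ.rv x
  A : ∀ a, c.modA a = false → τ.A a = σ.A a
  B : ∀ a, c.modB a = false → τ.B a = σ.B a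

theorem Agree.refl (c : Cmd) (σ : Store) : Agree c σ σ :=
  ⟨fun _ _ => rfl, fun _ _ => rfl, fun _ _ => rfl, fun _ _ => rfl⟩

theorem Agree.trans {c : Cmd} {σ τ ρ : Store} (h : Agree c σ τ) (h' : Agree c τ ρ) :
    Agree c σ ρ :=
  ⟨fun x hx => (h'.v x hx).trans (h.v x hx), fun x hx => (h'.r x hx).trans (h.r x hx),
    fun x hx => (h'.A x hx).trans (h.A x hx), fun x hx => (h'.B x hx).trans (h.B x hx)⟩

theorem Agree.mono {c d : Cmd} {σ τ : Store} (h : Agree c σ τ)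
    (hV : ∀ x, d.modV x = false → c.modV x = false)
    (hR : ∀ x, d.modR x = false → c.modR x = false)
    (hA : ∀ x, d.modA x = false → c.modA x = false)
    (hB : ∀ x, d.modB x = false → c.modB x = false) : Agree d σ τ :=
  ⟨fun x hx => h.v x (hV x hx), fun x hx => h.r x (hR x hx), fun x hx => h.A x (hA x hx),
    fun x hx => h.B x (hB x hx)⟩

theorem agree_setV {c : Cmd} {x : ℕ} (σ : Store) (hx : c.modV x = true) (i : ℕ) :
    Agree c σ (σ.setV x i) := by
  refine ⟨fun y hy => ?_, fun _ _ => rfl, fun _ _ => rfl, fun _ _ => rfl⟩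
  have : y ≠ x := by rintro rfl; simp [hx] at hy
  simp [this]

theorem eval_agree (c : Cmd) : ∀ σ, Agree c σ (c.eval σ) := by
  induction c with
  | skip => intro σ; exact Agree.refl _ _
  | set x e => intro σ; exact agree_setV σ (by simp [modV]) _
  | rset x r =>
    intro σ
    refine ⟨fun _ _ => rfl, fun y hy => ?_, fun _ _ => rfl, fun _ _ => rfl⟩
    simp [modR] at hy
    simp [eval, Ne.symm hy]
  | put a i e =>
    intro σ
    refine ⟨fun _ _ => rfl, fun _ _ => rfl, fun y hy => ?_, fun _ _ => rfl⟩
    simp [modA] at hy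
    funext j
    simp [eval, Ne.symm hy]
  | rput a i e =>
    intro σ
    refine ⟨fun _ _ => rfl, fun _ _ => rfl, fun _ _ => rfl, fun y hy => ?_⟩
    simp [modB] at hy
    funext j
    simp [eval, Ne.symm hy]
  | seq c d hc hd =>
    intro σ
    refine Agree.trans ((hc σ).mono ?_ ?_ ?_ ?_) ((hd _).mono ?_ ?_ ?_ ?_) <;>
    · intro x hx
      simp only [modV, modR, modA, modB, Bool.or_eq_false_iff] at hx
      simp [hx]
  | ifLt e e' c d hc hd =>
    intro σ
    simp only [eval]
    split
    · refine (hc σ).mono ?_ ?_ ?_ ?_ <;>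
      · intro x hx
        simp only [modV, modR, modA, modB, Bool.or_eq_false_iff] at hx
        simp [hx]
    · refine (hd σ).mono ?_ ?_ ?_ ?_ <;>
      · intro x hx
        simp only [modV, modR, modA, modB, Bool.or_eq_false_iff] at hx
        simp [hx]
  | ifRlt e e' c d hc hd =>
    intro σ
    simp only [eval]
    split
    · refine (hc σ).mono ?_ ?_ ?_ ?_ <;>
      · intro x hx
        simp only [modV, modR, modA, modB, Bool.or_eq_false_iff] at hx
        simp [hx]
    · refine (hd σ).mono ?_ ?_ ?_ ?_ <;>
      · intro x hx
        simp only [modV, modR, modA, modB, Bool.or_eq_false_iff] at hx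
        simp [hx]
  | loop x y c hc =>
    intro σ
    have hx : (loop x y c).modV x = true := by simp [modV]
    have : ∀ i, Agree (loop x y c) σ (iter c.eval x σ i) := by
      intro i
      induction i with
      | zero => exact Agree.refl _ _
      | succ i ih =>
        refine (ih.trans (agree_setV _ hx i)).trans ((hc _).mono ?_ ?_ ?_ ?_) <;>
        · intro z hz
          simp only [modV, modR, modA, modB, Bool.or_eq_false_iff] at hz
          simp [hz]
    exact (this _).trans (agree_setV _ hx _)

/-- The invariant only has to describe what the loop changes; everything else is supplied by
`Agree`. It is stated for the store before the loop variable is set. -/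
theorem loop_rule {x y : ℕ} {c : Cmd} {σ : Store} (I : ℕ → Store → Prop) (h0 : I 0 σ)
    (hs : ∀ i < σ.v y, ∀ τ, Agree (loop x y c) σ τ → I i τ → I (i + 1) (c.eval (τ.setV x i))) :
    ∃ τ, Agree (loop x y c) σ τ ∧ I (σ.v y) τ ∧ (loop x y c).eval σ = τ.setV x (σ.v y) := by
  have hx : (loop x y c).modV x = true := by simp [modV]
  have : ∀ i ≤ σ.v y, Agree (loop x y c) σ (iter c.eval x σ i) ∧ I i (iter c.eval x σ i) := by
    intro i
    induction i with
    | zero => intro _; exact ⟨Agree.refl _ _, h0⟩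
    | succ i ih =>
      intro hi
      obtain ⟨h₁, h₂⟩ := ih (by omega)
      refine ⟨(h₁.trans (agree_setV _ hx i)).trans ((eval_agree c _).mono ?_ ?_ ?_ ?_),
        hs i (by omega) _ h₁ h₂⟩ <;>
      · intro z hz
        simp only [modV, modR, modA, modB, Bool.or_eq_false_iff] at hz
        simp [hz]
  exact ⟨_, (this _ le_rfl).1, (this _ le_rfl).2, rfl⟩

end Cmd

end Structured

namespace Structured

open RAM

/-! ### The program

Word variables: `1` is `k`, `2` the capacity, `3` the sample size `m`, `4` is `m + 1`, `5` the number
of radii, `6` the number of guesses, `7` is `k + 1`, `8` the number of units in the scale.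
Arrays of words: `1` the sample, `2` the centers of the balls, `3` the covered points, `4` the loads,
`5` and `6` the labels and predecessors of the search, `7` the assignment to the balls, `8` the best
assignment to centers. Arrays of reals: `0` the distances, `1` the distances to the points traversed
so far, `2` the radii of the balls, `3` the radii in the output. -/

namespace E

abbrev add (a b : E) : E := op .add a b
abbrev sub (a b : E) : E := op .sub a b
abbrev mul (a b : E) : E := op .mul a b
abbrev div (a b : E) : E := op .div a b
abbrev mod (a b : E) : E := op .mod a b

end E

/-- The distance of two points. -/
def dst (a b : E) : RE := .arr 0 ((a.mul (.v 0)).add b)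

namespace Prog

open Cmd E

/-- Here variables are multiplied repeatedly and constants exceed `2`, so this part does not satisfy
`Cmd.chk`; it is treated separately in `Prog.setup_spec`. -/
def prologue (e : ℕ) : Cmd :=
  seq (set 2 (arr 0 (c 0))) <|
  seq (set 3 ((((c 12).mul (v 1)).mul (v 1)).mul (v 1))) <|
  seq (set 4 ((v 3).add (c 1))) <|
  seq (set 8 ((c e).mul (v 1))) <|
  seq (set 5 ((((c 4).mul (v 1)).mul (((c 4).mul (v 8)).add (c 1))).add (c 1))) <|
  seq (set 7 ((v 1).add (c 1))) <|
  seq (set 6 (v 7)) <|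
  loop 9 1 (set 6 ((v 6).mul ((v 4).mul (v 5))))

def distInit : Cmd := loop 9 0 (rput 1 (v 9) (dst (c 0) (v 9)))

def farthest : Cmd :=
  seq (set 11 (c 0)) (loop 9 0 (ifRlt (.arr 1 (v 11)) (.arr 1 (v 9)) (set 11 (v 9)) skip))

def distUpdate : Cmd :=
  loop 9 0 (ifRlt (dst (v 11) (v 9)) (.arr 1 (v 9)) (rput 1 (v 9) (dst (v 11) (v 9))) skip)

/-- Decoding the number of balls as a difference from `k` keeps it in the class of `k`, as the time
bound for the loops over the balls requires. -/
def attemptInit : Cmd :=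
  seq (set 18 (c 1)) <| seq (rset 1 (.cast (c 0))) <|
  seq (set 14 ((v 1).sub ((v 12).mod (v 7)))) <| seq (set 13 ((v 12).div (v 7))) <|
  loop 9 0 (seq (put 3 (v 9) (c 0)) (put 4 (v 9) (c 0)))

/-- If all points are covered, the result is the default `0`; the analysis never relies on this
case. -/
def pick : Cmd :=
  seq (set 17 (c 0)) (loop 9 0 (ifLt (arr 3 (v 9)) (c 1) (set 17 (v 9)) skip))

def cover : Cmd := loop 9 0 (ifRlt (.arr 2 (v 15)) (dst (v 17) (v 9)) skip (put 3 (v 9) (c 1)))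

/-- A digit below the sample size `m` names a sample point, and the digit `m` stands for the last
uncovered point. -/
def placeBody : Cmd :=
  seq (set 16 ((v 13).mod (v 4))) <| seq (set 13 ((v 13).div (v 4))) <|
  seq (ifLt (v 16) (v 3) (set 17 (arr 1 (v 16))) pick) <|
  seq (put 2 (v 15) (v 17)) <|
  seq (rput 2 (v 15) (.op .mul (.cast ((v 13).mod (v 5))) (.v 0))) <|
  seq (set 13 ((v 13).div (v 5))) <|
  seq (rset 1 (.op .add (.v 1) (.arr 2 (v 15)))) cover

def place : Cmd := loop 15 14 placeBody

/-- The entry `k` in the assignment marks the new point as having no ball, since balls have numbers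
below `k`. Balls that contain the new point get the largest label `k + 1`. -/
def searchInit : Cmd :=
  seq (put 7 (v 19) (v 1)) <|
  loop 15 14 (ifRlt (.arr 2 (v 15)) (dst (arr 2 (v 15)) (v 19)) (put 5 (v 15) (c 0))
    (seq (put 5 (v 15) (v 7)) (put 6 (v 15) (v 19))))

/-- Round `i` gives the label `k - i`, so labels decrease with the distance from the new point, and
`0` means not reached. Requiring a label strictly above `k - i` excludes the balls that were reached
in the same round. -/
def searchStep : Cmd :=
  ifLt ((v 1).sub (v 20)) (arr 5 (arr 7 (v 9)))
    (ifLt (arr 5 (v 15)) (c 1)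
      (ifRlt (.arr 2 (v 15)) (dst (arr 2 (v 15)) (v 9)) skip
        (seq (put 5 (v 15) ((v 1).sub (v 20))) (put 6 (v 15) (v 9)))) skip) skip

def searchRound : Cmd := loop 9 19 (loop 15 14 searchStep)

def search : Cmd := loop 20 1 searchRound

/-- The default `k` is not the number of a ball and reports that all reached balls are full. -/
def findFree : Cmd :=
  seq (set 21 (v 1)) <|
  loop 15 14 (ifLt (c 0) (arr 5 (v 15))
    (ifLt (arr 4 (arr 2 (v 15))) (v 2) (set 21 (v 15)) skip) skip)

/-- Truncated subtraction writes the load plus one as `U - ((U - load) - 1)`, which is correct since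
the load is below `U`. Unlike a sum, this expression has degree `1` and passes `Cmd.chk`. -/
def count : Cmd :=
  ifLt (v 21) (v 14)
    (put 4 (arr 2 (v 21)) ((v 2).sub (((v 2).sub (arr 4 (arr 2 (v 21)))).sub (c 1))))
    (set 18 (c 0))

def flip : Cmd :=
  loop 20 7 (ifLt (v 21) (v 14)
    (seq (set 22 (arr 6 (v 21))) <| seq (set 23 (arr 7 (v 22))) <|
      seq (put 7 (v 22) (v 21)) (set 21 (v 23))) skip)

def augment : Cmd := seq searchInit <| seq search <| seq findFree <| seq count flip

def save : Cmd :=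
  seq (loop 9 0 (put 8 (v 9) (arr 2 (arr 7 (v 9))))) <| seq (rset 2 (.v 1)) (set 24 (c 1))

def record : Cmd :=
  ifLt (c 0) (v 18) (ifLt (v 24) (c 1) save (ifRlt (.v 1) (.v 2) save skip)) skip

def attempt : Cmd := seq attemptInit <| seq place <| seq (loop 19 0 augment) record

def round : Cmd :=
  seq farthest <| seq (rset 0 (.op .div (.arr 1 (v 11)) (.cast (v 8)))) <|
  seq (loop 12 6 attempt) distUpdate

/-- An increment without addition, as in `count`; it is correct while the counter is below `k`. -/
def bump : Cmd := set 25 ((v 1).sub (((v 1).sub (v 25)).sub (c 1)))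

/-- The radii are collected in array `3` and copied at the very end, because array `0` of reals
contains the distances until then. The centers that fill up their number to `k` keep the radius `0`.
-/
def output : Cmd :=
  seq (loop 9 0 (seq (put 0 (v 9) (c 0)) (rput 3 (v 9) (.cast (c 0))))) <|
  seq (set 25 (c 0)) <|
  seq (loop 9 0 (seq (set 17 (arr 8 (v 9))) <| seq (put 0 ((v 0).add (v 9)) (v 17)) <|
    seq (ifLt (arr 0 (v 17)) (c 1) (seq (put 0 (v 17) (c 1)) bump) skip) <|
    ifRlt (.arr 3 (v 17)) (dst (v 17) (v 9)) (rput 3 (v 17) (dst (v 17) (v 9))) skip)) <|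
  seq (loop 9 0 (ifLt (v 25) (v 1)
    (ifLt (arr 0 (v 9)) (c 1) (seq (put 0 (v 9) (c 1)) bump) skip) skip)) <|
  loop 9 0 (rput 0 (v 9) (.arr 3 (v 9)))

def main : Cmd := seq distInit <| seq (loop 10 0 round) output

/-- The classes of the variables in `main`: `1` for `n`, `2` for `k + 1`, `3` for the number of
guesses, and `0` for the others. -/
def cls (x : ℕ) : ℕ :=
  if x = 0 ∨ x = 19 then 1 else if x = 1 ∨ x = 7 ∨ x = 14 then 2 else if x = 6 then 3 else 0

theorem main_chk : main.chk cls = true := by decide +kernel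

theorem main_time (Z n k G : ℕ) (hn : 1 ≤ n) (hG : 1 ≤ G) : main.time cls (fun i =>
    if i = 1 then n else if i = 2 then k + 1 else if i = 3 then G else Z) ≤
      2000 * (n ^ 3 * (k + 1) ^ 2 * G) := by
  simp [main, distInit, round, farthest, attempt, attemptInit, place, placeBody, pick,
    cover, augment, searchInit, search, searchRound, searchStep, findFree, count, flip, record, save,
    distUpdate, output, bump, Cmd.time, cls, E.code, RE.code, dst, E.addrCode, RE.addrCode]
  generalize hb : k + 1 = b
  have hb1 : 1 ≤ b := by omega
  -- The time is a polynomial in `n`, `b` and `G`. Each of its monomials is at most the leading one,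
  -- so it suffices that the coefficients add up to at most `2000`.
  have h : ∀ i j l, i ≤ 3 → j ≤ 2 → l ≤ 1 → n ^ i * b ^ j * G ^ l ≤ n ^ 3 * b ^ 2 * G := by
    intro i j l hi hj hl
    calc n ^ i * b ^ j * G ^ l ≤ n ^ 3 * b ^ 2 * G ^ 1 := by gcongr
      _ = _ := by rw [pow_one]
  linarith [h 0 0 0 (by simp) (by simp) (by simp), h 1 0 0 (by simp) (by simp) (by simp),
    h 2 0 0 (by simp) (by simp) (by simp), h 3 0 0 (by simp) (by simp) (by simp),
    h 0 1 0 (by simp) (by simp) (by simp), h 1 1 0 (by simp) (by simp) (by simp),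
    h 2 1 0 (by simp) (by simp) (by simp), h 3 1 0 (by simp) (by simp) (by simp),
    h 0 2 0 (by simp) (by simp) (by simp), h 1 2 0 (by simp) (by simp) (by simp),
    h 2 2 0 (by simp) (by simp) (by simp), h 3 2 0 (by simp) (by simp) (by simp),
    h 0 0 1 (by simp) (by simp) (by simp), h 1 0 1 (by simp) (by simp) (by simp),
    h 2 0 1 (by simp) (by simp) (by simp), h 3 0 1 (by simp) (by simp) (by simp),
    h 0 1 1 (by simp) (by simp) (by simp), h 1 1 1 (by simp) (by simp) (by simp),
    h 2 1 1 (by simp) (by simp) (by simp), h 3 1 1 (by simp) (by simp) (by simp),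
    h 0 2 1 (by simp) (by simp) (by simp), h 1 2 1 (by simp) (by simp) (by simp),
    h 2 2 1 (by simp) (by simp) (by simp), h 3 2 1 (by simp) (by simp) (by simp)]

end Prog

end Structured

/-! ### The encoding of guesses, and the placement of the balls. -/

namespace Structured

open RAM Cmd

/-- The parameters of the algorithm: the numbers of points and centers, the capacity, the sample
size, the number of radii, the number of units in the scale, the sample, and the distances. -/
structure Par where
  n : ℕ
  k : ℕ
  U : ℕ
  m : ℕ
  T : ℕ
  u : ℕ
  R : ℕ → ℕ
  dd : ℕ → ℕ → ℝ

namespace Par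

def G (P : Par) : ℕ := (P.k + 1) * ((P.m + 1) * P.T) ^ P.k

/-- The number of balls in the guess `g`. -/
def kk (P : Par) (g : ℕ) : ℕ := P.k - g % (P.k + 1)

/-- The part of the guess `g` that encodes the balls from the `b`-th one on. -/
def rest (P : Par) (g : ℕ) : ℕ → ℕ
  | 0 => g / (P.k + 1)
  | b + 1 => P.rest g b / (P.m + 1) / P.T

/-- The index in the sample of the center of the `b`-th ball in the guess `g`. -/
def sel (P : Par) (g b : ℕ) : ℕ := P.rest g b % (P.m + 1)

/-- The radius of the `b`-th ball in the guess `g`. -/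
def len (P : Par) (g b : ℕ) : ℕ := P.rest g b / (P.m + 1) % P.T

/-- `x` is in none of the first `b` balls. -/
def Uncov (P : Par) (X : ℕ → ℕ) (r : ℕ → ℝ) (b x : ℕ) : Prop := ∀ b' < b, r b' < P.dd (X b') x

/-- `X` and `r` are the centers and radii of the first `j` balls that are given by the indices `f`
and the radii `t` if a unit has the length `unit`. -/
structure Placed (P : Par) (unit : ℝ) (f t : ℕ → ℕ) (X : ℕ → ℕ) (r : ℕ → ℝ) (j : ℕ) : Prop where
  lt : ∀ b < j, X b < P.n
  rad : ∀ b < j, r b = t b * unit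
  sample : ∀ b < j, f b < P.m → X b = P.R (f b)
  uncov : ∀ b < j, ¬ f b < P.m → ∀ x < P.n, P.Uncov X r b x → P.Uncov X r b (X b) ∧ x ≤ X b

end Par

/-- The constants of the program have their values in `σ`. -/
structure Fits (P : Par) (σ : Store) : Prop where
  h0 : σ.v 0 = P.n
  h1 : σ.v 1 = P.k
  h2 : σ.v 2 = P.U
  h3 : σ.v 3 = P.m
  h4 : σ.v 4 = P.m + 1
  h5 : σ.v 5 = P.T
  h6 : σ.v 6 = P.G
  h7 : σ.v 7 = P.k + 1
  h8 : σ.v 8 = P.u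
  R : ∀ i < P.m, σ.A 1 i = P.R i
  dd : ∀ i < P.n, ∀ j < P.n, σ.B 0 (i * P.n + j) = P.dd i j

/-- The command does not change the constants of the program. -/
def Cmd.keeps (c : Cmd) : Bool :=
  !c.modV 0 && !c.modV 1 && !c.modV 2 && !c.modV 3 && !c.modV 4 && !c.modV 5 && !c.modV 6 &&
    !c.modV 7 && !c.modV 8 && !c.modA 1 && !c.modB 0

theorem Fits.agree {P : Par} {σ τ : Store} {c : Cmd} (h : Fits P σ) (ha : Agree c σ τ)
    (hc : c.keeps = true := by decide) : Fits P τ := by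
  simp only [Cmd.keeps, Bool.and_eq_true, Bool.not_eq_true'] at hc
  obtain ⟨⟨⟨⟨⟨⟨⟨⟨⟨⟨c0, c1⟩, c2⟩, c3⟩, c4⟩, c5⟩, c6⟩, c7⟩, c8⟩, cA⟩, cB⟩ := hc
  exact ⟨by rw [ha.v _ c0, h.h0], by rw [ha.v _ c1, h.h1], by rw [ha.v _ c2, h.h2],
    by rw [ha.v _ c3, h.h3], by rw [ha.v _ c4, h.h4], by rw [ha.v _ c5, h.h5],
    by rw [ha.v _ c6, h.h6], by rw [ha.v _ c7, h.h7], by rw [ha.v _ c8, h.h8],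
    fun i hi => by rw [ha.A _ cA, h.R i hi], fun i hi j hj => by rw [ha.B _ cB, h.dd i hi j hj]⟩

theorem Fits.eval {P : Par} {σ : Store} (h : Fits P σ) (c : Cmd)
    (hc : c.keeps = true := by decide) : Fits P (c.eval σ) := h.agree (eval_agree c σ) hc

theorem Fits.setV {P : Par} {σ : Store} (h : Fits P σ) (x i : ℕ) (hx : 8 < x) :
    Fits P (σ.setV x i) := by
  refine ⟨?_, ?_, ?_, ?_, ?_, ?_, ?_, ?_, ?_, h.R, h.dd⟩ <;>
    rw [Store.setV_v, if_neg (by omega)]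
  exacts [h.h0, h.h1, h.h2, h.h3, h.h4, h.h5, h.h6, h.h7, h.h8]

theorem index_lt {n i j : ℕ} (hi : i < n) (hj : j < n) : i * n + j < n * n :=
  calc i * n + j < i * n + n := by omega
    _ = (i + 1) * n := by ring
    _ ≤ n * n := Nat.mul_le_mul_right _ hi

theorem Fits.dst {P : Par} {σ : Store} (h : Fits P σ) {a b : E} (ha : a.ev σ < P.n)
    (hb : b.ev σ < P.n) : (dst a b).ev σ = P.dd (a.ev σ) (b.ev σ) := by
  rw [← h.dd _ ha _ hb, Structured.dst]
  simp only [RE.ev, E.ev, WordOp.eval, rix, h.h0, if_pos]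
  rw [Nat.mod_eq_of_lt (index_lt ha hb)]

/-- The last index of the entries that exceed all previous ones. -/
def amax (f : ℕ → ℝ) : ℕ → ℕ
  | 0 => 0
  | i + 1 => open scoped Classical in if f (amax f i) < f i then i else amax f i

theorem amax_lt (f : ℕ → ℝ) {n : ℕ} (hn : 0 < n) : amax f n < n := by
  obtain ⟨n, rfl⟩ := Nat.exists_eq_add_of_lt hn
  simp only [zero_add]
  induction n with
  | zero => simp [amax]
  | succ n ih =>
    have := ih (by omega)
    rw [amax]
    split <;> omega

theorem le_amax (f : ℕ → ℝ) {n x : ℕ} (hx : x < n) : f x ≤ f (amax f n) := by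
  induction n with
  | zero => omega
  | succ n ih =>
    rw [amax]
    rcases Nat.lt_succ_iff_lt_or_eq.mp hx with h | rfl
    · split
      · exact (ih h).trans (le_of_lt ‹_›)
      · exact ih h
    · split
      · exact le_rfl
      · exact not_lt.mp ‹_›

theorem amax_congr {f g : ℕ → ℝ} {n : ℕ} (hn : 0 < n) (h : ∀ x < n, f x = g x) :
    amax f n = amax g n := by
  have : ∀ i ≤ n, amax f i = amax g i := by
    intro i
    induction i with
    | zero => intro _; rfl
    | succ i ih =>
      intro hi
      have h1 := ih (by omega)
      have h2 : amax g i < n := by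
        rcases Nat.eq_zero_or_pos i with rfl | h0
        · simpa [amax] using hn
        · exact (amax_lt g h0).trans (by omega)
      rw [amax, amax, h1, h i (by omega), h _ h2]
  exact this n le_rfl

theorem Par.Placed.congr {P : Par} {unit : ℝ} {f t X X' : ℕ → ℕ} {r r' : ℕ → ℝ} {j : ℕ}
    (h : P.Placed unit f t X r j) (hX : ∀ b < j, X' b = X b) (hr : ∀ b < j, r' b = r b) :
    P.Placed unit f t X' r' j := by
  have hu : ∀ b < j, ∀ x, P.Uncov X' r' b x ↔ P.Uncov X r b x := by
    intro b hb x
    refine forall₂_congr fun b' hb' => ?_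
    rw [hX b' (by omega), hr b' (by omega)]
  refine ⟨fun b hb => ?_, fun b hb => ?_, fun b hb hs => ?_, fun b hb hs x hx => ?_⟩
  · rw [hX b hb]; exact h.lt b hb
  · rw [hr b hb]; exact h.rad b hb
  · rw [hX b hb]; exact h.sample b hb hs
  · rw [hu b hb, hu b hb, hX b hb]; exact h.uncov b hb hs x hx

theorem Par.Placed.succ {P : Par} {unit : ℝ} {f t X : ℕ → ℕ} {r : ℕ → ℝ} {j : ℕ}
    (h : P.Placed unit f t X r j) (hX : X j < P.n) (hr : r j = t j * unit)
    (hs : f j < P.m → X j = P.R (f j))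
    (hu : ¬ f j < P.m → ∀ x < P.n, P.Uncov X r j x → P.Uncov X r j (X j) ∧ x ≤ X j) :
    P.Placed unit f t X r (j + 1) := by
  have : ∀ b, b < j + 1 → b < j ∨ b = j := fun b hb => by omega
  refine ⟨fun b hb => ?_, fun b hb => ?_, fun b hb => ?_, fun b hb => ?_⟩ <;>
    rcases this b hb with hb | rfl
  exacts [h.lt b hb, hX, h.rad b hb, hr, h.sample b hb, hs, h.uncov b hb, hu]

theorem Cmd.eval_seq (c d : Cmd) (σ : Store) : (seq c d).eval σ = d.eval (c.eval σ) := rfl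

namespace Prog

theorem distInit_spec {P : Par} {σ : Store} (h : Fits P σ) (hn : 0 < P.n) :
    ∀ x < P.n, (distInit.eval σ).B 1 x = P.dd 0 x := by
  obtain ⟨τ, ha, hI, he⟩ := loop_rule (x := 9) (y := 0)
    (c := rput 1 (.v 9) (dst (.c 0) (.v 9))) (σ := σ)
    (fun i τ => ∀ x < i, τ.B 1 x = P.dd 0 x) (by simp) (by
      intro i hi τ ha hI x hx
      have hf := (h.agree ha).setV 9 i (by omega)
      rw [h.h0] at hi
      have hd := hf.dst (a := .c 0) (b := .v 9) (by simpa [E.ev] using hn) (by simpa [E.ev] using hi)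
      simp only [E.ev, Store.setV_v, if_pos] at hd
      simp only [eval, E.ev, hd, rix, Store.setB_B, Store.setV_v]
      by_cases hxi : x = i
      · simp [hxi]
      · simpa [hxi] using hI x (by omega))
  rw [distInit, he]
  rw [h.h0] at hI
  simpa using hI

theorem farthest_spec {P : Par} {σ : Store} (h : Fits P σ) :
    (farthest.eval σ).v 11 = amax (σ.B 1) P.n := by
  obtain ⟨τ, ha, hI, he⟩ := loop_rule (x := 9) (y := 0)
    (c := ifRlt (.arr 1 (.v 11)) (.arr 1 (.v 9)) (set 11 (.v 9)) skip) (σ := σ.setV 11 0)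
    (fun i τ => τ.v 11 = amax (σ.B 1) i) (by simp [amax]) (by
      intro i hi τ ha hI
      have hB : τ.B 1 = σ.B 1 := ha.B 1 (by decide)
      simp only [eval, RE.ev, E.ev, rix]
      simp only [Store.setV_v, Store.setV_B, hB, hI, amax]
      norm_num
      split <;> simp [hI])
  have : farthest.eval σ = τ.setV 9 _ := he
  rw [this]
  simpa [h.h0] using hI

theorem distUpdate_spec {P : Par} {σ : Store} (h : Fits P σ) (h11 : σ.v 11 < P.n) :
    ∀ x < P.n, (distUpdate.eval σ).B 1 x = min (σ.B 1 x) (P.dd (σ.v 11) x) := by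
  obtain ⟨τ, ha, hI, he⟩ := loop_rule (x := 9) (y := 0)
    (c := ifRlt (dst (.v 11) (.v 9)) (.arr 1 (.v 9)) (rput 1 (.v 9) (dst (.v 11) (.v 9))) skip)
    (σ := σ)
    (fun i τ => ∀ x < P.n, τ.B 1 x = if x < i then min (σ.B 1 x) (P.dd (σ.v 11) x) else σ.B 1 x)
    (by simp) (by
      intro i hi τ ha hI x hx
      have hf := (h.agree ha).setV 9 i (by omega)
      rw [h.h0] at hi
      have h11' : τ.v 11 = σ.v 11 := ha.v 11 (by decide)
      have hd := hf.dst (a := .v 11) (b := .v 9) (by simpa [E.ev, h11'] using h11)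
        (by simpa [E.ev] using hi)
      simp only [E.ev, Store.setV_v, if_pos] at hd
      rw [if_neg (by decide), h11'] at hd
      have hIi := hI i hi
      simp only [lt_irrefl, if_false] at hIi
      simp only [eval, E.ev, RE.ev, hd, rix, Store.setV_v, Store.setV_B, one_ne_zero, if_false, if_true, hIi]
      by_cases hxi : x = i
      · subst hxi
        split
        · simp [min_eq_right (le_of_lt ‹_›)]
        · simp [hIi, min_eq_left (not_lt.mp ‹_›)]
      · have : (x < i + 1) = (x < i) := by apply propext; omega
        split <;> simp [hxi, hI x hx, this])
  rw [distUpdate, he]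
  rw [h.h0] at hI
  intro x hx
  simpa [hx] using hI x hx

theorem attemptInit_spec {P : Par} {σ : Store} (h : Fits P σ) :
    (attemptInit.eval σ).v 18 = 1 ∧ (attemptInit.eval σ).rv 1 = 0 ∧
      (attemptInit.eval σ).v 14 = P.kk (σ.v 12) ∧ (attemptInit.eval σ).v 13 = P.rest (σ.v 12) 0 ∧
      ∀ x < P.n, (attemptInit.eval σ).A 3 x = 0 ∧ (attemptInit.eval σ).A 4 x = 0 := by
  obtain ⟨τ, ha, hI, he⟩ := loop_rule (x := 9) (y := 0)
    (c := seq (put 3 (.v 9) (.c 0)) (put 4 (.v 9) (.c 0)))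
    (σ := (((σ.setV 18 1).setR 1 ((0 : ℕ) : ℝ)).setV 14 (P.kk (σ.v 12))).setV 13 (P.rest (σ.v 12) 0))
    (fun i τ => ∀ x < i, τ.A 3 x = 0 ∧ τ.A 4 x = 0) (by simp) (by
      intro i hi τ ha hI x hx
      simp only [eval, E.ev, wix, Store.setA_A, Store.setV_v, Store.setA_v]
      by_cases hxi : x = i
      · simp [hxi]
      · simpa [hxi] using hI x (by omega))
  have : attemptInit.eval σ = τ.setV 9 (σ.v 0) := by
    refine Eq.trans ?_ (he.trans (by simp))
    simp [attemptInit, eval, E.ev, RE.ev, Par.kk, Par.rest, WordOp.eval, h.h1, h.h7]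
  rw [this]
  simp only [Store.setV_v, Store.setR_v] at hI
  refine ⟨?_, ?_, ?_, ?_, by simpa [h.h0] using hI⟩
  · simpa using ha.v 18 (by decide)
  · simpa using ha.r 1 (by decide)
  · simpa using ha.v 14 (by decide)
  · simpa using ha.v 13 (by decide)

/-- The last index of a zero entry. -/
theorem pick_spec {P : Par} {σ : Store} (h : Fits P σ) (hn : 0 < P.n) :
    (pick.eval σ).v 17 < P.n ∧ ∀ x < P.n, σ.A 3 x = 0 →
      σ.A 3 ((pick.eval σ).v 17) = 0 ∧ x ≤ (pick.eval σ).v 17 := by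
  obtain ⟨τ, ha, hI, he⟩ := loop_rule (x := 9) (y := 0)
    (c := ifLt (.arr 3 (.v 9)) (.c 1) (set 17 (.v 9)) skip) (σ := σ.setV 17 0)
    (fun i τ => τ.v 17 < P.n ∧ ∀ x < i, σ.A 3 x = 0 → σ.A 3 (τ.v 17) = 0 ∧ x ≤ τ.v 17)
    (by simp [hn]) (by
      intro i hi τ ha hI
      have hA : τ.A 3 = σ.A 3 := ha.A 3 (by decide)
      simp only [Store.setV_v, h.h0] at hi
      have hi' : i < P.n := by simpa using hi
      simp only [eval, E.ev, wix, Store.setV_v, Store.setV_A, hA]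
      norm_num
      by_cases h3 : σ.A 3 i = 0
      · simp [h3, hi']
        intro x hx _; omega
      · simp [h3, hI.1]
        intro x hx h0
        rcases (show x < i ∨ x = i by omega) with h | rfl
        · exact hI.2 x h h0
        · exact absurd h0 h3)
  have : pick.eval σ = τ.setV 9 _ := he
  rw [this]
  simpa [h.h0] using hI

theorem cover_spec {P : Par} {σ : Store} (h : Fits P σ) (h17 : σ.v 17 < P.n) :
    ∀ x < P.n, (cover.eval σ).A 3 x = 0 ↔
      σ.A 3 x = 0 ∧ σ.B 2 (σ.v 15) < P.dd (σ.v 17) x := by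
  obtain ⟨τ, ha, hI, he⟩ := loop_rule (x := 9) (y := 0)
    (c := ifRlt (.arr 2 (.v 15)) (dst (.v 17) (.v 9)) skip (put 3 (.v 9) (.c 1))) (σ := σ)
    (fun i τ => ∀ x < P.n, τ.A 3 x = 0 ↔
      σ.A 3 x = 0 ∧ (x < i → σ.B 2 (σ.v 15) < P.dd (σ.v 17) x))
    (by simp) (by
      intro i hi τ ha hI x hx
      have hf := (h.agree ha).setV 9 i (by omega)
      rw [h.h0] at hi
      have h17' : τ.v 17 = σ.v 17 := ha.v 17 (by decide)
      have h15' : τ.v 15 = σ.v 15 := ha.v 15 (by decide)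
      have hB : τ.B 2 = σ.B 2 := ha.B 2 (by decide)
      have hd := hf.dst (a := .v 17) (b := .v 9) (by simpa [E.ev, h17'] using h17)
        (by simpa [E.ev] using hi)
      simp only [E.ev, Store.setV_v, if_pos] at hd
      rw [if_neg (by decide), h17'] at hd
      simp only [eval, E.ev, RE.ev, hd, rix, wix, Store.setV_v, Store.setV_B, hB]
      norm_num
      rw [h15']
      by_cases hxi : x = i
      · subst hxi
        split
        · simp [hI x hx, ‹_›]
        · simp [‹_›]
      · have : (x ≤ i) = (x < i) := by apply propext; omega
        split <;> simp [hxi, hI x hx, this])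
  rw [cover, he]
  rw [h.h0] at hI
  intro x hx
  simpa [hx] using hI x hx

/-- The balls of the guess have been placed, and the covered points marked. -/
structure PlaceInv (P : Par) (unit : ℝ) (g b : ℕ) (τ : Store) : Prop where
  rest : τ.v 13 = P.rest g b
  placed : P.Placed unit (P.sel g) (P.len g) (τ.A 2) (τ.B 2) b
  cost : τ.rv 1 = ∑ b' ∈ Finset.range b, τ.B 2 b'
  cov : ∀ x < P.n, τ.A 3 x = 0 ↔ P.Uncov (τ.A 2) (τ.B 2) b x

theorem placeBody_spec {P : Par} {σ : Store} (h : Fits P σ) (hn : 0 < P.n)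
    (hR : ∀ i < P.m, P.R i < P.n) {g b : ℕ} (hI : PlaceInv P (σ.rv 0) g b σ) (h15 : σ.v 15 = b) :
    PlaceInv P (σ.rv 0) g (b + 1) (placeBody.eval σ) := by
  set σ₂ := (σ.setV 16 (P.sel g b)).setV 13 (P.rest g b / (P.m + 1)) with hσ₂
  have h₂ : Fits P σ₂ := (h.setV 16 _ (by omega)).setV 13 _ (by omega)
  set pk := ifLt (.v 16) (.v 3) (set 17 (.arr 1 (.v 16))) pick with hpk
  set σ₃ := pk.eval σ₂ with hσ₃
  have a₃ : Agree pk σ₂ σ₃ := eval_agree _ _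
  have h₃ : Fits P σ₃ := h₂.agree a₃
  have e13 : σ₃.v 13 = P.rest g b / (P.m + 1) := by rw [a₃.v 13 (by decide)]; simp [hσ₂]
  have e15 : σ₃.v 15 = b := by rw [a₃.v 15 (by decide)]; simp [hσ₂, h15]
  have er0 : σ₃.rv 0 = σ.rv 0 := by rw [a₃.r 0 (by decide)]; simp [hσ₂]
  have er1 : σ₃.rv 1 = σ.rv 1 := by rw [a₃.r 1 (by decide)]; simp [hσ₂]
  have eA2 : σ₃.A 2 = σ.A 2 := by rw [a₃.A 2 (by decide)]; simp [hσ₂]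
  have eA3 : σ₃.A 3 = σ.A 3 := by rw [a₃.A 3 (by decide)]; simp [hσ₂]
  have eB2 : σ₃.B 2 = σ.B 2 := by rw [a₃.B 2 (by decide)]; simp [hσ₂]
  have e17 : σ₃.v 17 < P.n ∧ (P.sel g b < P.m → σ₃.v 17 = P.R (P.sel g b)) ∧
      (¬ P.sel g b < P.m → ∀ x < P.n, P.Uncov (σ.A 2) (σ.B 2) b x →
        P.Uncov (σ.A 2) (σ.B 2) b (σ₃.v 17) ∧ x ≤ σ₃.v 17) := by
    have e16 : σ₂.v 16 = P.sel g b := by simp [hσ₂]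
    by_cases hs : P.sel g b < P.m
    · have : σ₃.v 17 = P.R (P.sel g b) := by
        rw [hσ₃, hpk]
        simp only [eval, E.ev, h₂.h3, e16, hs, if_true, wix]
        simpa using h₂.R _ hs
      exact ⟨this ▸ hR _ hs, fun _ => this, fun h => absurd hs h⟩
    · have : σ₃ = pick.eval σ₂ := by
        rw [hσ₃, hpk]
        simp only [eval, E.ev, h₂.h3, e16, hs, if_false]
      obtain ⟨p1, p2⟩ := pick_spec h₂ hn
      rw [← this] at p1 p2
      refine ⟨p1, fun h => absurd h hs, fun _ x hx hux => ?_⟩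
      have := p2 x hx (by simpa [hσ₂] using (hI.cov x hx).mpr hux)
      refine ⟨(hI.cov _ p1).mp (by simpa [hσ₂] using this.1), this.2⟩
  set σ₄ := ((((σ₃.setA 2 b (σ₃.v 17)).setB 2 b ((P.len g b : ℝ) * σ.rv 0)).setV 13
    (P.rest g (b + 1))).setR 1 (σ.rv 1 + (P.len g b : ℝ) * σ.rv 0)) with hσ₄
  have hσ : placeBody.eval σ = cover.eval σ₄ := by
    have : (set 13 ((E.v 13).div (.v 4))).eval ((set 16 ((E.v 13).mod (.v 4))).eval σ) = σ₂ := by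
      simp [eval, E.ev, WordOp.eval, hI.rest, h.h4, hσ₂, Par.sel]
    simp only [placeBody, eval_seq]
    rw [this, ← hpk, ← hσ₃]
    congr 1
    simp [eval, E.ev, RE.ev, WordOp.eval, RealOp.eval, wix, rix, e15, e13, er0, er1, h₃.h5, hσ₄, Par.len,
      Par.rest]
  have h₄ : Fits P σ₄ := ⟨by simpa [hσ₄] using h₃.h0, by simpa [hσ₄] using h₃.h1,
    by simpa [hσ₄] using h₃.h2, by simpa [hσ₄] using h₃.h3, by simpa [hσ₄] using h₃.h4,
    by simpa [hσ₄] using h₃.h5, by simpa [hσ₄] using h₃.h6, by simpa [hσ₄] using h₃.h7,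
    by simpa [hσ₄] using h₃.h8, by simpa [hσ₄] using h₃.R, by simpa [hσ₄] using h₃.dd⟩
  have f17 : σ₄.v 17 = σ₃.v 17 := by simp [hσ₄]
  have hc := cover_spec h₄ (by rw [f17]; exact e17.1)
  have a₅ := eval_agree cover σ₄
  rw [← hσ] at hc a₅
  set σ₅ := placeBody.eval σ
  have g2 : σ₅.A 2 = fun i => if i = b then σ₃.v 17 else σ.A 2 i := by
    rw [a₅.A 2 (by decide)]; funext i; simp [hσ₄, eA2]
  have gB2 : σ₅.B 2 = fun i => if i = b then (P.len g b : ℝ) * σ.rv 0 else σ.B 2 i := by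
    rw [a₅.B 2 (by decide)]; funext i; simp [hσ₄, eB2]
  have hX : ∀ i < b, σ₅.A 2 i = σ.A 2 i := fun i hi => by rw [g2]; simp [hi.ne]
  have hr : ∀ i < b, σ₅.B 2 i = σ.B 2 i := fun i hi => by rw [gB2]; simp [hi.ne]
  have hX' : σ₅.A 2 b = σ₃.v 17 := by rw [g2]; simp
  have hr' : σ₅.B 2 b = (P.len g b : ℝ) * σ.rv 0 := by rw [gB2]; simp
  have hU : ∀ x, P.Uncov (σ₅.A 2) (σ₅.B 2) b x ↔ P.Uncov (σ.A 2) (σ.B 2) b x := by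
    intro x
    refine forall₂_congr fun b' hb' => ?_
    rw [hX b' hb', hr b' hb']
  refine ⟨?_, (hI.placed.congr hX hr).succ ?_ hr' ?_ ?_, ?_, fun x hx => ?_⟩
  · rw [a₅.v 13 (by decide)]; simp [hσ₄]
  · rw [hX']; exact e17.1
  · rw [hX']; exact e17.2.1
  · simp only [hU, hX']; exact e17.2.2
  · rw [a₅.r 1 (by decide), Finset.sum_range_succ, hr',
      Finset.sum_congr rfl fun i hi => hr i (Finset.mem_range.mp hi), ← hI.cost]
    simp [hσ₄]
  · rw [hc x hx, f17]
    have k3 : σ₄.A 3 x = σ.A 3 x := by simp [hσ₄, eA3]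
    have k15 : σ₄.v 15 = b := by simp [hσ₄, e15]
    have kB : σ₄.B 2 b = (P.len g b : ℝ) * σ.rv 0 := by simp [hσ₄]
    rw [k3, k15, kB, hI.cov x hx, ← hU]
    constructor
    · rintro ⟨h1, h2⟩ b' hb'
      rcases (show b' < b ∨ b' = b by omega) with h | rfl
      · exact h1 b' h
      · rw [hr', hX']; exact h2
    · intro h1
      have := h1 b (by omega)
      rw [hr', hX'] at this
      exact ⟨fun b' hb' => h1 b' (by omega), this⟩

theorem place_spec {P : Par} {σ : Store} (h : Fits P σ) (hn : 0 < P.n)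
    (hR : ∀ i < P.m, P.R i < P.n) {g : ℕ} (h14 : σ.v 14 = P.kk g) (h13 : σ.v 13 = P.rest g 0)
    (h1 : σ.rv 1 = 0) (h3 : ∀ x < P.n, σ.A 3 x = 0) :
    PlaceInv P (σ.rv 0) g (P.kk g) (place.eval σ) := by
  obtain ⟨τ, ha, hI, he⟩ := loop_rule (x := 15) (y := 14) (c := placeBody) (σ := σ)
    (fun i τ => PlaceInv P (σ.rv 0) g i τ)
    ⟨h13, ⟨by simp, by simp, by simp, by simp⟩, by simpa using h1,
      fun x hx => by simp [h3 x hx, Par.Uncov]⟩ (by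
      intro i hi τ ha hI
      have hr : τ.rv 0 = σ.rv 0 := ha.r 0 (by decide)
      rw [← hr] at hI ⊢
      refine placeBody_spec ((h.agree ha).setV 15 i (by omega)) hn hR (σ := τ.setV 15 i) ?_ (by simp)
      exact ⟨by simpa using hI.rest, hI.placed, hI.cost, hI.cov⟩)
  rw [place, he, ← h14]
  exact ⟨by simpa using hI.rest, hI.placed, hI.cost, hI.cov⟩

end Prog

end Structured

namespace Structured

open RAM Cmd

/-! ### Augmenting paths -/

/-- The balls with the centers `X` and the radii `r`; their number is `kk`. -/
structure Balls where
  P : Par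
  X : ℕ → ℕ
  r : ℕ → ℝ
  kk : ℕ

namespace Balls

/-- The point `x` is in the ball `b`. -/
def In (Q : Balls) (b x : ℕ) : Prop := Q.P.dd (Q.X b) x ≤ Q.r b

/-- The centers are distinct, and all points can be assigned to balls. -/
def Feas (Q : Balls) : Prop :=
  (∀ b < Q.kk, ∀ b' < Q.kk, Q.X b = Q.X b' → b = b') ∧
  ∃ f : ℕ → ℕ, (∀ x < Q.P.n, f x < Q.kk ∧ Q.In (f x) x) ∧
    ∀ b < Q.kk, ((Finset.range Q.P.n).filter (fun x => f x = b)).card ≤ Q.P.U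

/-- The first `p` points are assigned to balls. -/
structure Assigned (Q : Balls) (p : ℕ) (mu load : ℕ → ℕ) : Prop where
  lt : ∀ x < p, mu x < Q.kk
  mem : ∀ x < p, Q.In (mu x) x
  load_eq : ∀ w < Q.P.n, load w = ((Finset.range p).filter (fun x => Q.X (mu x) = w)).card
  load_le : ∀ w < Q.P.n, load w ≤ Q.P.U

/-- The ball `b` with a positive label can be reached from `p` via the point `via b`. -/
def Reached (Q : Balls) (p : ℕ) (mu lab via : ℕ → ℕ) : Prop :=
  ∀ b < Q.kk, 0 < lab b → lab b ≤ Q.P.k + 1 ∧ Q.In b (via b) ∧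
    (via b = p ∨ via b < p ∧ lab b < lab (mu (via b)))

/-- The stopping condition of the search: no point of a reached ball leads to a ball that has not
been reached. -/
def Closed (Q : Balls) (p : ℕ) (mu lab : ℕ → ℕ) : Prop :=
  ∀ x < p, 0 < lab (mu x) → ∀ b < Q.kk, Q.In b x → 0 < lab b

/-- The labels after the pairs of points and balls in `D` have been treated in a round in which the
new labels are `l`. -/
structure Round (Q : Balls) (p l : ℕ) (mu lab₀ via₀ : ℕ → ℕ) (D : ℕ → ℕ → Prop)
    (lab via : ℕ → ℕ) : Prop where
  old : ∀ b, 0 < lab₀ b → lab b = lab₀ b ∧ via b = via₀ b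
  new : ∀ b, lab₀ b = 0 → 0 < lab b → lab b = l ∧ via b < p ∧ l < lab₀ (mu (via b)) ∧ Q.In b (via b)
  done : ∀ x b, D x b → b < Q.kk → l < lab₀ (mu x) → Q.In b x → 0 < lab b

theorem Round.of_iff {Q : Balls} {p l : ℕ} {mu lab₀ via₀ : ℕ → ℕ} {D D' : ℕ → ℕ → Prop}
    {lab via : ℕ → ℕ} (h : Q.Round p l mu lab₀ via₀ D lab via)
    (hD : ∀ x b, b < Q.kk → D' x b → D x b) : Q.Round p l mu lab₀ via₀ D' lab via :=
  ⟨h.old, h.new, fun x b hb hk => h.done x b (hD x b hk hb) hk⟩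

-- A label given in this round equals `l` and thus never satisfies `l < lab (mu x)`. The condition
-- therefore refers to the labels before the round, whatever the order in which the pairs are
-- treated.
open scoped Classical in
theorem Round.step {Q : Balls} {p l : ℕ} (hl : 0 < l) {mu lab₀ via₀ : ℕ → ℕ} {D : ℕ → ℕ → Prop}
    {lab via : ℕ → ℕ} (h : Q.Round p l mu lab₀ via₀ D lab via) {x b : ℕ} (hx : x < p)
    {lab' via' : ℕ → ℕ}
    (hlab : lab' = if l < lab (mu x) ∧ lab b = 0 ∧ Q.In b x then Function.update lab b l else lab)
    (hvia : via' = if l < lab (mu x) ∧ lab b = 0 ∧ Q.In b x then Function.update via b x else via) :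
    Q.Round p l mu lab₀ via₀ (fun x' b' => D x' b' ∨ x' = x ∧ b' = b) lab' via' := by
  have hlt : l < lab (mu x) ↔ l < lab₀ (mu x) := by
    by_cases h0 : lab₀ (mu x) = 0
    · constructor
      · intro hl'
        have := (h.new _ h0 (by omega)).1
        omega
      · omega
    · rw [(h.old _ (by omega)).1]
  by_cases hc : l < lab (mu x) ∧ lab b = 0 ∧ Q.In b x
  · rw [if_pos hc] at hlab hvia
    subst hlab hvia
    have hb0 : lab₀ b = 0 := by
      by_contra hb
      have := (h.old b (by omega)).1
      omega
    refine ⟨fun b' hb' => ?_, fun b' hb' hp => ?_, fun x' b' hD hk hl' hin => ?_⟩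
    · have : b' ≠ b := by rintro rfl; omega
      simpa [this] using h.old b' hb'
    · by_cases hbb : b' = b
      · subst hbb
        simp [hx, hc.2.2, hlt.mp hc.1]
      · simpa [hbb] using h.new b' hb' (by simpa [hbb] using hp)
    · by_cases hbb : b' = b
      · subst hbb; simp [hl]
      · rw [Function.update_of_ne hbb]
        rcases hD with hD | hD
        · exact h.done x' b' hD hk hl' hin
        · exact absurd hD.2 hbb
  · rw [if_neg hc] at hlab hvia
    subst hlab hvia
    refine ⟨h.old, h.new, fun x' b' hD hk hl' hin => ?_⟩
    rcases hD with hD | ⟨rfl, rfl⟩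
    · exact h.done x' b' hD hk hl' hin
    · by_contra h0
      exact hc ⟨hlt.mpr hl', by omega, hin⟩

/-- The state of the search after `i` rounds. -/
structure Search (Q : Balls) (p i : ℕ) (mu lab via : ℕ → ℕ) : Prop where
  reached : Q.Reached p mu lab via
  start : ∀ b < Q.kk, Q.In b p → 0 < lab b
  large : ∀ b < Q.kk, 0 < lab b → Q.P.k - i < lab b
  progress : Q.Closed p mu lab ∨ i + 1 ≤ ((Finset.range Q.kk).filter (fun b => 0 < lab b)).card

/-- Either the round reaches a new ball, and the number of reached balls increases, or it reaches
none, and then the reached balls are closed. Once closed, they stay so. -/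
theorem Search.next {Q : Balls} {p i : ℕ} {mu lab₀ via₀ lab via : ℕ → ℕ}
    (h : Q.Search p i mu lab₀ via₀) (hi : i < Q.P.k) (hmu : ∀ x < p, mu x < Q.kk)
    (hr : Q.Round p (Q.P.k - i) mu lab₀ via₀ (fun x _ => x < p) lab via) :
    Q.Search p (i + 1) mu lab via := by
  have pos : ∀ b, 0 < lab₀ b → 0 < lab b := fun b hb => by rw [(hr.old b hb).1]; exact hb
  refine ⟨fun b hb hl => ?_, fun b hb hin => pos b (h.start b hb hin), fun b hb hl => ?_, ?_⟩
  · by_cases h0 : lab₀ b = 0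
    · obtain ⟨h1, h2, h3, h4⟩ := hr.new b h0 hl
      refine ⟨by omega, h4, Or.inr ⟨h2, ?_⟩⟩
      rw [(hr.old (mu (via b)) (by omega)).1, h1]; exact h3
    · obtain ⟨h1, h2⟩ := hr.old b (by omega)
      obtain ⟨h3, h4, h5⟩ := h.reached b hb (by omega)
      rw [h1, h2]
      refine ⟨h3, h4, h5.imp_right fun h6 => ⟨h6.1, ?_⟩⟩
      rw [(hr.old (mu (via₀ b)) (by omega)).1]; exact h6.2
  · by_cases h0 : lab₀ b = 0
    · rw [(hr.new b h0 hl).1]; omega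
    · have := h.large b hb (by omega)
      rw [(hr.old b (by omega)).1]; omega
  · by_cases hnew : ∃ b < Q.kk, lab₀ b = 0 ∧ 0 < lab b
    · obtain ⟨b, hb, h0, hl⟩ := hnew
      rcases h.progress with hc | hc
      · obtain ⟨h1, h2, h3, h4⟩ := hr.new b h0 hl
        have := hc _ h2 (by omega) b hb h4
        omega
      · right
        have : (Finset.range Q.kk).filter (fun b => 0 < lab₀ b) ⊂
            (Finset.range Q.kk).filter (fun b => 0 < lab b) := by
          refine Finset.ssubset_iff_of_subset (fun c hc => ?_) |>.mpr ⟨b, ?_, ?_⟩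
          · simp only [Finset.mem_filter] at hc ⊢; exact ⟨hc.1, pos c hc.2⟩
          · simp [hb, hl]
          · simp [h0]
        have := Finset.card_lt_card this
        omega
    · left
      intro x hx hl b hb hin
      have hl0 : 0 < lab₀ (mu x) := by
        by_contra h0
        exact hnew ⟨mu x, hmu x hx, by omega, hl⟩
      exact hr.done x b hx hb (h.large _ (hmu x hx) hl0) hin

/-- The other alternative in `progress` would require `k + 1` reached balls, but there are at most
`k`. -/
theorem Search.closed {Q : Balls} {p : ℕ} {mu lab via : ℕ → ℕ} (h : Q.Search p Q.P.k mu lab via)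
    (hk : Q.kk ≤ Q.P.k) : Q.Closed p mu lab := by
  rcases h.progress with hc | hc
  · exact hc
  · have := (Finset.card_filter_le (Finset.range Q.kk) (fun b => 0 < lab b))
    rw [Finset.card_range] at this
    omega

/-- The counting direction of Hall's theorem. The reached balls `L` are full, so at least `L.card *
U` points are assigned to them. In any assignment these points and `p` must all go to balls in `L`,
which is one point too many. Distinct centers are needed to identify the load of a center with that
of its ball. -/
theorem not_feas {Q : Balls} {p : ℕ} (hp : p < Q.P.n) {mu lab load : ℕ → ℕ}
    (hX : ∀ b < Q.kk, Q.X b < Q.P.n) (hA : Q.Assigned p mu load)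
    (hc : Q.Closed p mu lab) (hs : ∀ b < Q.kk, Q.In b p → 0 < lab b)
    (hfull : ∀ b < Q.kk, 0 < lab b → Q.P.U ≤ load (Q.X b)) : ¬ Q.Feas := by
  rintro ⟨hinj, f, hf, hU⟩
  set L := (Finset.range Q.kk).filter (fun b => 0 < lab b) with hL
  set S := (Finset.range p).filter (fun x => mu x ∈ L) with hS
  have h1 : S.card = ∑ b ∈ L, ((Finset.range p).filter (fun x => mu x = b)).card := by
    rw [Finset.card_eq_sum_card_fiberwise (f := mu) (t := L)]
    · refine Finset.sum_congr rfl fun b hb => ?_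
      congr 1
      ext x
      simp only [hS, Finset.mem_filter]
      constructor
      · rintro ⟨⟨h1, h2⟩, h3⟩; exact ⟨h1, h3⟩
      · rintro ⟨h1, h2⟩; exact ⟨⟨h1, h2 ▸ hb⟩, h2⟩
    · intro x hx
      exact (Finset.mem_filter.mp hx).2
  have h2 : ∀ b ∈ L, ((Finset.range p).filter (fun x => mu x = b)).card = load (Q.X b) := by
    intro b hb
    simp only [hL, Finset.mem_filter, Finset.mem_range] at hb
    rw [hA.load_eq _ (hX b hb.1)]
    congr 1
    refine Finset.filter_congr fun x hx => ⟨fun h => by rw [h], fun h => ?_⟩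
    exact hinj _ (hA.lt x (Finset.mem_range.mp hx)) _ hb.1 h
  have h3 : L.card * Q.P.U ≤ S.card := by
    rw [h1, ← smul_eq_mul]
    refine Finset.card_nsmul_le_sum _ _ _ fun b hb => ?_
    rw [h2 b hb]
    simp only [hL, Finset.mem_filter, Finset.mem_range] at hb
    exact hfull b hb.1 hb.2
  have hpS : p ∉ S := by simp [hS]
  have h4 : (insert p S).card ≤ ∑ b ∈ L, ((Finset.range Q.P.n).filter (fun x => f x = b)).card := by
    rw [Finset.card_eq_sum_card_fiberwise (f := f) (t := L)]
    · refine Finset.sum_le_sum fun b hb => Finset.card_le_card fun x hx => ?_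
      simp only [Finset.mem_filter, Finset.mem_insert, hS, Finset.mem_range] at hx ⊢
      refine ⟨?_, hx.2⟩
      rcases hx.1 with rfl | h <;> omega
    · intro x hx
      simp only [Finset.mem_coe, Finset.mem_insert, hS, Finset.mem_filter, Finset.mem_range,
        hL] at hx ⊢
      rcases hx with rfl | ⟨hx, hm⟩
      · exact ⟨(hf x hp).1, hs _ (hf x hp).1 (hf x hp).2⟩
      · have := hf x (by omega)
        exact ⟨this.1, hc x hx hm.2 _ this.1 this.2⟩
  have h5 : ∑ b ∈ L, ((Finset.range Q.P.n).filter (fun x => f x = b)).card ≤ L.card * Q.P.U := by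
    rw [← smul_eq_mul]
    refine Finset.sum_le_card_nsmul _ _ _ fun b hb => hU b ?_
    simp only [hL, Finset.mem_filter, Finset.mem_range] at hb
    exact hb.1
  rw [Finset.card_insert_of_notMem hpS] at h4
  omega

/-- The state of the search for a new assignment: the point `p` waits for a ball, or the ball `f`
waits for a point. -/
structure Flip (Q : Balls) (p i f : ℕ) (mu lab via load : ℕ → ℕ) : Prop where
  lt : ∀ x < p, mu x < Q.kk
  mem : ∀ x ≤ p, mu x < Q.kk → Q.In (mu x) x
  load_eq : ∀ w < Q.P.n, load w =
    ((Finset.range (p + 1)).filter (fun x => mu x < Q.kk ∧ Q.X (mu x) = w)).card +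
      if f < Q.kk ∧ Q.X f = w then 1 else 0
  last : mu p < Q.kk ↔ ¬ f < Q.kk
  lab_pos : f < Q.kk → i + 1 ≤ lab f
  chain : f < Q.kk → ∀ b < Q.kk, lab f ≤ lab b → lab b ≤ Q.P.k + 1 ∧ Q.In b (via b) ∧
    (via b = p ∨ via b < p ∧ lab b < lab (mu (via b)))

theorem card_filter_update {s : Finset ℕ} {mu : ℕ → ℕ} {z f : ℕ} (hz : z ∈ s) (C : ℕ → Prop)
    [DecidablePred C] :
    (s.filter (fun x => C (Function.update mu z f x))).card + (if C (mu z) then 1 else 0) =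
      (s.filter (fun x => C (mu x))).card + if C f then 1 else 0 := by
  rw [Finset.card_filter, Finset.card_filter, ← Finset.add_sum_erase _ _ hz,
    ← Finset.add_sum_erase s (fun x => if C (mu x) then 1 else 0) hz, Function.update_self]
  have : ∑ x ∈ s.erase z, (if C (Function.update mu z f x) then 1 else 0) =
      ∑ x ∈ s.erase z, if C (mu x) then 1 else 0 := by
    refine Finset.sum_congr rfl fun x hx => ?_
    rw [Function.update_of_ne (Finset.ne_of_mem_erase hx)]
  rw [this]
  ring

/-- The point `via f` moves to `f`, and the ball it leaves becomes the waiting one, so the loads do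
not change. Labels increase strictly along the path, hence the rest of the path does not use the
point that has just been moved. -/
theorem Flip.next {Q : Balls} {p i f : ℕ} {mu lab via load : ℕ → ℕ}
    (h : Q.Flip p i f mu lab via load) (hf : f < Q.kk) :
    Q.Flip p (i + 1) (mu (via f)) (Function.update mu (via f) f) lab via load := by
  obtain ⟨h1, h2, h3⟩ := h.chain hf f hf le_rfl
  set z := via f with hz
  have hzp : z ≤ p := by rcases h3 with h | h <;> omega
  have hpk : ¬ mu p < Q.kk := fun hh => h.last.mp hh hf
  refine ⟨fun x hx => ?_, fun x hx hm => ?_, fun w hw => ?_, ?_, fun ho => ?_, fun ho b hb hl => ?_⟩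
  · by_cases hxz : x = z
    · subst hxz; simpa using hf
    · simpa [hxz] using h.lt x hx
  · by_cases hxz : x = z
    · subst hxz; simpa using h2
    · rw [Function.update_of_ne hxz] at hm ⊢
      exact h.mem x hx hm
  · rw [h.load_eq w hw]
    exact (card_filter_update (by simpa using Nat.lt_succ_of_le hzp)
      (fun y => y < Q.kk ∧ Q.X y = w)).symm
  · rcases h3 with h3 | h3
    · rw [h3]; simpa [hf] using hpk
    · rw [Function.update_of_ne (by omega)]
      exact iff_of_false hpk (not_not_intro (h.lt z h3.1))
  · rcases h3 with h3 | h3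
    · rw [h3] at ho; exact absurd ho hpk
    · have := h.lab_pos hf
      omega
  · rcases h3 with h3 | h3
    · rw [h3] at ho; exact absurd ho hpk
    · obtain ⟨c1, c2, c3⟩ := h.chain hf b hb (by omega)
      refine ⟨c1, c2, c3.imp_right fun c4 => ⟨c4.1, ?_⟩⟩
      have : via b ≠ z := by
        intro hbz
        rw [hbz] at c4
        omega
      rw [Function.update_of_ne this]; exact c4.2

theorem Flip.mono {Q : Balls} {p i f : ℕ} {mu lab via load : ℕ → ℕ}
    (h : Q.Flip p i f mu lab via load) (hf : ¬ f < Q.kk) (j : ℕ) :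
    Q.Flip p j f mu lab via load :=
  ⟨h.lt, h.mem, h.load_eq, h.last, fun h => absurd h hf, fun h => absurd h hf⟩

/-- The load at the end of the path is increased in advance; the last summand of `load_eq` accounts
for the point that the ball `f` still waits for. -/
theorem Flip.start {Q : Balls} {p f : ℕ} (hp : p < Q.P.n) {mu mu' lab via load load' : ℕ → ℕ}
    (hk : Q.kk ≤ Q.P.k) (hA : Q.Assigned p mu load)
    (hmu : ∀ x, mu' x = if x = p then Q.P.k else mu x)
    (hr : Q.Reached p mu' lab via) (hf : f < Q.kk) (hlf : 0 < lab f)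
    (hload : ∀ w < Q.P.n, load' w = if w = Q.X f then load w + 1 else load w) :
    Q.Flip p 0 f mu' lab via load' := by
  have hlt : ∀ x < p, mu' x = mu x := fun x hx => by rw [hmu, if_neg hx.ne]
  have hp' : mu' p = Q.P.k := by rw [hmu, if_pos rfl]
  refine ⟨fun x hx => by rw [hlt x hx]; exact hA.lt x hx, fun x hx hm => ?_, fun w hw => ?_, ?_,
    fun _ => hlf, fun _ b hb hl => hr b hb (by omega)⟩
  · rcases hx.lt_or_eq with hx | rfl
    · rw [hlt x hx]; exact hA.mem x hx
    · rw [hp'] at hm; omega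
  · have : (Finset.range (p + 1)).filter (fun x => mu' x < Q.kk ∧ Q.X (mu' x) = w) =
        (Finset.range p).filter (fun x => Q.X (mu x) = w) := by
      ext x
      simp only [Finset.mem_filter, Finset.mem_range]
      constructor
      · rintro ⟨h1, h2, h3⟩
        have : x ≠ p := by rintro rfl; omega
        have hx : x < p := by omega
        rw [hlt x hx] at h3
        exact ⟨hx, h3⟩
      · rintro ⟨h1, h2⟩
        rw [hlt x h1]
        exact ⟨by omega, hA.lt x h1, h2⟩
    rw [hload w hw, this, ← hA.load_eq w hw]
    by_cases hwf : w = Q.X f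
    · simp [hwf, hf]
    · simp [hwf, Ne.symm hwf]
  · rw [hp']; exact iff_of_false (by omega) (not_not_intro hf)

/-- After `k + 1` iterations a waiting ball would have a label of at least `k + 2`, but labels are
at most `k + 1`. -/
theorem Flip.finish {Q : Balls} {p f : ℕ} {mu lab via load : ℕ → ℕ}
    (h : Q.Flip p (Q.P.k + 1) f mu lab via load) (hl : ∀ w < Q.P.n, load w ≤ Q.P.U) :
    Q.Assigned (p + 1) mu load := by
  have hf : ¬ f < Q.kk := by
    intro hf
    have := h.lab_pos hf
    have := (h.chain hf f hf le_rfl).1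
    omega
  have hlt : ∀ x < p + 1, mu x < Q.kk := by
    intro x hx
    rcases (Nat.lt_succ_iff.mp hx).lt_or_eq with hx | rfl
    · exact h.lt x hx
    · exact h.last.mpr hf
  refine ⟨hlt, fun x hx => h.mem x (by omega) (hlt x hx), fun w hw => ?_, hl⟩
  rw [h.load_eq w hw, if_neg (by tauto), add_zero]
  congr 1
  refine Finset.filter_congr fun x hx => ?_
  simp [hlt x (Finset.mem_range.mp hx)]

end Balls

end Structured

/-! ### Correctness of the augmenting-path search in the program. -/

namespace Structured

open RAM Cmd

namespace Prog

/-- The program is about to assign the points to the balls `Q`. -/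
structure Holds (Q : Balls) (σ : Store) : Prop where
  fits : Fits Q.P σ
  X : σ.A 2 = Q.X
  r : σ.B 2 = Q.r
  kk : σ.v 14 = Q.kk
  lt : ∀ b < Q.kk, Q.X b < Q.P.n
  le : Q.kk ≤ Q.P.k

theorem Holds.agree {Q : Balls} {σ τ : Store} {c : Cmd} (h : Holds Q σ) (ha : Agree c σ τ)
    (hc : (c.keeps && !c.modA 2 && !c.modB 2 && !c.modV 14) = true := by decide) : Holds Q τ := by
  simp only [Bool.and_eq_true, Bool.not_eq_true'] at hc
  exact ⟨h.fits.agree ha hc.1.1.1, by rw [ha.A _ hc.1.1.2, h.X], by rw [ha.B _ hc.1.2, h.r],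
    by rw [ha.v _ hc.2, h.kk], h.lt, h.le⟩

theorem Holds.eval {Q : Balls} {σ : Store} (h : Holds Q σ) (c : Cmd)
    (hc : (c.keeps && !c.modA 2 && !c.modB 2 && !c.modV 14) = true := by decide) :
    Holds Q (c.eval σ) := h.agree (eval_agree c σ) hc

theorem Holds.setV {Q : Balls} {σ : Store} (h : Holds Q σ) (x i : ℕ) (hx : 8 < x)
    (hx' : x ≠ 14) : Holds Q (σ.setV x i) :=
  ⟨h.fits.setV x i hx, h.X, h.r, by rw [Store.setV_v, if_neg (Ne.symm hx')]; exact h.kk, h.lt, h.le⟩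

theorem searchInit_spec {Q : Balls} {σ : Store} (h : Holds Q σ) (hp : σ.v 19 < Q.P.n) :
    (∀ x, (searchInit.eval σ).A 7 x = if x = σ.v 19 then Q.P.k else σ.A 7 x) ∧
    ∀ b < Q.kk, (Q.In b (σ.v 19) ∧ (searchInit.eval σ).A 5 b = Q.P.k + 1 ∧
        (searchInit.eval σ).A 6 b = σ.v 19) ∨
      (¬ Q.In b (σ.v 19) ∧ (searchInit.eval σ).A 5 b = 0) := by
  have h₁ : Holds Q ((put 7 (.v 19) (.v 1)).eval σ) := h.eval _
  set σ₁ := (put 7 (.v 19) (.v 1)).eval σ with hσ₁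
  have e19 : σ₁.v 19 = σ.v 19 := rfl
  obtain ⟨τ, ha, hI, he⟩ := loop_rule (x := 15) (y := 14)
    (c := (ifRlt (.arr 2 (.v 15)) (dst (.arr 2 (.v 15)) (.v 19)) (put 5 (.v 15) (.c 0))
      (seq (put 5 (.v 15) (.v 7)) (put 6 (.v 15) (.v 19))))) (σ := σ₁)
    (fun i τ => ∀ b < i, (Q.In b (σ.v 19) ∧ τ.A 5 b = Q.P.k + 1 ∧ τ.A 6 b = σ.v 19) ∨
      (¬ Q.In b (σ.v 19) ∧ τ.A 5 b = 0)) (by simp) (by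
      intro i hi τ ha hI b hb
      have hf := (h₁.agree ha).setV 15 i (by omega) (by omega)
      rw [h₁.kk] at hi
      have h19 : τ.v 19 = σ.v 19 := ha.v 19 (by decide)
      have hX : τ.A 2 = Q.X := hf.X
      have hr : τ.B 2 = Q.r := hf.r
      have h7 : τ.v 7 = Q.P.k + 1 := hf.fits.h7
      have hd := hf.fits.dst (a := .arr 2 (.v 15)) (b := .v 19)
        (by simpa [E.ev, wix, hX] using h.lt i hi) (by simpa [E.ev, h19] using hp)
      simp only [E.ev, Store.setV_v, if_pos, wix, Store.setV_A, hX] at hd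
      norm_num at hd
      rw [h19] at hd
      simp only [eval, E.ev, RE.ev, hd, rix, wix, Store.setV_v, Store.setV_B, hr]
      by_cases hbi : b = i
      · subst hbi
        by_cases hin : Q.In b (σ.v 19)
        · left
          have : ¬ Q.r b < Q.P.dd (Q.X b) (σ.v 19) := not_lt.mpr hin
          simp [this, hin, h7, h19]
        · right
          have : Q.r b < Q.P.dd (Q.X b) (σ.v 19) := not_le.mp hin
          simp [this, hin]
      · have := hI b (by omega)
        norm_num
        split <;> simpa [hbi] using this)
  have h7 : (searchInit.eval σ).A 7 = σ₁.A 7 := by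
    rw [searchInit, eval_seq, ← hσ₁]
    exact (eval_agree _ _).A 7 (by decide)
  refine ⟨fun x => ?_, ?_⟩
  · rw [h7]; simp [hσ₁, Cmd.eval, E.ev, wix, h.fits.h1]
  · rw [h₁.kk] at hI
    have : searchInit.eval σ = τ.setV 15 (σ₁.v 14) := by rw [← he]; rfl
    rw [this]
    simpa using hI

theorem searchStep_spec {Q : Balls} {σ : Store} (h : Holds Q σ) {x b i : ℕ} {mu : ℕ → ℕ}
    (hx : x < Q.P.n) (hb : b < Q.kk) (e9 : σ.v 9 = x) (e15 : σ.v 15 = b) (e20 : σ.v 20 = i)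
    (e7 : σ.A 7 = mu) : open scoped Classical in
    ((searchStep.eval σ).A 5 = if Q.P.k - i < σ.A 5 (mu x) ∧ σ.A 5 b = 0 ∧ Q.In b x then
      Function.update (σ.A 5) b (Q.P.k - i) else σ.A 5) ∧
    (searchStep.eval σ).A 6 = if Q.P.k - i < σ.A 5 (mu x) ∧ σ.A 5 b = 0 ∧ Q.In b x then
      Function.update (σ.A 6) b x else σ.A 6 := by
  have hd := h.fits.dst (a := .arr 2 (.v 15)) (b := .v 9)
    (by simpa [E.ev, wix, h.X, e15] using h.lt _ hb) (by simpa [E.ev, e9] using hx)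
  simp only [E.ev, wix, h.X, e9, e15] at hd
  norm_num at hd
  simp only [searchStep, eval, RE.ev, hd, rix, h.r, E.ev, wix, WordOp.eval, h.fits.h1, e9, e15,
    e20, e7]
  norm_num
  by_cases h1 : Q.P.k - i < σ.A 5 (mu x)
  · by_cases h2 : σ.A 5 b = 0
    · by_cases h3 : Q.In b x
      · have : ¬ Q.r b < Q.P.dd (Q.X b) x := not_lt.mpr h3
        simp only [h1, h2, h3, this, if_true, if_false, and_self]
        constructor <;> funext i <;> simp [Function.update_apply, Store.setA, e15, e9]
      · have : Q.r b < Q.P.dd (Q.X b) x := not_le.mp h3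
        simp [h1, h2, h3, this]
    · simp [h1, h2]
  · simp [h1]

theorem searchRound_spec {Q : Balls} {σ : Store} (h : Holds Q σ) (hp : σ.v 19 < Q.P.n)
    (hi : σ.v 20 < Q.P.k) :
    Q.Round (σ.v 19) (Q.P.k - σ.v 20) (σ.A 7) (σ.A 5) (σ.A 6) (fun x _ => x < σ.v 19)
      ((searchRound.eval σ).A 5) ((searchRound.eval σ).A 6) := by
  obtain ⟨τ, ha, hI, he⟩ := loop_rule (x := 9) (y := 19) (c := loop 15 14 searchStep) (σ := σ)
    (fun i τ => Q.Round (σ.v 19) (Q.P.k - σ.v 20) (σ.A 7) (σ.A 5) (σ.A 6) (fun x _ => x < i)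
      (τ.A 5) (τ.A 6)) ⟨by simp, by intro b; omega, by simp⟩ (by
      intro x hx τ ha hI
      have hf := (h.agree ha).setV 9 x (by omega) (by omega)
      obtain ⟨τ', ha', hI', he'⟩ := loop_rule (x := 15) (y := 14) (c := searchStep)
        (σ := τ.setV 9 x)
        (fun j τ' => Q.Round (σ.v 19) (Q.P.k - σ.v 20) (σ.A 7) (σ.A 5) (σ.A 6)
          (fun x' b' => x' < x ∨ x' = x ∧ b' < j) (τ'.A 5) (τ'.A 6))
        (hI.of_iff (by simp)) (by
          intro j hj τ' ha' hI'
          have hf' := (hf.agree ha').setV 15 j (by omega) (by omega)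
          rw [hf.kk] at hj
          have e9 : τ'.v 9 = x := by rw [ha'.v 9 (by decide)]; simp
          have e20 : τ'.v 20 = σ.v 20 := by
            rw [ha'.v 20 (by decide)]; simpa using ha.v 20 (by decide)
          have e7 : τ'.A 7 = σ.A 7 := by
            rw [ha'.A 7 (by decide)]; simpa using ha.A 7 (by decide)
          obtain ⟨s5, s6⟩ := searchStep_spec hf' (hx.trans hp) hj
            (by simpa using e9) (by simp) (by simpa using e20) e7
          refine (hI'.step (by omega) hx s5 s6).of_iff ?_
          intro x' b' _ hx'
          omega)
      rw [he']
      rw [hf.kk] at hI'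
      refine hI'.of_iff ?_
      intro x' b' _ hx'
      omega)
  rw [searchRound, he]
  exact hI

theorem search_spec {Q : Balls} {σ : Store} (h : Holds Q σ) (hp : σ.v 19 < Q.P.n)
    (hmu : ∀ x < σ.v 19, σ.A 7 x < Q.kk)
    (hs : Q.Search (σ.v 19) 0 (σ.A 7) (σ.A 5) (σ.A 6)) :
    Q.Search (σ.v 19) Q.P.k (σ.A 7) ((search.eval σ).A 5) ((search.eval σ).A 6) := by
  obtain ⟨τ, ha, hI, he⟩ := loop_rule (x := 20) (y := 1) (c := searchRound) (σ := σ)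
    (fun i τ => Q.Search (σ.v 19) i (σ.A 7) (τ.A 5) (τ.A 6)) hs (by
      intro i hi τ ha hI
      have hf := (h.agree ha).setV 20 i (by omega) (by omega)
      rw [h.fits.h1] at hi
      have e19 : τ.v 19 = σ.v 19 := ha.v 19 (by decide)
      have e7 : τ.A 7 = σ.A 7 := ha.A 7 (by decide)
      have := searchRound_spec hf (by simpa [e19] using hp) (by simpa using hi)
      simp only [Store.setV_v, Store.setV_A, e7, if_true] at this
      norm_num at this
      rw [e19] at this
      exact hI.next hi hmu this)
  rw [search, he, ← h.fits.h1]
  exact hI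

theorem findFree_spec {Q : Balls} {σ : Store} (h : Holds Q σ) :
    ((findFree.eval σ).v 21 < Q.kk ∧ 0 < σ.A 5 ((findFree.eval σ).v 21) ∧
      σ.A 4 (Q.X ((findFree.eval σ).v 21)) < Q.P.U) ∨
    ((findFree.eval σ).v 21 = Q.P.k ∧ ∀ b < Q.kk, 0 < σ.A 5 b → Q.P.U ≤ σ.A 4 (Q.X b)) := by
  obtain ⟨τ, ha, hI, he⟩ := loop_rule (x := 15) (y := 14)
    (c := (ifLt (.c 0) (.arr 5 (.v 15))
      (ifLt (.arr 4 (.arr 2 (.v 15))) (.v 2) (set 21 (.v 15)) skip) skip))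
    (σ := σ.setV 21 Q.P.k)
    (fun i τ => (τ.v 21 < Q.kk ∧ 0 < σ.A 5 (τ.v 21) ∧ σ.A 4 (Q.X (τ.v 21)) < Q.P.U) ∨
      (τ.v 21 = Q.P.k ∧ ∀ b < i, 0 < σ.A 5 b → Q.P.U ≤ σ.A 4 (Q.X b)))
    (by simp) (by
      intro i hi τ ha hI
      have hf := ((h.setV 21 Q.P.k (by omega) (by omega)).agree ha).setV 15 i (by omega) (by omega)
      have hi' : i < Q.kk := by simpa [h.kk] using hi
      have e5 : τ.A 5 = σ.A 5 := ha.A 5 (by decide)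
      have e4 : τ.A 4 = σ.A 4 := ha.A 4 (by decide)
      have hX : τ.A 2 = Q.X := hf.X
      have hU : τ.v 2 = Q.P.U := hf.fits.h2
      simp only [eval, E.ev, wix, Store.setV_v, Store.setV_A, e5, e4, hX]
      norm_num
      rw [hU]
      by_cases h5 : 0 < σ.A 5 i
      · by_cases h4 : σ.A 4 (Q.X i) < Q.P.U
        · left; simp [h5, h4, hi']
        · simp only [h5, h4, if_true, if_false]
          refine hI.imp (fun h => by simpa using h) fun h => ⟨by simpa using h.1, fun b hb h0 => ?_⟩
          rcases (show b < i ∨ b = i by omega) with hb | rfl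
          · exact h.2 b hb h0
          · exact not_lt.mp h4
      · simp only [h5, if_false]
        refine hI.imp (fun h => by simpa using h) fun h => ⟨by simpa using h.1, fun b hb h0 => ?_⟩
        rcases (show b < i ∨ b = i by omega) with hb | rfl
        · exact h.2 b hb h0
        · exact absurd h0 h5)
  have : findFree.eval σ = τ.setV 15 (σ.v 14) := by
    refine Eq.trans ?_ (he.trans (by simp))
    simp [findFree, eval, E.ev, h.fits.h1]
  rw [this]
  simpa [h.kk] using hI

theorem flip_spec {Q : Balls} {σ : Store} (h : Holds Q σ) {p : ℕ}
    (hf : Q.Flip p 0 (σ.v 21) (σ.A 7) (σ.A 5) (σ.A 6) (σ.A 4)) (hl : ∀ w < Q.P.n, σ.A 4 w ≤ Q.P.U) :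
    Q.Assigned (p + 1) ((flip.eval σ).A 7) (σ.A 4) := by
  obtain ⟨τ, ha, hI, he⟩ := loop_rule (x := 20) (y := 7)
    (c := (ifLt (.v 21) (.v 14)
      (seq (set 22 (.arr 6 (.v 21))) <| seq (set 23 (.arr 7 (.v 22))) <|
      seq (put 7 (.v 22) (.v 21)) (set 21 (.v 23))) skip)) (σ := σ)
    (fun i τ => Q.Flip p i (τ.v 21) (τ.A 7) (σ.A 5) (σ.A 6) (σ.A 4)) hf (by
      intro i hi τ ha hI
      have hf := (h.agree ha).setV 20 i (by omega) (by omega)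
      have e6 : τ.A 6 = σ.A 6 := ha.A 6 (by decide)
      have e14 : τ.v 14 = Q.kk := by simpa using hf.kk
      simp only [eval, E.ev, wix, Store.setV_v, Store.setV_A, e6]
      norm_num
      rw [e14]
      by_cases hk : τ.v 21 < Q.kk
      · have := hI.next hk
        rw [if_pos hk]
        convert this using 1
        · simp
        · funext x
          simp [Function.update_apply]
      · rw [if_neg hk]
        exact (hI.mono hk _))
  rw [h.fits.h7] at hI
  rw [flip, he]
  exact hI.finish hl

/-- After a failure the assignment is no longer under control while the loop over the points
continues; it only matters that the flag stays `0`. -/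
theorem augment_v18 (σ : Store) : (augment.eval σ).v 18 = σ.v 18 ∨ (augment.eval σ).v 18 = 0 := by
  simp only [augment, eval_seq]
  rw [(eval_agree flip _).v 18 (by decide)]
  set σ₃ := findFree.eval (search.eval (searchInit.eval σ)) with hσ₃
  have : σ₃.v 18 = σ.v 18 := by
    rw [hσ₃, (eval_agree findFree _).v 18 (by decide), (eval_agree search _).v 18 (by decide),
      (eval_agree searchInit _).v 18 (by decide)]
  simp only [count, eval]
  split
  · left; simpa using this
  · right; simp [E.ev]

/-- If some reached ball has a free place, the path to it is flipped. Otherwise all reached balls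
are full, and since they are closed, `Balls.not_feas` applies. -/
theorem augment_spec {Q : Balls} {σ : Store} (h : Holds Q σ) (hp : σ.v 19 < Q.P.n)
    (hA : Q.Assigned (σ.v 19) (σ.A 7) (σ.A 4)) :
    ((augment.eval σ).v 18 = σ.v 18 ∧
      Q.Assigned (σ.v 19 + 1) ((augment.eval σ).A 7) ((augment.eval σ).A 4)) ∨
    ((augment.eval σ).v 18 = 0 ∧ ¬ Q.Feas) := by
  simp only [augment, eval_seq]
  obtain ⟨i1, i2⟩ := searchInit_spec h hp
  have h₁ : Holds Q (searchInit.eval σ) := h.eval _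
  have a₁ := eval_agree searchInit σ
  set σ₁ := searchInit.eval σ
  have e₁19 : σ₁.v 19 = σ.v 19 := a₁.v 19 (by decide)
  have hmu : ∀ x < σ.v 19, σ₁.A 7 x = σ.A 7 x := fun x hx => by rw [i1, if_neg hx.ne]
  have hs : Q.Search (σ₁.v 19) 0 (σ₁.A 7) (σ₁.A 5) (σ₁.A 6) := by
    rw [e₁19]
    refine ⟨fun b hb hl => ?_, fun b hb hin => ?_, fun b hb hl => ?_, ?_⟩
    · rcases i2 b hb with ⟨h1, h2, h3⟩ | ⟨h1, h2⟩
      · rw [h2, h3]; exact ⟨le_rfl, h1, Or.inl rfl⟩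
      · omega
    · rcases i2 b hb with ⟨h1, h2, h3⟩ | ⟨h1, h2⟩
      · omega
      · exact absurd hin h1
    · rcases i2 b hb with ⟨h1, h2, h3⟩ | ⟨h1, h2⟩ <;> omega
    · by_cases hb : ∃ b < Q.kk, 0 < σ₁.A 5 b
      · right
        obtain ⟨b, hb, hl⟩ := hb
        exact Finset.card_pos.mpr ⟨b, by simp [hb, hl]⟩
      · left
        intro x hx hl
        refine absurd ⟨σ₁.A 7 x, ?_, hl⟩ hb
        rw [hmu x hx]; exact hA.lt x hx
  have hs' := search_spec h₁ (by rw [e₁19]; exact hp) (by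
    intro x hx; rw [e₁19] at hx; rw [hmu x hx]; exact hA.lt x hx) hs
  have h₂ : Holds Q (search.eval σ₁) := h₁.eval _
  have a₂ := eval_agree search σ₁
  set σ₂ := search.eval σ₁
  rw [e₁19] at hs'
  have hf := findFree_spec h₂
  have h₃ : Holds Q (findFree.eval σ₂) := h₂.eval _
  have a₃ := eval_agree findFree σ₂
  set σ₃ := findFree.eval σ₂
  have e₃5 : σ₃.A 5 = σ₂.A 5 := a₃.A 5 (by decide)
  have e₃6 : σ₃.A 6 = σ₂.A 6 := a₃.A 6 (by decide)
  have e₃7 : σ₃.A 7 = σ₁.A 7 := by rw [a₃.A 7 (by decide), a₂.A 7 (by decide)]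
  have e₂4 : σ₂.A 4 = σ.A 4 := by rw [a₂.A 4 (by decide), a₁.A 4 (by decide)]
  have e₃4 : σ₃.A 4 = σ.A 4 := by rw [a₃.A 4 (by decide), e₂4]
  have e₃18 : σ₃.v 18 = σ.v 18 := by
    rw [a₃.v 18 (by decide), a₂.v 18 (by decide), a₁.v 18 (by decide)]
  rw [e₂4] at hf
  have h₄ : Holds Q (count.eval σ₃) := h₃.eval _
  have a₄ := eval_agree count σ₃
  have e₅18 : (flip.eval (count.eval σ₃)).v 18 = (count.eval σ₃).v 18 :=
    (eval_agree flip _).v 18 (by decide)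
  have e₅4 : (flip.eval (count.eval σ₃)).A 4 = (count.eval σ₃).A 4 :=
    (eval_agree flip _).A 4 (by decide)
  rw [e₅18, e₅4]
  rcases hf with ⟨f1, f2, f3⟩ | ⟨f1, f2⟩
  · left
    have hc : count.eval σ₃ = σ₃.setA 4 (Q.X (σ₃.v 21)) (σ.A 4 (Q.X (σ₃.v 21)) + 1) := by
      simp only [count, eval, E.ev, WordOp.eval, wix, h₃.kk, h₃.X, h₃.fits.h2, f1, if_true, e₃4]
      norm_num
      congr 1
      omega
    set σ₄ := count.eval σ₃
    have e18 : σ₄.v 18 = σ.v 18 := by rw [hc]; simpa using e₃18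
    have e4 : ∀ w, σ₄.A 4 w = if w = Q.X (σ₃.v 21) then σ.A 4 w + 1 else σ.A 4 w := by
      intro w
      rw [hc, Store.setA_A, e₃4]
      by_cases hw : w = Q.X (σ₃.v 21)
      · simp [hw]
      · simp [hw]
    have e21 : σ₄.v 21 = σ₃.v 21 := a₄.v 21 (by decide)
    refine ⟨e18, flip_spec h₄ ?_ ?_⟩
    · refine Balls.Flip.start hp h.le hA (fun x => ?_) ?_ (by rw [e21]; exact f1) ?_
        (fun w hw => by rw [e4, e21])
      · rw [a₄.A 7 (by decide), e₃7, i1]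
      · rw [a₄.A 7 (by decide), a₄.A 5 (by decide), a₄.A 6 (by decide), e₃7, e₃5, e₃6]
        exact hs'.reached
      · rw [e21, a₄.A 5 (by decide), e₃5]; exact f2
    · intro w hw
      rw [e4]
      split
      · subst w; omega
      · exact hA.load_le w hw
  · right
    refine ⟨?_, ?_⟩
    · have : ¬ σ₃.v 21 < Q.kk := by rw [f1]; exact not_lt.mpr h.le
      simp [count, eval, E.ev, h₃.kk, this]
    · refine Balls.not_feas hp h.lt hA ?_ hs'.start f2
      have := hs'.closed h.le
      intro x hx hl
      refine this x hx ?_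
      rwa [hmu x hx]

end Prog

end Structured

/-! ### Solutions found by the program: attempts, rounds, and the output. -/

namespace Structured

open RAM Cmd

/-- The assignment `O` of the points to centers is a solution of cost at most `c`. -/
def Par.Sol (P : Par) (O : ℕ → ℕ) (c : ℝ) : Prop :=
  ∃ r : ℕ → ℝ, (∀ w, 0 ≤ r w) ∧ (∀ x < P.n, O x < P.n ∧ P.dd (O x) x ≤ r (O x)) ∧
    ((Finset.range P.n).image O).card ≤ P.k ∧ ∑ w ∈ (Finset.range P.n).image O, r w ≤ c ∧
    ∀ w < P.n, ((Finset.range P.n).filter (fun x => O x = w)).card ≤ P.U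

theorem Par.Sol.congr {P : Par} {O O' : ℕ → ℕ} {c : ℝ} (h : P.Sol O c)
    (hO : ∀ x < P.n, O' x = O x) : P.Sol O' c := by
  obtain ⟨r, h1, h2, h3, h4, h5⟩ := h
  have hi : (Finset.range P.n).image O' = (Finset.range P.n).image O :=
    Finset.image_congr fun x hx => hO x (by simpa using hx)
  refine ⟨r, h1, fun x hx => by rw [hO x hx]; exact h2 x hx, by rwa [hi], by rwa [hi],
    fun w hw => ?_⟩
  rw [Finset.filter_congr (q := fun x => O x = w)]
  · exact h5 w hw
  · intro x hx
    rw [hO x (Finset.mem_range.mp hx)]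

/-- Loads are counted per center and not per ball, so the result is a solution even if balls share a
center; such a center gets the sum of their radii. For this reason wrong guesses do no harm. -/
theorem Balls.Assigned.sol {Q : Balls} {mu load : ℕ → ℕ} (h : Q.Assigned Q.P.n mu load)
    (hX : ∀ b < Q.kk, Q.X b < Q.P.n) (hk : Q.kk ≤ Q.P.k) (hr : ∀ b < Q.kk, 0 ≤ Q.r b) :
    Q.P.Sol (fun x => Q.X (mu x)) (∑ b ∈ Finset.range Q.kk, Q.r b) := by
  have hr' : ∀ b ∈ Finset.range Q.kk, 0 ≤ Q.r b := fun b hb => hr b (Finset.mem_range.mp hb)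
  refine ⟨fun w => ∑ b ∈ (Finset.range Q.kk).filter (fun b => Q.X b = w), Q.r b, fun w => ?_,
    fun x hx => ⟨hX _ (h.lt x hx), (h.mem x hx).trans ?_⟩, ?_, ?_, fun w hw => ?_⟩
  · exact Finset.sum_nonneg fun b hb => hr' b (Finset.mem_filter.mp hb).1
  · exact Finset.single_le_sum (f := Q.r)
      (s := (Finset.range Q.kk).filter (fun b => Q.X b = Q.X (mu x)))
      (fun b hb => hr' b (Finset.mem_filter.mp hb).1) (by simpa using h.lt x hx)
  · refine (Finset.card_le_card (t := (Finset.range Q.kk).image Q.X) ?_).trans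
      (Finset.card_image_le.trans (by simpa using hk))
    intro w hw
    obtain ⟨x, hx, rfl⟩ := Finset.mem_image.mp hw
    exact Finset.mem_image_of_mem _ (Finset.mem_range.mpr (h.lt x (Finset.mem_range.mp hx)))
  · refine Finset.sum_fiberwise_le_sum_of_sum_fiber_nonneg fun w hw => ?_
    exact Finset.sum_nonneg fun b hb => hr' b (Finset.mem_filter.mp hb).1
  · rw [← h.load_eq w hw]; exact h.load_le w hw

/-- The store contains a solution if one has been found. -/
def Best (P : Par) (σ : Store) : Prop :=
  σ.v 24 = 0 ∨ σ.v 24 = 1 ∧ P.Sol (σ.A 8) (σ.rv 2)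

/-- A solution of cost at most `c` has been found. -/
def Found (c : ℝ) (σ : Store) : Prop := σ.v 24 = 1 ∧ σ.rv 2 ≤ c

/-- The guess `g` has been tried. -/
def Tried (P : Par) (unit : ℝ) (g : ℕ) (σ : Store) : Prop :=
  ∃ X r, P.Placed unit (P.sel g) (P.len g) X r (P.kk g) ∧
    (Balls.Feas ⟨P, X, r, P.kk g⟩ → Found (∑ b ∈ Finset.range (P.kk g), r b) σ)

/-- The solution in `τ` is at least as good as the one in `σ`. -/
def Improves (σ τ : Store) : Prop := ∀ c, Found c σ → Found c τ

theorem Tried.improves {P : Par} {unit : ℝ} {g : ℕ} {σ τ : Store} (h : Tried P unit g σ)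
    (hi : Improves σ τ) : Tried P unit g τ := by
  obtain ⟨X, r, h1, h2⟩ := h
  exact ⟨X, r, h1, fun hf => hi _ (h2 hf)⟩

namespace Prog

theorem save_spec {P : Par} {σ : Store} (h : Fits P σ) :
    (save.eval σ).v 24 = 1 ∧ (save.eval σ).rv 2 = σ.rv 1 ∧
      ∀ x < P.n, (save.eval σ).A 8 x = σ.A 2 (σ.A 7 x) := by
  obtain ⟨τ, ha, hI, he⟩ := loop_rule (x := 9) (y := 0)
    (c := put 8 (.v 9) (.arr 2 (.arr 7 (.v 9)))) (σ := σ)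
    (fun i τ => ∀ x < i, τ.A 8 x = σ.A 2 (σ.A 7 x)) (by simp) (by
      intro i hi τ ha hI x hx
      have e2 : τ.A 2 = σ.A 2 := ha.A 2 (by decide)
      have e7 : τ.A 7 = σ.A 7 := ha.A 7 (by decide)
      simp only [eval, E.ev, wix, Store.setA_A, Store.setV_v, Store.setV_A, e2, e7]
      by_cases hxi : x = i
      · simp [hxi]
      · simpa [hxi] using hI x (by omega))
  have e1 : τ.rv 1 = σ.rv 1 := ha.r 1 (by decide)
  rw [h.h0] at hI
  simp only [save, eval_seq, he]
  simp [eval, RE.ev, E.ev, e1]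
  exact hI

theorem record_spec {P : Par} {σ : Store} (h : Fits P σ) (hB : Best P σ)
    (hs : σ.v 18 = 1 → P.Sol (fun x => σ.A 2 (σ.A 7 x)) (σ.rv 1)) (h18 : σ.v 18 = 0 ∨ σ.v 18 = 1) :
    Best P (record.eval σ) ∧ Improves σ (record.eval σ) ∧
      (σ.v 18 = 1 → Found (σ.rv 1) (record.eval σ)) := by
  obtain ⟨s1, s2, s3⟩ := save_spec h
  have hbest : σ.v 18 = 1 → Best P (save.eval σ) := fun h1 =>
    Or.inr ⟨s1, by rw [s2]; exact (hs h1).congr s3⟩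
  rcases h18 with h0 | h1
  · have : record.eval σ = σ := by simp [record, eval, E.ev, h0]
    rw [this]
    exact ⟨hB, fun c hc => hc, by omega⟩
  · rcases hB with hB | hB
    · have : record.eval σ = save.eval σ := by simp [record, eval, E.ev, h1, hB]
      rw [this]
      refine ⟨hbest h1, fun c hc => ?_, fun _ => ⟨s1, s2.le⟩⟩
      have := hc.1
      omega
    · by_cases hlt : σ.rv 1 < σ.rv 2
      · have : record.eval σ = save.eval σ := by simp [record, eval, E.ev, RE.ev, h1, hB, hlt]
        rw [this]
        refine ⟨hbest h1, fun c hc => ⟨s1, ?_⟩, fun _ => ⟨s1, s2.le⟩⟩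
        rw [s2]
        exact hlt.le.trans hc.2
      · have : record.eval σ = σ := by simp [record, eval, E.ev, RE.ev, h1, hB, hlt]
        rw [this]
        exact ⟨Or.inr hB, fun c hc => hc, fun _ => ⟨hB.1, not_lt.mp hlt⟩⟩

theorem Best_agree {P : Par} {σ τ : Store} {c : Cmd} (h : Best P σ) (ha : Agree c σ τ)
    (hc : (!c.modV 24 && !c.modR 2 && !c.modA 8) = true := by decide) : Best P τ := by
  simp only [Bool.and_eq_true, Bool.not_eq_true'] at hc
  rw [Best, ha.v _ hc.1.1, ha.r _ hc.1.2, ha.A _ hc.2]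
  exact h

theorem improves_of_agree {σ τ : Store} {c : Cmd} (ha : Agree c σ τ)
    (hc : (!c.modV 24 && !c.modR 2) = true := by decide) : Improves σ τ := by
  simp only [Bool.and_eq_true, Bool.not_eq_true'] at hc
  intro c h
  rw [Found, ha.v _ hc.1, ha.r _ hc.2]
  exact h

theorem attempt_spec {P : Par} {σ : Store} (h : Fits P σ) (hn : 0 < P.n)
    (hR : ∀ i < P.m, P.R i < P.n) (hu : 0 ≤ σ.rv 0) (hB : Best P σ) :
    Best P (attempt.eval σ) ∧ Improves σ (attempt.eval σ) ∧
      Tried P (σ.rv 0) (σ.v 12) (attempt.eval σ) := by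
  simp only [attempt, eval_seq]
  obtain ⟨i1, i2, i3, i4, i5⟩ := attemptInit_spec h
  have h₁ : Fits P (attemptInit.eval σ) := h.eval _
  have a₁ := eval_agree attemptInit σ
  set σ₁ := attemptInit.eval σ
  have e₁0 : σ₁.rv 0 = σ.rv 0 := a₁.r 0 (by decide)
  have hp := place_spec h₁ hn hR i3 i4 i2 (fun x hx => (i5 x hx).1)
  have h₂ : Fits P (place.eval σ₁) := h₁.eval _
  have a₂ := eval_agree place σ₁
  set σ₂ := place.eval σ₁
  rw [e₁0] at hp
  have e₂18 : σ₂.v 18 = 1 := by rw [a₂.v 18 (by decide), i1]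
  have e₂4 : ∀ x < P.n, σ₂.A 4 x = 0 := fun x hx => by rw [a₂.A 4 (by decide), (i5 x hx).2]
  have hkk : P.kk (σ.v 12) ≤ P.k := Nat.sub_le _ _
  have hQ : Holds ⟨P, σ₂.A 2, σ₂.B 2, P.kk (σ.v 12)⟩ σ₂ :=
    ⟨h₂, rfl, rfl, by rw [a₂.v 14 (by decide), i3], hp.placed.lt, hkk⟩
  set Q : Balls := ⟨P, σ₂.A 2, σ₂.B 2, P.kk (σ.v 12)⟩ with hQdef
  obtain ⟨τ, ha, hI, he⟩ := loop_rule (x := 19) (y := 0) (c := augment) (σ := σ₂)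
    (fun p τ => (τ.v 18 = 1 ∧ Q.Assigned p (τ.A 7) (τ.A 4)) ∨ (τ.v 18 = 0 ∧ ¬ Q.Feas))
    (Or.inl ⟨e₂18, by simp, by simp, fun w hw => by simp [e₂4 w hw],
      fun w hw => by simp [e₂4 w hw]⟩) (by
      intro p hp' τ ha hI
      rw [h₂.h0] at hp'
      have hf := (hQ.agree ha).setV 19 p (by omega) (by omega)
      rcases hI with ⟨hI, hA⟩ | ⟨hI, hA⟩
      · have := augment_spec hf (by simpa using hp') (by simpa using hA)
        simpa [hI] using this
      · right
        have := augment_v18 (τ.setV 19 p)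
        simp [hI] at this
        exact ⟨this, hA⟩)
  have hQ' : Holds Q (τ.setV 19 (σ₂.v 0)) := (hQ.agree ha).setV 19 _ (by omega) (by omega)
  rw [he]
  have hτ1 : τ.rv 1 = ∑ b ∈ Finset.range (P.kk (σ.v 12)), σ₂.B 2 b := by
    rw [ha.r 1 (by decide), hp.cost]
  have hBτ : Best P (τ.setV 19 (σ₂.v 0)) := by
    have := Best_agree (Best_agree (Best_agree hB a₁) a₂) ha
    simpa [Best] using this
  have hIτ : Improves σ (τ.setV 19 (σ₂.v 0)) := by
    intro c hc
    have := improves_of_agree ha (by decide) c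
      (improves_of_agree a₂ (by decide) c (improves_of_agree a₁ (by decide) c hc))
    simpa [Found] using this
  rw [h₂.h0] at hI
  obtain ⟨r1, r2, r3⟩ := record_spec hQ'.fits hBτ (by
    intro h18
    rcases hI with ⟨_, hA⟩ | ⟨h0, _⟩
    · have := hA.sol hp.placed.lt hkk (fun b hb => by
        show 0 ≤ σ₂.B 2 b
        rw [hp.placed.rad b hb]
        positivity)
      simp only [Store.setV_A, Store.setV_rv, hτ1, hQ'.X]
      exact this
    · simp [h0] at h18) (by
    rcases hI with ⟨h1, _⟩ | ⟨h0, _⟩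
    · right; simpa using h1
    · left; simpa using h0)
  refine ⟨r1, fun c hc => r2 c (hIτ c hc), σ₂.A 2, σ₂.B 2, hp.placed, fun hf => ?_⟩
  rw [← hτ1]
  refine r3 ?_
  rcases hI with ⟨h1, _⟩ | ⟨_, h0⟩
  · simpa using h1
  · exact absurd hf h0

end Prog

/-- The distance of `x` to the first `s + 1` points of the farthest-first traversal. -/
def Par.md (P : Par) : ℕ → ℕ → ℝ
  | 0, x => P.dd 0 x
  | s + 1, x => min (P.md s x) (P.dd (amax (P.md s) P.n) x)

/-- The largest distance of a point to the first `s + 1` points of the traversal. -/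
def Par.scale (P : Par) (s : ℕ) : ℝ := P.md s (amax (P.md s) P.n)

namespace Prog

theorem round_spec {P : Par} {σ : Store} (h : Fits P σ) (hn : 0 < P.n)
    (hR : ∀ i < P.m, P.R i < P.n) {s : ℕ} (hs : 0 ≤ P.scale s)
    (hmd : ∀ x < P.n, σ.B 1 x = P.md s x) (hB : Best P σ) :
    Best P (round.eval σ) ∧ Improves σ (round.eval σ) ∧
      (∀ g < P.G, Tried P (P.scale s / P.u) g (round.eval σ)) ∧
      ∀ x < P.n, (round.eval σ).B 1 x = P.md (s + 1) x := by
  simp only [round, eval_seq]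
  have f := farthest_spec h
  rw [amax_congr hn hmd] at f
  have h₁ : Fits P (farthest.eval σ) := h.eval _
  have a₁ := eval_agree farthest σ
  set σ₁ := farthest.eval σ
  have e1 : σ₁.B 1 = σ.B 1 := a₁.B 1 (by decide)
  have hu : (rset 0 (.op .div (.arr 1 (.v 11)) (.cast (.v 8)))).eval σ₁ =
      σ₁.setR 0 (P.scale s / P.u) := by
    simp [eval, RE.ev, E.ev, RealOp.eval, rix, h₁.h8, f, e1, hmd _ (amax_lt _ hn), Par.scale]
  rw [hu]
  have h₂ : Fits P (σ₁.setR 0 (P.scale s / P.u)) :=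
    ⟨h₁.h0, h₁.h1, h₁.h2, h₁.h3, h₁.h4, h₁.h5, h₁.h6, h₁.h7, h₁.h8, h₁.R, h₁.dd⟩
  have hB₂ : Best P (σ₁.setR 0 (P.scale s / P.u)) := by
    have := Best_agree hB a₁
    simpa [Best] using this
  have hI₂ : Improves σ (σ₁.setR 0 (P.scale s / P.u)) := by
    intro c hc
    have := improves_of_agree a₁ (by decide) c hc
    simpa [Found] using this
  set σ₂ := σ₁.setR 0 (P.scale s / P.u) with hσ₂
  obtain ⟨τ, ha, hI, he⟩ := loop_rule (x := 12) (y := 6) (c := attempt) (σ := σ₂)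
    (fun i τ => Best P τ ∧ Improves σ₂ τ ∧ ∀ g < i, Tried P (P.scale s / P.u) g τ)
    ⟨hB₂, fun c hc => hc, by simp⟩ (by
      intro i hi τ ha hI
      have hf := (h₂.agree ha).setV 12 i (by omega)
      have e0 : (τ.setV 12 i).rv 0 = P.scale s / P.u := by
        have := ha.r 0 (by decide)
        simpa [hσ₂] using this
      obtain ⟨t1, t2, t3⟩ := attempt_spec hf hn hR (by rw [e0]; positivity)
        (by simpa [Best] using hI.1)
      have t2' : Improves τ (attempt.eval (τ.setV 12 i)) := fun c hc =>
        t2 c (by simpa [Found] using hc)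
      refine ⟨t1, fun c hc => t2' c (hI.2.1 c hc), fun g hg => ?_⟩
      rcases (show g < i ∨ g = i by omega) with hg | rfl
      · exact (hI.2.2 g hg).improves t2'
      · rw [e0] at t3
        simpa using t3)
  rw [he]
  rw [h₂.h6] at hI ⊢
  have h₃ : Fits P (τ.setV 12 P.G) := (h₂.agree ha).setV 12 _ (by omega)
  have a₄ := eval_agree distUpdate (τ.setV 12 P.G)
  have e11 : (τ.setV 12 P.G).v 11 = amax (P.md s) P.n := by
    have := ha.v 11 (by decide)
    simpa [hσ₂, f] using this
  have eB : (τ.setV 12 P.G).B 1 = σ.B 1 := by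
    have := ha.B 1 (by decide)
    simpa [hσ₂, e1] using this
  have hI₄ : Improves τ (distUpdate.eval (τ.setV 12 P.G)) := fun c hc =>
    improves_of_agree a₄ (by decide) c (by simpa [Found] using hc)
  refine ⟨Best_agree (by simpa [Best] using hI.1) a₄, fun c hc => hI₄ c (hI.2.1 c (hI₂ c hc)),
    fun g hg => (hI.2.2 g hg).improves hI₄, fun x hx => ?_⟩
  rw [distUpdate_spec h₃ (by rw [e11]; exact amax_lt _ hn) x hx, eB, e11, hmd x hx, Par.md]

theorem bump_spec {P : Par} {σ : Store} (h : Fits P σ) (h25 : σ.v 25 < P.k) :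
    bump.eval σ = σ.setV 25 (σ.v 25 + 1) := by
  simp only [bump, eval, E.ev, WordOp.eval, h.h1]
  congr 1
  omega

/-- The indices of the entries `1`. -/
def ones (f : ℕ → ℕ) (n : ℕ) : Finset ℕ := (Finset.range n).filter (fun q => f q = 1)

theorem mem_ones {f : ℕ → ℕ} {n q : ℕ} : q ∈ ones f n ↔ q < n ∧ f q = 1 := by simp [ones]

/-- The output of the program for the assignment `O`. -/
structure Output (P : Par) (O : ℕ → ℕ) (τ : Store) : Prop where
  card : (ones (τ.A 0) P.n).card = P.k
  assign : ∀ x < P.n, τ.A 0 (P.n + x) = O x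
  mem : ∀ x < P.n, τ.A 0 (O x) = 1
  nonneg : ∀ q < P.n, 0 ≤ τ.B 0 q
  le : ∀ x < P.n, P.dd (O x) x ≤ τ.B 0 (O x)
  attained : ∀ q < P.n, τ.B 0 q = 0 ∨ ∃ x < P.n, O x = q ∧ τ.B 0 q = P.dd q x

/-- The assignment of the first `i` points has been output. -/
structure OutInv (P : Par) (O : ℕ → ℕ) (i : ℕ) (τ : Store) : Prop where
  assign : ∀ x < i, τ.A 0 (P.n + x) = O x
  flag : ∀ q < P.n, τ.A 0 q = if q ∈ (Finset.range i).image O then 1 else 0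
  card : τ.v 25 = ((Finset.range i).image O).card
  nonneg : ∀ q < P.n, 0 ≤ τ.B 3 q
  le : ∀ x < i, P.dd (O x) x ≤ τ.B 3 (O x)
  attained : ∀ q < P.n, τ.B 3 q = 0 ∨ ∃ x < i, O x = q ∧ τ.B 3 q = P.dd q x

def outClear : Cmd := loop 9 0 (seq (put 0 (.v 9) (.c 0)) (rput 3 (.v 9) (.cast (.c 0))))

def outBody : Cmd :=
  (seq (set 17 (.arr 8 (.v 9))) <| seq (put 0 ((E.v 0).add (.v 9)) (.v 17)) <|
    seq (ifLt (.arr 0 (.v 17)) (.c 1) (seq (put 0 (.v 17) (.c 1)) bump) skip) <|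
    ifRlt (.arr 3 (.v 17)) (dst (.v 17) (.v 9)) (rput 3 (.v 17) (dst (.v 17) (.v 9))) skip)

def outPad : Cmd :=
  loop 9 0 (ifLt (.v 25) (.v 1)
    (ifLt (.arr 0 (.v 9)) (.c 1) (seq (put 0 (.v 9) (.c 1)) bump) skip) skip)

def outRadii : Cmd := loop 9 0 (rput 0 (.v 9) (.arr 3 (.v 9)))

theorem outClear_spec {P : Par} {σ : Store} (h : Fits P σ) :
    ∀ q < P.n, (outClear.eval σ).A 0 q = 0 ∧ (outClear.eval σ).B 3 q = 0 := by
  obtain ⟨τ, ha, hI, he⟩ := loop_rule (x := 9) (y := 0)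
    (c := seq (put 0 (.v 9) (.c 0)) (rput 3 (.v 9) (.cast (.c 0)))) (σ := σ)
    (fun i τ => ∀ q < i, τ.A 0 q = 0 ∧ τ.B 3 q = 0) (by simp) (by
      intro i hi τ ha hI x hx
      have hf := (h.agree ha).setV 9 i (by omega)
      rw [h.h0] at hi
      have h0 : τ.v 0 = P.n := by simpa using hf.h0
      simp only [eval, E.ev, RE.ev, wix, rix, Store.setA_A, Store.setV_v, Store.setA_v, Store.setB_B,
        Store.setB_A, Store.setA_B]
      norm_num
      rw [h0, Nat.mod_eq_of_lt (by omega)]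
      by_cases hxi : x = i
      · simp [hxi]
      · simpa [hxi] using hI x (by omega))
  rw [h.h0] at hI
  rw [outClear, he]
  simpa using hI

theorem outBody_spec {P : Par} {σ : Store} (h : Fits P σ) {O : ℕ → ℕ} {i : ℕ} (hi : i < P.n)
    (h9 : σ.v 9 = i) (hO : ∀ x < P.n, O x < P.n) (h8 : ∀ x < P.n, σ.A 8 x = O x)
    (hk : ((Finset.range P.n).image O).card ≤ P.k) (hI : OutInv P O i σ) :
    OutInv P O (i + 1) (outBody.eval σ) := by
  set w := O i with hw
  have hwn : w < P.n := hO i hi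
  set σ₂ := (σ.setV 17 w).setA 0 (P.n + i) w with hσ₂
  have h₂ : Fits P σ₂ := by
    have := h.setV 17 w (by omega)
    exact ⟨this.h0, this.h1, this.h2, this.h3, this.h4, this.h5, this.h6, this.h7, this.h8,
      by simpa [hσ₂] using this.R, this.dd⟩
  have e17 : σ₂.v 17 = w := by simp [hσ₂]
  have e9 : σ₂.v 9 = i := by simp [hσ₂, h9]
  have e0 : σ₂.v 0 = P.n := h₂.h0
  have hA₂ : ∀ q < P.n, σ₂.A 0 q = if q ∈ (Finset.range i).image O then 1 else 0 := by
    intro q hq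
    have : q ≠ P.n + i := by omega
    rw [← hI.flag q hq]
    simp [hσ₂, this]
  set fl := ifLt (.arr 0 (.v 17)) (.c 1) (seq (put 0 (.v 17) (.c 1)) bump) skip with hfl
  have hfl' : (w ∈ (Finset.range i).image O → fl.eval σ₂ = σ₂) ∧
      (w ∉ (Finset.range i).image O → fl.eval σ₂ = (σ₂.setA 0 w 1).setV 25 (σ₂.v 25 + 1)) := by
    have ea : E.ev σ₂ (.arr 0 (.v 17)) = if w ∈ (Finset.range i).image O then 1 else 0 := by
      rw [← hA₂ w hwn]
      simp only [E.ev, wix, if_true, e17, e0]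
      rw [Nat.mod_eq_of_lt (by omega)]
    refine ⟨fun hm => ?_, fun hm => ?_⟩
    · rw [hfl, Cmd.eval, ea, if_pos hm, if_neg (by simp [E.ev]), Cmd.eval]
    · have hp : (put 0 (.v 17) (.c 1)).eval σ₂ = σ₂.setA 0 w 1 := by
        simp only [eval, E.ev, wix, if_true, e17, e0]
        rw [Nat.mod_eq_of_lt (by omega)]
      rw [hfl, Cmd.eval, ea, if_neg hm, if_pos (by simp [E.ev]), eval_seq, hp]
      have h₃ : Fits P (σ₂.setA 0 w 1) := ⟨h₂.h0, h₂.h1, h₂.h2, h₂.h3, h₂.h4, h₂.h5, h₂.h6, h₂.h7,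
        h₂.h8, by simpa using h₂.R, h₂.dd⟩
      rw [bump_spec h₃]
      · simp
      · have e25 : σ₂.v 25 = ((Finset.range i).image O).card := by simpa [hσ₂] using hI.card
        have : insert w ((Finset.range i).image O) ⊆ (Finset.range P.n).image O := by
          intro q hq
          rcases Finset.mem_insert.mp hq with rfl | hq
          · exact Finset.mem_image_of_mem _ (by simpa using hi)
          · exact Finset.image_subset_image (by simpa using hi.le) hq
        have := Finset.card_le_card this
        rw [Finset.card_insert_of_notMem hm] at this
        simp only [Store.setA_v, e25]
        omega
  set σ₃ := fl.eval σ₂ with hσ₃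
  have a₃ : Agree fl σ₂ σ₃ := eval_agree _ _
  have h₃ : Fits P σ₃ := h₂.agree a₃
  have him : (Finset.range (i + 1)).image O = insert w ((Finset.range i).image O) := by
    rw [Finset.range_add_one, Finset.image_insert]
  have b17 : σ₃.v 17 = w := by rw [a₃.v 17 (by decide), e17]
  have b9 : σ₃.v 9 = i := by rw [a₃.v 9 (by decide), e9]
  have hd' := h₃.dst (a := .v 17) (b := .v 9) (by simpa [E.ev, b17] using hwn)
    (by simpa [E.ev, b9] using hi)
  simp only [E.ev, b17, b9] at hd'
  have hB3 : σ₃.B 3 = σ.B 3 := by rw [a₃.B 3 (by decide)]; simp [hσ₂]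
  have key : (outBody.eval σ).A 0 = σ₃.A 0 ∧ (outBody.eval σ).v 25 = σ₃.v 25 ∧
      ∀ q, (outBody.eval σ).B 3 q = if q = w then max (σ.B 3 w) (P.dd w i) else σ.B 3 q := by
    have hs₂ : (put 0 ((E.v 0).add (.v 9)) (.v 17)).eval ((set 17 (.arr 8 (.v 9))).eval σ) = σ₂ := by
      simp [eval, E.ev, WordOp.eval, wix, h9, h8 i hi, h.h0, hσ₂, hw]
      rw [Nat.mod_eq_of_lt (by omega)]
    simp only [outBody, eval_seq]
    rw [hs₂, ← hfl, ← hσ₃]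
    simp only [eval, hd', RE.ev, rix, E.ev, b17, hB3]
    norm_num
    split
    · refine ⟨by simp, by simp, fun q => ?_⟩
      by_cases hq : q = w
      · simp [hq, max_eq_right (le_of_lt ‹_›)]
      · simp [hq, hB3]
    · refine ⟨rfl, rfl, fun q => ?_⟩
      by_cases hq : q = w
      · simp [hq, hB3, max_eq_left (not_lt.mp ‹_›)]
      · simp [hq, hB3]
  obtain ⟨k1, k2, k3⟩ := key
  have hA₃ : ∀ q < P.n, σ₃.A 0 q = if q ∈ (Finset.range (i + 1)).image O then 1 else 0 := by
    intro q hq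
    rw [him]
    by_cases hm : w ∈ (Finset.range i).image O
    · rw [hfl'.1 hm, hA₂ q hq, Finset.insert_eq_of_mem hm]
    · rw [hfl'.2 hm]
      by_cases hqw : q = w
      · simp [hqw]
      · have := hA₂ q hq
        simp only [Store.setV_A, Store.setA_A, hqw, and_false, if_false, this, Finset.mem_insert,
          false_or]
  have hA₃' : ∀ x, σ₃.A 0 (P.n + x) = σ₂.A 0 (P.n + x) := by
    intro x
    by_cases hm : w ∈ (Finset.range i).image O
    · rw [hfl'.1 hm]
    · rw [hfl'.2 hm]
      have : P.n + x ≠ w := by omega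
      simp [this]
  refine ⟨fun x hx => ?_, by rw [k1]; exact hA₃, ?_, fun q hq => ?_, fun x hx => ?_, fun q hq => ?_⟩
  · rw [k1, hA₃']
    by_cases hxi : x = i
    · simp [hσ₂, hxi, hw]
    · simpa [hσ₂, hxi] using hI.assign x (by omega)
  · rw [k2, him]
    by_cases hm : w ∈ (Finset.range i).image O
    · rw [hfl'.1 hm, Finset.insert_eq_of_mem hm, ← hI.card]; simp [hσ₂]
    · rw [hfl'.2 hm, Finset.card_insert_of_notMem hm, ← hI.card]; simp [hσ₂]
  · rw [k3]
    split
    · exact le_max_of_le_left (hI.nonneg w hwn)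
    · exact hI.nonneg q hq
  · rw [k3]
    rcases (show x < i ∨ x = i by omega) with hx | rfl
    · split
      · rename_i hxw
        rw [← hxw]
        exact le_max_of_le_left (hI.le x hx)
      · exact hI.le x hx
    · rw [if_pos rfl]; exact le_max_right _ _
  · rw [k3]
    have old : σ.B 3 q = 0 ∨ ∃ x < i + 1, O x = q ∧ σ.B 3 q = P.dd q x :=
      (hI.attained q hq).imp_right fun ⟨x, hx, h⟩ => ⟨x, by omega, h⟩
    split
    · subst q
      rcases le_total (σ.B 3 w) (P.dd w i) with hle | hle
      · right
        exact ⟨i, by omega, rfl, max_eq_right hle⟩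
      · rw [max_eq_left hle]; exact old
    · exact old

/-- Flags are added only while there are fewer than `k`. Either their number reaches `k`, or all `n
≥ k` points have been flagged. -/
theorem outPad_spec {P : Par} {σ : Store} (h : Fits P σ) (hkn : P.k ≤ P.n)
    (h01 : ∀ q < P.n, σ.A 0 q = 0 ∨ σ.A 0 q = 1)
    (hc : σ.v 25 = (ones (σ.A 0) P.n).card) (hk : σ.v 25 ≤ P.k) :
    (ones ((outPad.eval σ).A 0) P.n).card = P.k ∧
    (∀ q < P.n, σ.A 0 q = 1 → (outPad.eval σ).A 0 q = 1) ∧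
    ∀ x, (outPad.eval σ).A 0 (P.n + x) = σ.A 0 (P.n + x) := by
  obtain ⟨τ, ha, hI, he⟩ := loop_rule (x := 9) (y := 0)
    (c := (ifLt (.v 25) (.v 1)
      (ifLt (.arr 0 (.v 9)) (.c 1) (seq (put 0 (.v 9) (.c 1)) bump) skip) skip)) (σ := σ)
    (fun i τ => (∀ q < P.n, τ.A 0 q = 0 ∨ τ.A 0 q = 1) ∧
      τ.v 25 = (ones (τ.A 0) P.n).card ∧ τ.v 25 ≤ P.k ∧
      (τ.v 25 = P.k ∨ ∀ q < i, τ.A 0 q = 1) ∧ (∀ q < P.n, σ.A 0 q = 1 → τ.A 0 q = 1) ∧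
      ∀ x, τ.A 0 (P.n + x) = σ.A 0 (P.n + x))
    ⟨h01, hc, hk, by simp, fun _ _ h => h, fun _ => rfl⟩ (by
      rintro i hi τ ha ⟨I1, I2, I3, I4, I5, I6⟩
      have hf := (h.agree ha).setV 9 i (by omega)
      rw [h.h0] at hi
      have e0 : τ.v 0 = P.n := by simpa using hf.h0
      have e1 : τ.v 1 = P.k := by simpa using hf.h1
      have ex : E.ev (τ.setV 9 i) (.arr 0 (.v 9)) = τ.A 0 i := by
        simp [E.ev, wix, e0, Nat.mod_eq_of_lt (show i < 2 * P.n by omega)]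
      simp only [eval, ex]
      simp only [E.ev, Store.setV_v]
      norm_num
      rw [e1, e0, wix, if_pos rfl, Nat.mod_eq_of_lt (by omega)]
      by_cases hlt : τ.v 25 < P.k
      · rw [if_pos hlt]
        have I4' : ∀ q < i, τ.A 0 q = 1 := I4.resolve_left (by omega)
        rcases I1 i hi with h0 | h1
        · rw [if_pos h0]
          have hf' : Fits P ((τ.setV 9 i).setA 0 i 1) := ⟨hf.h0, hf.h1, hf.h2, hf.h3, hf.h4, hf.h5,
            hf.h6, hf.h7, hf.h8, by simpa using hf.R, hf.dd⟩
          rw [bump_spec hf' (by simpa using hlt)]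
          simp only [Store.setV_v, Store.setV_A, Store.setA_v, Store.setA_A]
          norm_num
          refine ⟨fun q hq => ?_, ?_, by omega, Or.inr fun q hq => ?_, fun q hq h1 => ?_,
            fun x => ?_⟩
          · by_cases hqi : q = i
            · simp [hqi]
            · simpa [hqi] using I1 q hq
          · rw [I2]
            rw [← Finset.card_insert_of_notMem (a := i) (by simp [mem_ones, h0])]
            congr 1
            ext q
            by_cases hqi : q = i
            · simp [mem_ones, hqi, hi]
            · simp [mem_ones, hqi]
          · intro hqi
            exact I4' q (by omega)
          · intro _
            exact I5 q hq h1
          · rw [if_neg (by omega)]; exact I6 x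
        · rw [if_neg (by omega)]
          refine ⟨I1, by simpa using I2, by simpa using I3, Or.inr fun q hq => ?_, I5, I6⟩
          rcases (show q < i ∨ q = i by omega) with hq | rfl
          · exact I4' q hq
          · exact h1
      · rw [if_neg hlt]
        exact ⟨I1, by simpa using I2, by simpa using I3, Or.inl (by simp; omega), I5, I6⟩)
  rw [h.h0] at hI
  obtain ⟨I1, I2, I3, I4, I5, I6⟩ := hI
  rw [outPad, he]
  simp only [Store.setV_A]
  refine ⟨?_, I5, I6⟩
  rw [← I2]
  rcases I4 with h4 | h4
  · exact h4
  · refine le_antisymm I3 ?_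
    rw [I2, ones, Finset.filter_true_of_mem (fun q hq => h4 q (Finset.mem_range.mp hq)),
      Finset.card_range]
    exact hkn

theorem outRadii_spec {P : Par} {σ : Store} (h0 : σ.v 0 = P.n) :
    ∀ q < P.n, (outRadii.eval σ).B 0 q = σ.B 3 q := by
  obtain ⟨τ, ha, hI, he⟩ := loop_rule (x := 9) (y := 0)
    (c := (rput 0 (.v 9) (.arr 3 (.v 9)))) (σ := σ)
    (fun i τ => ∀ q < i, τ.B 0 q = σ.B 3 q) (by simp) (by
      intro i hi τ ha hI q hq
      rw [h0] at hi
      have e0 : τ.v 0 = P.n := by rw [ha.v 0 (by decide), h0]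
      have e3 : τ.B 3 = σ.B 3 := ha.B 3 (by decide)
      have hlt : i < P.n * P.n := by nlinarith
      simp only [eval, E.ev, RE.ev, rix, Store.setB_B, Store.setV_v, Store.setV_B, e3]
      norm_num
      rw [e0, Nat.mod_eq_of_lt hlt]
      by_cases hqi : q = i
      · simp [hqi]
      · simpa [hqi] using hI q (by omega))
  rw [h0] at hI
  rw [outRadii, he]
  simpa using hI

theorem output_spec {P : Par} {σ : Store} (h : Fits P σ) {O : ℕ → ℕ} {c : ℝ} (hkn : P.k ≤ P.n)
    (h8 : ∀ x < P.n, σ.A 8 x = O x) (hs : P.Sol O c) :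
    Output P O (output.eval σ) := by
  obtain ⟨r, s1, s2, s3, s4, s5⟩ := hs
  have hO : ∀ x < P.n, O x < P.n := fun x hx => (s2 x hx).1
  have : output = seq outClear (seq (set 25 (.c 0)) (seq (loop 9 0 outBody)
    (seq outPad outRadii))) := rfl
  rw [this]
  simp only [eval_seq]
  have c₁ := outClear_spec h
  have h₁ : Fits P (outClear.eval σ) := h.eval _
  have a₁ := eval_agree outClear σ
  set σ₁ := outClear.eval σ
  have h₂ : Fits P ((set 25 (.c 0)).eval σ₁) := h₁.eval _
  have hσ₂ : (set 25 (.c 0)).eval σ₁ = σ₁.setV 25 0 := rfl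
  set σ₂ := (set 25 (.c 0)).eval σ₁
  obtain ⟨τ, ha, hI, he⟩ := loop_rule (x := 9) (y := 0) (c := outBody) (σ := σ₂)
    (fun i τ => OutInv P O i τ) (by
      refine ⟨by simp, fun q hq => ?_, by simp [hσ₂], fun q hq => ?_, by simp, fun q hq => ?_⟩
      · simpa [hσ₂] using (c₁ q hq).1
      · simpa [hσ₂] using (c₁ q hq).2.ge
      · left; simpa [hσ₂] using (c₁ q hq).2) (by
      intro i hi τ ha hI
      rw [h₂.h0] at hi
      refine outBody_spec ((h₂.agree ha).setV 9 i (by omega)) hi (by simp) hO (fun x hx => ?_) s3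
        ⟨hI.assign, hI.flag, by simpa using hI.card, hI.nonneg, hI.le, hI.attained⟩
      rw [Store.setV_A, ha.A 8 (by decide), hσ₂, Store.setV_A, a₁.A 8 (by decide), h8 x hx])
  rw [he, h₂.h0]
  rw [h₂.h0] at hI
  have h₃ : Fits P (τ.setV 9 P.n) := (h₂.agree ha).setV 9 _ (by omega)
  have hfl : ∀ q < P.n, τ.A 0 q = 1 ↔ q ∈ (Finset.range P.n).image O := by
    intro q hq
    rw [hI.flag q hq]; split <;> simp [*]
  have hf : ones ((τ.setV 9 P.n).A 0) P.n = (Finset.range P.n).image O := by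
    ext q
    simp only [mem_ones, Store.setV_A]
    constructor
    · rintro ⟨h1, h2⟩; exact (hfl q h1).mp h2
    · intro h1
      have hq : q < P.n := by
        obtain ⟨x, hx, rfl⟩ := Finset.mem_image.mp h1
        exact hO x (Finset.mem_range.mp hx)
      exact ⟨hq, (hfl q hq).mpr h1⟩
  obtain ⟨p1, p2, p3⟩ := outPad_spec h₃ hkn (fun q hq => by
      rw [Store.setV_A, hI.flag q hq]; split <;> simp)
    (by rw [hf]; simpa using hI.card) (by simpa [hI.card] using s3)
  have a₄ := eval_agree outPad (τ.setV 9 P.n)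
  set σ₄ := outPad.eval (τ.setV 9 P.n)
  have h₄ : Fits P σ₄ := h₃.agree a₄
  have a₅ := eval_agree outRadii σ₄
  have r₅ := outRadii_spec h₄.h0
  set σ₅ := outRadii.eval σ₄
  have eA : σ₅.A 0 = σ₄.A 0 := a₅.A 0 (by decide)
  have e3 : σ₄.B 3 = τ.B 3 := a₄.B 3 (by decide)
  rw [e3] at r₅
  refine ⟨by rw [eA]; exact p1, fun x hx => ?_, fun x hx => ?_, fun q hq => ?_, fun x hx => ?_,
    fun q hq => ?_⟩
  · rw [eA, p3]; exact hI.assign x hx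
  · rw [eA]
    refine p2 _ (hO x hx) ((hfl _ (hO x hx)).mpr ?_)
    exact Finset.mem_image_of_mem _ (Finset.mem_range.mpr hx)
  · rw [r₅ q hq]; exact hI.nonneg q hq
  · rw [r₅ _ (hO x hx)]; exact hI.le x hx
  · rw [r₅ q hq]; exact hI.attained q hq

/-- If some guess is good, then the program outputs a solution that is as good. -/
theorem main_spec {P : Par} {σ : Store} (h : Fits P σ) (hn : 0 < P.n) (hkn : P.k ≤ P.n)
    (hR : ∀ i < P.m, P.R i < P.n) (hd : ∀ x < P.n, ∀ y < P.n, 0 ≤ P.dd x y) (h24 : σ.v 24 = 0)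
    {s g : ℕ} (hs : s < P.n) (hg : g < P.G) {c : ℝ}
    (hgood : ∀ X r, P.Placed (P.scale s / P.u) (P.sel g) (P.len g) X r (P.kk g) →
      Balls.Feas ⟨P, X, r, P.kk g⟩ ∧ ∑ b ∈ Finset.range (P.kk g), r b ≤ c) :
    ∃ O, P.Sol O c ∧ Output P O (main.eval σ) := by
  simp only [main, eval_seq]
  have d₁ := distInit_spec h hn
  have h₁ : Fits P (distInit.eval σ) := h.eval _
  have a₁ := eval_agree distInit σ
  set σ₁ := distInit.eval σ
  have hscale : ∀ s, 0 ≤ P.scale s := by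
    intro s
    have : ∀ x < P.n, 0 ≤ P.md s x := by
      induction s with
      | zero => exact fun x hx => hd 0 hn x hx
      | succ s ih => exact fun x hx => le_min (ih x hx) (hd _ (amax_lt _ hn) x hx)
    exact this _ (amax_lt _ hn)
  obtain ⟨τ, ha, ⟨I1, I2, I3⟩, he⟩ := loop_rule (x := 10) (y := 0) (c := round) (σ := σ₁)
    (fun i τ => Best P τ ∧ (∀ x < P.n, τ.B 1 x = P.md i x) ∧
      ∀ s < i, ∀ g < P.G, Tried P (P.scale s / P.u) g τ)
    ⟨Or.inl (by rw [a₁.v 24 (by decide), h24]), d₁, by simp⟩ (by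
      rintro i hi τ ha ⟨I1, I2, I3⟩
      have hf := (h₁.agree ha).setV 10 i (by omega)
      obtain ⟨r1, r2, r3, r4⟩ := round_spec hf hn hR (hscale i) I2 (by simpa [Best] using I1)
      have r2' : Improves τ (round.eval (τ.setV 10 i)) := fun c hc =>
        r2 c (by simpa [Found] using hc)
      refine ⟨r1, r4, fun s hs g hg => ?_⟩
      rcases (show s < i ∨ s = i by omega) with hs | rfl
      · exact (I3 s hs g hg).improves r2'
      · exact r3 g hg)
  rw [h₁.h0] at I3
  obtain ⟨X, r, p1, p2⟩ := I3 s hs g hg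
  obtain ⟨q1, q2⟩ := hgood X r p1
  obtain ⟨f1, f2⟩ := p2 q1
  rw [he]
  have h₂ : Fits P (τ.setV 10 (σ₁.v 0)) := (h₁.agree ha).setV 10 _ (by omega)
  rcases I1 with I1 | ⟨_, I1⟩
  · omega
  · obtain ⟨r', s1, s2, s3, s4, s5⟩ := I1
    exact ⟨τ.A 8, ⟨r', s1, s2, s3, s4.trans (f2.trans q2), s5⟩,
      output_spec h₂ hkn (fun x hx => rfl) ⟨r', s1, s2, s3, s4, s5⟩⟩

end Prog

end Structured

namespace Structured

/-! ### The existence of a good guess -/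

namespace Par

/-- A solution whose radii are multiples of `unit`, such that the sample contains sufficiently many
points of the large clusters. -/
structure Clusters (P : Par) (unit : ℝ) (cl : ℕ → ℕ) (C : Finset ℕ) (L : ℕ → ℕ) : Prop where
  symm : ∀ x y, P.dd x y = P.dd y x
  tri : ∀ x y z, P.dd x z ≤ P.dd x y + P.dd y z
  unit_nonneg : 0 ≤ unit
  k_pos : 0 < P.k
  mem : ∀ x < P.n, cl x ∈ C
  lt : ∀ q ∈ C, q < P.n
  nonempty : ∀ q ∈ C, ∃ x < P.n, cl x = q
  card_le : C.card ≤ P.k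
  rad : ∀ x < P.n, P.dd (cl x) x ≤ L (cl x) * unit
  load : ∀ q ∈ C, ((Finset.range P.n).filter (fun x => cl x = q)).card ≤ P.U
  sample_lt : ∀ i < P.m, P.R i < P.n
  sample : ∀ q ∈ C, P.U < P.k * ((Finset.range P.n).filter (fun x => cl x = q)).card →
    (∃ i < P.m, cl (P.R i) = q) ∧
    (2 ≤ ((Finset.range P.n).filter (fun x => cl x = q)).card →
      ∃ i < P.m, ∃ i' < P.m, cl (P.R i) = q ∧ cl (P.R i') = q ∧ P.R i ≠ P.R i')
  sum_lt : 4 * ∑ q ∈ C, L q < P.T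

/-- The cluster has at most `U / k` points. -/
def Light (P : Par) (cl : ℕ → ℕ) (q : ℕ) : Prop :=
  P.k * ((Finset.range P.n).filter (fun x => cl x = q)).card ≤ P.U

/-- The first `j` balls serve the clusters in `V`; each cluster in `M` waits for a further ball. -/
structure Plan (P : Par) (unit : ℝ) (cl L : ℕ → ℕ) (j : ℕ) (f t X serv : ℕ → ℕ)
    (V M : Finset ℕ) : Prop where
  placed : P.Placed unit f t X (fun b => t b * unit) j
  fresh : ∀ b < j, ¬ f b < P.m → P.Uncov X (fun b => t b * unit) b (X b)
  le : ∀ b < j, f b ≤ P.m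
  inj : ∀ b < j, ∀ b' < j, X b = X b' → b = b'
  own : ∀ b < j, cl (X b) ∈ V ∪ M
  pair : ∀ q ∈ M, ∃ i < P.m, cl (P.R i) = q ∧ ∀ b < j, X b ≠ P.R i
  serve : ∀ x < P.n, cl x ∈ V → serv (cl x) < j ∧ P.dd (X (serv (cl x))) x ≤ t (serv (cl x)) * unit
  load : ∀ b < j, ((Finset.range P.n).filter (fun x => cl x ∈ V ∧ serv (cl x) = b)).card ≤ P.U
  disj : Disjoint V M
  count : j ≤ V.card
  cost : ∑ b ∈ Finset.range j, t b ≤ 4 * ∑ q ∈ V, L q + 2 * ∑ q ∈ M, L q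

/-- A further ball around `a` serves the clusters in `N`, and `M'` is the set of those that wait
afterwards. This covers a heavy cluster that is served at once or has to wait, a light cluster with
its family, and the second ball of a waiting cluster. Since `N` is nonempty, there are never more
balls than served clusters. -/
theorem Plan.push {P : Par} {unit : ℝ} {cl L : ℕ → ℕ} {j : ℕ} {f t X serv : ℕ → ℕ}
    {V M : Finset ℕ} (h : P.Plan unit cl L j f t X serv V M) {f₀ t₀ a : ℕ} {N M' : Finset ℕ}
    (ha : a < P.n) (hs : f₀ < P.m → a = P.R f₀) (hfm : f₀ ≤ P.m)
    (hu : ¬ f₀ < P.m → P.Uncov X (fun b => t b * unit) j a ∧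
      ∀ x < P.n, P.Uncov X (fun b => t b * unit) j x → x ≤ a)
    (hN : Disjoint V N) (hN0 : N.Nonempty) (hM : Disjoint (V ∪ N) M')
    (hV : V ∪ M ⊆ V ∪ N ∪ M') (hcl : cl a ∈ V ∪ N ∪ M') (hX : ∀ b < j, X b ≠ a)
    (hp : ∀ q ∈ M', ∃ i < P.m, cl (P.R i) = q ∧ a ≠ P.R i ∧ ∀ b < j, X b ≠ P.R i)
    (hserve : ∀ x < P.n, cl x ∈ N → P.dd a x ≤ t₀ * unit)
    (hload : ((Finset.range P.n).filter (fun x => cl x ∈ N)).card ≤ P.U)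
    (hcost : t₀ + 2 * ∑ q ∈ M, L q ≤ 4 * ∑ q ∈ N, L q + 2 * ∑ q ∈ M', L q) :
    P.Plan unit cl L (j + 1) (Function.update f j f₀) (Function.update t j t₀)
      (Function.update X j a) (fun q => if q ∈ N then j else serv q) (V ∪ N) M' := by
  have hf : ∀ b < j, Function.update f j f₀ b = f b := fun b hb => Function.update_of_ne hb.ne _ _
  have ht : ∀ b < j, Function.update t j t₀ b = t b := fun b hb => Function.update_of_ne hb.ne _ _
  have hX' : ∀ b < j, Function.update X j a b = X b := fun b hb => Function.update_of_ne hb.ne _ _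
  have hunc : ∀ b ≤ j, ∀ x, P.Uncov (Function.update X j a)
      (fun b => (Function.update t j t₀ b : ℕ) * unit) b x ↔
      P.Uncov X (fun b => t b * unit) b x := by
    intro b hb x
    refine forall₂_congr fun b' hb' => ?_
    beta_reduce
    rw [hX' b' (by omega), ht b' (by omega)]
  have split : ∀ b, b < j + 1 → b < j ∨ b = j := fun b hb => by omega
  refine ⟨?_, fun b hb hb' => ?_, fun b hb => ?_, fun b hb b' hb' hbb => ?_, fun b hb => ?_,
    fun q hq => ?_, fun x hx hc => ?_, fun b hb => ?_, hM, ?_, ?_⟩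
  · refine ⟨fun b hb => ?_, fun b hb => rfl, fun b hb hb' => ?_, fun b hb hb' x hx => ?_⟩
    · rcases split b hb with hb | rfl
      · rw [hX' b hb]; exact h.placed.lt b hb
      · simpa using ha
    · rcases split b hb with hb | rfl
      · rw [hX' b hb, hf b hb]; rw [hf b hb] at hb'; exact h.placed.sample b hb hb'
      · simpa using hs (by simpa using hb')
    · rw [hunc b (by omega), hunc b (by omega)]
      rcases split b hb with hb | rfl
      · rw [hX' b hb]; rw [hf b hb] at hb'; exact h.placed.uncov b hb hb' x hx
      · have := hu (by simpa using hb')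
        simpa using fun hxu => ⟨this.1, this.2 x hx hxu⟩
  · rw [hunc b (by omega)]
    rcases split b hb with hb | rfl
    · rw [hX' b hb]; rw [hf b hb] at hb'; exact h.fresh b hb hb'
    · simpa using (hu (by simpa using hb')).1
  · rcases split b hb with hb | rfl
    · rw [hf b hb]; exact h.le b hb
    · simpa using hfm
  · rcases split b hb with hb | rfl <;> rcases split b' hb' with hb' | rfl
    · rw [hX' b hb, hX' b' hb'] at hbb; exact h.inj b hb b' hb' hbb
    · rw [hX' b hb, Function.update_self] at hbb; exact absurd hbb (hX b hb)
    · rw [hX' b' hb', Function.update_self] at hbb; exact absurd hbb.symm (hX b' hb')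
    · rfl
  · rcases split b hb with hb | rfl
    · rw [hX' b hb]; exact hV (h.own b hb)
    · simpa using hcl
  · obtain ⟨i, hi, h1, h2, h3⟩ := hp q hq
    refine ⟨i, hi, h1, fun b hb => ?_⟩
    rcases split b hb with hb | rfl
    · rw [hX' b hb]; exact h3 b hb
    · simpa using h2
  · by_cases hcN : cl x ∈ N
    · simpa [hcN] using hserve x hx hcN
    · have hcV : cl x ∈ V := by
        rcases Finset.mem_union.mp hc with h | h
        · exact h
        · exact absurd h hcN
      obtain ⟨h1, h2⟩ := h.serve x hx hcV
      simp only [hcN, if_false]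
      rw [hX' _ h1, ht _ h1]
      exact ⟨by omega, h2⟩
  · rcases split b hb with hb | rfl
    · refine (Finset.card_le_card fun x hx => ?_).trans (h.load b hb)
      simp only [Finset.mem_filter, Finset.mem_union] at hx ⊢
      obtain ⟨h1, h2, h3⟩ := hx
      by_cases hcN : cl x ∈ N
      · simp only [hcN, if_true] at h3; omega
      · simp only [hcN, if_false] at h3
        exact ⟨h1, h2.resolve_right hcN, h3⟩
    · refine (Finset.card_le_card fun x hx => ?_).trans hload
      simp only [Finset.mem_filter, Finset.mem_union] at hx ⊢
      obtain ⟨h1, h2, h3⟩ := hx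
      refine ⟨h1, ?_⟩
      by_contra hcN
      simp only [hcN, if_false] at h3
      have := (h.serve x (Finset.mem_range.mp h1) (h2.resolve_right hcN)).1
      omega
  · rw [Finset.card_union_of_disjoint hN]
    have := hN0.card_pos
    have := h.count
    omega
  · rw [Finset.sum_range_succ, Function.update_self, Finset.sum_union hN,
      Finset.sum_congr rfl fun b hb => ht b (Finset.mem_range.mp hb)]
    have : ∑ b ∈ Finset.range j, t b ≤ 4 * ∑ q ∈ V, L q + 2 * ∑ q ∈ M, L q := h.cost
    change ∑ b ∈ Finset.range j, t b + t₀ ≤ _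
    omega

/-- The largest set of clusters that can be served by a ball around `a`. -/
theorem exists_closure (P : Par) (unit : ℝ) (L : ℕ → ℕ) (hun : 0 ≤ unit) (a i : ℕ)
    (A : Finset ℕ) :
    ∃ J ⊆ A, (∀ q ∈ J, P.dd a q + L q * unit ≤ ((2 * L i + ∑ q ∈ J, L q : ℕ) : ℝ) * unit) ∧
      ∀ q ∈ A, q ∉ J → ((2 * L i + ∑ q ∈ J, L q : ℕ) : ℝ) * unit < P.dd a q := by
  classical
  obtain ⟨J, hJ, hmax⟩ := Finset.exists_max_image
    (A.powerset.filter fun J => ∀ q ∈ J,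
      P.dd a q + L q * unit ≤ ((2 * L i + ∑ q ∈ J, L q : ℕ) : ℝ) * unit) Finset.card
    ⟨∅, by simp⟩
  simp only [Finset.mem_filter, Finset.mem_powerset] at hJ hmax
  refine ⟨J, hJ.1, hJ.2, fun q hq hqJ => ?_⟩
  by_contra hlt
  push Not at hlt
  -- If the ball contained the center of `q`, adding `q` to `J` would increase the radius by exactly
  -- the radius of `q`, so the enlarged ball would contain `q` as well, against the maximality of
  -- `J`.
  have hsum : ((2 * L i + ∑ q ∈ insert q J, L q : ℕ) : ℝ) * unit =
      ((2 * L i + ∑ q ∈ J, L q : ℕ) : ℝ) * unit + L q * unit := by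
    rw [Finset.sum_insert hqJ]; push_cast; ring
  have := hmax (insert q J) ⟨Finset.insert_subset hq hJ.1, fun q' hq' => by
      rw [hsum]
      rcases Finset.mem_insert.mp hq' with rfl | hq'
      · linarith
      · have := hJ.2 q' hq'
        have : 0 ≤ (L q : ℝ) * unit := by positivity
        linarith⟩
  rw [Finset.card_insert_of_notMem hqJ] at this
  omega

variable {P : Par} {unit : ℝ} {cl L : ℕ → ℕ} {C : Finset ℕ}

/-- The number of points in few light clusters. -/
theorem Clusters.card_light (h : P.Clusters unit cl C L) {N : Finset ℕ} (hN : N ⊆ C)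
    (hl : ∀ q ∈ N, P.Light cl q) :
    ((Finset.range P.n).filter (fun x => cl x ∈ N)).card ≤ P.U := by
  have h1 : ((Finset.range P.n).filter (fun x => cl x ∈ N)).card =
      ∑ q ∈ N, ((Finset.range P.n).filter (fun x => cl x = q)).card := by
    rw [Finset.card_eq_sum_card_fiberwise (f := cl) (t := N)]
    · refine Finset.sum_congr rfl fun q hq => ?_
      congr 1
      ext x
      simp only [Finset.mem_filter]
      constructor
      · rintro ⟨⟨h1, h2⟩, h3⟩; exact ⟨h1, h3⟩
      · rintro ⟨h1, h2⟩; exact ⟨⟨h1, h2 ▸ hq⟩, h2⟩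
    · intro x hx
      exact (Finset.mem_filter.mp hx).2
  have h2 : P.k * ((Finset.range P.n).filter (fun x => cl x ∈ N)).card ≤ P.k * P.U := by
    rw [h1, Finset.mul_sum]
    calc ∑ q ∈ N, P.k * ((Finset.range P.n).filter (fun x => cl x = q)).card
        ≤ N.card • P.U := Finset.sum_le_card_nsmul _ _ _ fun q hq => hl q hq
      _ ≤ P.k * P.U := Nat.mul_le_mul_right _ ((Finset.card_le_card hN).trans h.card_le)
  exact Nat.le_of_mul_le_mul_left h2 h.k_pos

/-- A plan in which the balls cover the clusters that have been treated, and no center of another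
light cluster. -/
def Partial (P : Par) (unit : ℝ) (cl : ℕ → ℕ) (C : Finset ℕ) (L : ℕ → ℕ) (V M : Finset ℕ) : Prop :=
  ∃ j f t X serv, P.Plan unit cl L j f t X serv V M ∧ V ∪ M ⊆ C ∧
    (∀ x < P.n, cl x ∈ V ∪ M → ∃ b < j, P.dd (X b) x ≤ t b * unit) ∧
    ∀ b < j, ∀ q ∈ C, q ∉ V ∪ M → P.Light cl q → t b * unit < P.dd (X b) q

theorem Plan.extend {j : ℕ} {f t X serv : ℕ → ℕ} {V M N M' : Finset ℕ} {f₀ t₀ a : ℕ}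
    (hp : P.Plan unit cl L (j + 1) (Function.update f j f₀) (Function.update t j t₀)
      (Function.update X j a) serv (V ∪ N) M') (hVM : V ∪ M ⊆ V ∪ N ∪ M')
    (hC : V ∪ N ∪ M' ⊆ C)
    (hcov : ∀ x < P.n, cl x ∈ V ∪ M → ∃ b < j, P.dd (X b) x ≤ t b * unit)
    (hclosed : ∀ b < j, ∀ q ∈ C, q ∉ V ∪ M → P.Light cl q → t b * unit < P.dd (X b) q)
    (hcov' : ∀ x < P.n, cl x ∈ V ∪ N ∪ M' → cl x ∉ V ∪ M → P.dd a x ≤ t₀ * unit)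
    (hclosed' : ∀ q ∈ C, q ∉ V ∪ N ∪ M' → P.Light cl q → t₀ * unit < P.dd a q) :
    P.Partial unit cl C L (V ∪ N) M' := by
  refine ⟨_, _, _, _, _, hp, hC, fun x hx hc => ?_, fun b hb q hq hqn hl => ?_⟩
  · by_cases hc' : cl x ∈ V ∪ M
    · obtain ⟨b, hb, h⟩ := hcov x hx hc'
      refine ⟨b, by omega, ?_⟩
      rw [Function.update_of_ne hb.ne, Function.update_of_ne hb.ne]
      exact h
    · exact ⟨j, by omega, by simpa using hcov' x hx hc hc'⟩
  · rcases (show b < j ∨ b = j by omega) with hb | rfl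
    · rw [Function.update_of_ne hb.ne, Function.update_of_ne hb.ne]
      exact hclosed b hb q hq (fun h => hqn (hVM h)) hl
    · simpa using hclosed' q hq hqn hl

theorem Clusters.dd_le (h : P.Clusters unit cl C L) {a x : ℕ} (ha : a < P.n) (hx : x < P.n)
    (hax : cl a = cl x) : P.dd a x ≤ ((2 * L (cl a) : ℕ) : ℝ) * unit := by
  have h1 := h.tri a (cl a) x
  have h2 := h.rad a ha
  have h3 := h.rad x hx
  rw [h.symm] at h2
  rw [← hax] at h3
  push_cast
  linarith

/-- The capacity need not suffice for the heavy cluster `i` and the family `J` together. If `J` is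
nonempty, the ball serves `J` alone, and `i` waits in `M` for a ball around its second sample point.
The price is `2 * L i` plus the radii of `J` now and `2 * L i` later. This is where the factor four
arises. -/
theorem Clusters.heavy_step (h : P.Clusters unit cl C L) {V M : Finset ℕ}
    (hVM : P.Partial unit cl C L V M) {i : ℕ} (hi : i ∈ C) (hiV : i ∉ V ∪ M)
    (hh : ¬ P.Light cl i) :
    ∃ V' M', P.Partial unit cl C L V' M' ∧ V ∪ M ⊆ V' ∪ M' ∧ i ∈ V' ∪ M' := by
  classical
  obtain ⟨j, f, t, X, serv, hp, hC, hcov, hclosed⟩ := hVM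
  obtain ⟨s1, s2⟩ := h.sample i hi (not_le.mp hh)
  have hXi : ∀ b < j, cl (X b) ≠ i := fun b hb hbi => hiV (hbi ▸ hp.own b hb)
  have pairs : ∀ a, cl a = i → ∀ q ∈ M, ∃ i' < P.m, cl (P.R i') = q ∧ a ≠ P.R i' ∧
      ∀ b < j, X b ≠ P.R i' := by
    intro a ha q hq
    obtain ⟨i', h1, h2, h3⟩ := hp.pair q hq
    refine ⟨i', h1, h2, ?_, h3⟩
    rintro rfl
    exact hiV (Finset.mem_union_right _ (by rw [← ha, h2]; exact hq))
  have hiV' : i ∉ V ∧ i ∉ M := by simpa using hiV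
  set A := C.filter (fun q => q ∉ V ∪ M ∧ P.Light cl q) with hA
  have hAi : i ∉ A := fun h' => hh (Finset.mem_filter.mp h').2.2
  obtain ⟨i₁, hi₁, e₁, hpair⟩ : ∃ i₁ < P.m, cl (P.R i₁) = i ∧
      (2 ≤ ((Finset.range P.n).filter (fun x => cl x = i)).card →
        ∃ i₂ < P.m, cl (P.R i₂) = i ∧ P.R i₁ ≠ P.R i₂) := by
    by_cases hn2 : 2 ≤ ((Finset.range P.n).filter (fun x => cl x = i)).card
    · obtain ⟨i₁, hi₁, i₂, hi₂, e₁, e₂, hne⟩ := s2 hn2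
      exact ⟨i₁, hi₁, e₁, fun _ => ⟨i₂, hi₂, e₂, hne⟩⟩
    · obtain ⟨i₁, hi₁, e₁⟩ := s1
      exact ⟨i₁, hi₁, e₁, fun h => absurd h hn2⟩
  obtain ⟨J, hJA, hJ1, hJ2⟩ := exists_closure P unit L h.unit_nonneg (P.R i₁) i A
  have hJ : ∀ q ∈ J, q ∈ C ∧ q ∉ V ∪ M ∧ P.Light cl q := fun q hq => by
    simpa [hA] using hJA hq
  have hclosed' : ∀ W, J ⊆ W → V ∪ M ⊆ W → ∀ q ∈ C, q ∉ W → P.Light cl q →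
      ((2 * L i + ∑ q ∈ J, L q : ℕ) : ℝ) * unit < P.dd (P.R i₁) q := by
    intro W hJW hVW q hq hqW hl
    refine hJ2 q ?_ (fun h => hqW (hJW h))
    simp only [hA, Finset.mem_filter]
    exact ⟨hq, fun h => hqW (hVW h), hl⟩
  have hserve : ∀ x < P.n, cl x ∈ insert i J →
      P.dd (P.R i₁) x ≤ ((2 * L i + ∑ q ∈ J, L q : ℕ) : ℝ) * unit := by
    intro x hx hc
    rcases Finset.mem_insert.mp hc with hc | hc
    · have := h.dd_le (h.sample_lt i₁ hi₁) hx (e₁.trans hc.symm)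
      rw [e₁] at this
      refine this.trans (mul_le_mul_of_nonneg_right ?_ h.unit_nonneg)
      exact_mod_cast Nat.le_add_right _ _
    · have h1 := h.tri (P.R i₁) (cl x) x
      have h2 := h.rad x hx
      have h3 := hJ1 _ hc
      linarith
  by_cases hJ0 : J.Nonempty
  -- A heavy cluster has more points than a light one, and the light clusters in `J` are nonempty;
  -- so `i` has at least two points and hence two in the sample.
  · obtain ⟨i₂, hi₂, e₂, hne⟩ := hpair (by
      obtain ⟨q, hq⟩ := hJ0
      obtain ⟨x, hx, hxq⟩ := h.nonempty q (hJ q hq).1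
      have h1 : 0 < ((Finset.range P.n).filter (fun x => cl x = q)).card :=
        Finset.card_pos.mpr ⟨x, by simp [hx, hxq]⟩
      have h2 : P.k * ((Finset.range P.n).filter (fun x => cl x = q)).card ≤ P.U := (hJ q hq).2.2
      have h3 := not_le.mp hh
      by_contra h4
      have h5 := Nat.mul_le_mul_left P.k (show ((Finset.range P.n).filter (fun x => cl x = i)).card ≤
        ((Finset.range P.n).filter (fun x => cl x = q)).card by omega)
      omega)
    refine ⟨V ∪ J, insert i M, ?_, ?_, by simp⟩
    · have hsub : V ∪ M ⊆ V ∪ J ∪ insert i M := by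
        intro q; simp only [Finset.mem_union, Finset.mem_insert]; tauto
      refine Plan.extend (M := M) (t₀ := 2 * L i + ∑ q ∈ J, L q) (a := P.R i₁)
        (f₀ := i₁) (hp.push (h.sample_lt i₁ hi₁) (fun _ => rfl) hi₁.le
        (fun h => absurd hi₁ h) ?_ hJ0 ?_ hsub ?_ (fun b hb hXb => ?_) ?_
        (fun x hx hc => hserve x hx (Finset.mem_insert_of_mem hc))
        (h.card_light (fun q hq => (hJ q hq).1) fun q hq => (hJ q hq).2.2) ?_) hsub ?_ hcov hclosed
        (fun x hx hc hc' => hserve x hx ?_) (hclosed' _ ?_ hsub)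
      · refine Finset.disjoint_left.mpr fun q hq hqJ => (hJ q hqJ).2.1 ?_
        exact Finset.mem_union_left _ hq
      · refine Finset.disjoint_left.mpr fun q hq hqM => ?_
        rcases Finset.mem_insert.mp hqM with rfl | hqM
        · rcases Finset.mem_union.mp hq with hq | hq
          · exact hiV'.1 hq
          · exact hAi (hJA hq)
        · rcases Finset.mem_union.mp hq with hq | hq
          · exact Finset.disjoint_left.mp hp.disj hq hqM
          · exact (hJ q hq).2.1 (Finset.mem_union_right _ hqM)
      · rw [e₁]; simp
      · exact hXi b hb (hXb ▸ e₁)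
      · intro q hq
        rcases Finset.mem_insert.mp hq with rfl | hq
        · exact ⟨i₂, hi₂, e₂, hne, fun b hb hXb => hXi b hb (hXb ▸ e₂)⟩
        · exact pairs _ e₁ q hq
      · rw [Finset.sum_insert hiV'.2]; omega
      · intro q hq
        simp only [Finset.mem_union, Finset.mem_insert] at hq
        rcases hq with (hq | hq) | (rfl | hq)
        · exact hC (Finset.mem_union_left _ hq)
        · exact (hJ q hq).1
        · exact hi
        · exact hC (Finset.mem_union_right _ hq)
      · simp only [Finset.mem_union, Finset.mem_insert] at hc hc' ⊢; tauto
      · intro q hq; simp [hq]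
    · intro q; simp only [Finset.mem_union, Finset.mem_insert]; tauto
  · rw [Finset.not_nonempty_iff_eq_empty] at hJ0
    subst hJ0
    have hsub : V ∪ M ⊆ V ∪ {i} ∪ M := by
      intro q; simp only [Finset.mem_union]; tauto
    have hserve' : ∀ x < P.n, cl x ∈ ({i} : Finset ℕ) →
        P.dd (P.R i₁) x ≤ ((2 * L i + ∑ q ∈ (∅ : Finset ℕ), L q : ℕ) : ℝ) * unit :=
      fun x hx hc => hserve x hx (by simpa using hc)
    refine ⟨V ∪ {i}, M, ?_, hsub, by simp⟩
    refine Plan.extend (M := M) (t₀ := 2 * L i + ∑ q ∈ (∅ : Finset ℕ), L q) (a := P.R i₁)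
      (f₀ := i₁) (hp.push (h.sample_lt i₁ hi₁)
      (fun _ => rfl) hi₁.le (fun h => absurd hi₁ h) ?_ (by simp) ?_ hsub ?_ (fun b hb hXb => ?_)
      (pairs _ e₁) hserve' ?_ ?_) hsub ?_ hcov hclosed
      (fun x hx hc hc' => hserve' x hx ?_) (hclosed' _ (by simp) hsub)
    · simpa using hiV'.1
    · rw [Finset.disjoint_union_left]
      exact ⟨hp.disj, by simpa using hiV'.2⟩
    · rw [e₁]; simp
    · exact hXi b hb (hXb ▸ e₁)
    · simpa using h.load i hi
    · simp; omega
    · intro q hq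
      simp only [Finset.mem_union, Finset.mem_singleton] at hq
      rcases hq with (hq | rfl) | hq
      · exact hC (Finset.mem_union_left _ hq)
      · exact hi
      · exact hC (Finset.mem_union_right _ hq)
    · simp only [Finset.mem_union] at hc hc' ⊢; tauto

/-- The center of an untreated light cluster is uncovered, so uncovered points exist, and none of
them is in a treated cluster. The last uncovered point thus lies in some untreated cluster `i`, and
which one is irrelevant. Since `i` and its family are all light, one ball can serve them together.
-/
theorem Clusters.light_step (h : P.Clusters unit cl C L) {V M : Finset ℕ}
    (hVM : P.Partial unit cl C L V M) (hheavy : ∀ q ∈ C, ¬ P.Light cl q → q ∈ V ∪ M)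
    (hne : ¬ C ⊆ V ∪ M) :
    ∃ V' M', P.Partial unit cl C L V' M' ∧ V ∪ M ⊆ V' ∪ M' ∧ ∃ i ∈ C, i ∉ V ∪ M ∧ i ∈ V' ∪ M' := by
  classical
  obtain ⟨j, f, t, X, serv, hp, hC, hcov, hclosed⟩ := hVM
  obtain ⟨q₀, hq₀, hq₀V⟩ := Finset.not_subset.mp hne
  have hq₀u : P.Uncov X (fun b => t b * unit) j q₀ := fun b hb =>
    hclosed b hb q₀ hq₀ hq₀V (by_contra fun hl => hq₀V (hheavy q₀ hq₀ hl))
  obtain ⟨a, ha, hmax⟩ := Finset.exists_max_image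
    ((Finset.range P.n).filter fun x => P.Uncov X (fun b => t b * unit) j x) id
    ⟨q₀, by simp [h.lt q₀ hq₀, hq₀u]⟩
  simp only [Finset.mem_filter, Finset.mem_range, id] at ha hmax
  set i := cl a with hia
  have hi : i ∈ C := h.mem a ha.1
  have hiV : i ∉ V ∪ M := by
    intro hiV
    obtain ⟨b, hb, hle⟩ := hcov a ha.1 hiV
    exact absurd (ha.2 b hb) (not_lt.mpr hle)
  have hl : P.Light cl i := by_contra fun hl => hiV (hheavy i hi hl)
  have hiV' : i ∉ V ∧ i ∉ M := by simpa using hiV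
  -- The cluster `i` is left out because its radius is already counted twice in the radius of the
  -- ball.
  set A := C.filter (fun q => q ∉ V ∪ M ∧ q ≠ i ∧ P.Light cl q) with hA
  obtain ⟨J, hJA, hJ1, hJ2⟩ := exists_closure P unit L h.unit_nonneg a i A
  have hJ : ∀ q ∈ J, q ∈ C ∧ q ∉ V ∪ M ∧ q ≠ i ∧ P.Light cl q := fun q hq => by
    simpa [hA] using hJA hq
  have hiJ : i ∉ J := fun h => (hJ i h).2.2.1 rfl
  have hserve : ∀ x < P.n, cl x ∈ insert i J →
      P.dd a x ≤ ((2 * L i + ∑ q ∈ J, L q : ℕ) : ℝ) * unit := by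
    intro x hx hc
    rcases Finset.mem_insert.mp hc with hc | hc
    · refine (h.dd_le ha.1 hx hc.symm).trans (mul_le_mul_of_nonneg_right ?_ h.unit_nonneg)
      exact_mod_cast Nat.le_add_right _ _
    · have h1 := h.tri a (cl x) x
      have h2 := h.rad x hx
      have h3 := hJ1 _ hc
      linarith
  have hsub : V ∪ M ⊆ V ∪ insert i J ∪ M := by
    intro q; simp only [Finset.mem_union, Finset.mem_insert]; tauto
  refine ⟨V ∪ insert i J, M, ?_, hsub, i, hi, hiV, by simp⟩
  -- The index `P.m`, one past the sample, encodes the choice of the last uncovered point.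
  refine Plan.extend (M := M) (t₀ := 2 * L i + ∑ q ∈ J, L q) (a := a) (f₀ := P.m)
    (hp.push ha.1 (fun h => absurd h (lt_irrefl _)) le_rfl
    (fun _ => ⟨ha.2, fun x hx hu => hmax x ⟨hx, hu⟩⟩) ?_ (by simp) ?_ hsub (by simp [← hia])
    (fun b hb hXb => hiV (by rw [hia, ← hXb]; exact hp.own b hb)) ?_ hserve
    (h.card_light ?_ ?_) ?_) hsub ?_ hcov hclosed
    (fun x hx hc hc' => hserve x hx ?_) (fun q hq hqV hql => hJ2 q ?_ ?_)
  · refine Finset.disjoint_left.mpr fun q hq hqJ => ?_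
    rcases Finset.mem_insert.mp hqJ with rfl | hqJ
    · exact hiV'.1 hq
    · exact (hJ q hqJ).2.1 (Finset.mem_union_left _ hq)
  · refine Finset.disjoint_left.mpr fun q hq hqM => ?_
    simp only [Finset.mem_union, Finset.mem_insert] at hq
    rcases hq with hq | rfl | hq
    · exact Finset.disjoint_left.mp hp.disj hq hqM
    · exact hiV'.2 hqM
    · exact (hJ q hq).2.1 (Finset.mem_union_right _ hqM)
  · intro q hq
    obtain ⟨i', h1, h2, h3⟩ := hp.pair q hq
    refine ⟨i', h1, h2, ?_, h3⟩
    intro hai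
    exact hiV'.2 (by rw [hia, hai, h2]; exact hq)
  · intro q hq
    rcases Finset.mem_insert.mp hq with rfl | hq
    · exact hi
    · exact (hJ q hq).1
  · intro q hq
    rcases Finset.mem_insert.mp hq with rfl | hq
    · exact hl
    · exact (hJ q hq).2.2.2
  · rw [Finset.sum_insert hiJ]; omega
  · intro q hq
    simp only [Finset.mem_union, Finset.mem_insert] at hq
    rcases hq with (hq | rfl | hq) | hq
    · exact hC (Finset.mem_union_left _ hq)
    · exact hi
    · exact (hJ q hq).1
    · exact hC (Finset.mem_union_right _ hq)
  · simp only [Finset.mem_union] at hc hc' ⊢; tauto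
  · simp only [Finset.mem_union, Finset.mem_insert] at hqV
    simp only [hA, Finset.mem_filter, Finset.mem_union]
    exact ⟨hq, by tauto, by tauto, hql⟩
  · intro hqJ
    exact hqV (by simp [hqJ])

/-- Heavy clusters come first: only the centers of light clusters are known to stay uncovered, so
the light step needs that nothing heavy is left. Each step treats at least one more cluster. -/
theorem Clusters.exists_partial (h : P.Clusters unit cl C L) :
    ∃ V M, P.Partial unit cl C L V M ∧ V ∪ M = C := by
  classical
  have step : ∀ V M, P.Partial unit cl C L V M → ¬ C ⊆ V ∪ M →
      ∃ V' M', P.Partial unit cl C L V' M' ∧ (C \ (V' ∪ M')).card < (C \ (V ∪ M)).card := by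
    intro V M hVM hne
    obtain ⟨V', M', h1, h2, i, h3, h4, h5⟩ : ∃ V' M', P.Partial unit cl C L V' M' ∧
        V ∪ M ⊆ V' ∪ M' ∧ ∃ i ∈ C, i ∉ V ∪ M ∧ i ∈ V' ∪ M' := by
      by_cases hh : ∀ q ∈ C, ¬ P.Light cl q → q ∈ V ∪ M
      · exact h.light_step hVM hh hne
      · push Not at hh
        obtain ⟨i, h1, h2, h3⟩ := hh
        obtain ⟨V', M', h4, h5, h6⟩ := h.heavy_step hVM h1 h3 h2
        exact ⟨V', M', h4, h5, i, h1, h3, h6⟩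
    refine ⟨V', M', h1, Finset.card_lt_card ?_⟩
    refine Finset.ssubset_iff_of_subset (Finset.sdiff_subset_sdiff le_rfl h2) |>.mpr ⟨i, ?_, ?_⟩
    · simp only [Finset.mem_sdiff]; exact ⟨h3, h4⟩
    · simp only [Finset.mem_sdiff]; tauto
  have base : P.Partial unit cl C L ∅ ∅ := by
    refine ⟨0, fun _ => 0, fun _ => 0, fun _ => 0, fun _ => 0, ?_, by simp, by simp, by simp⟩
    refine ⟨⟨?_, ?_, ?_, ?_⟩, ?_, ?_, ?_, ?_, ?_, ?_, ?_, ?_, ?_, ?_⟩ <;> simp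
  have : ∀ N V M, P.Partial unit cl C L V M → (C \ (V ∪ M)).card ≤ N →
      ∃ V M, P.Partial unit cl C L V M ∧ V ∪ M = C := by
    intro N
    induction N with
    | zero =>
      intro V M hVM hc
      have : C \ (V ∪ M) = ∅ := Finset.card_eq_zero.mp (by omega)
      rw [Finset.sdiff_eq_empty_iff_subset] at this
      obtain ⟨j, f, t, X, serv, hp, hC, h'⟩ := hVM
      exact ⟨V, M, ⟨j, f, t, X, serv, hp, hC, h'⟩, hC.antisymm this⟩
    | succ N ih =>
      intro V M hVM hc
      by_cases hne : C ⊆ V ∪ M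
      · obtain ⟨j, f, t, X, serv, hp, hC, h'⟩ := hVM
        exact ⟨V, M, ⟨j, f, t, X, serv, hp, hC, h'⟩, hC.antisymm hne⟩
      · obtain ⟨V', M', h1, h2⟩ := step V M hVM hne
        exact ih V' M' h1 (by omega)
  exact this _ ∅ ∅ base le_rfl

/-- Each waiting cluster `q` gets a ball of radius `2 * L q` around its reserved sample point; its
weight in the cost bound rises from two to four. -/
theorem Clusters.exists_plan (h : P.Clusters unit cl C L) :
    ∃ j f t X serv, P.Plan unit cl L j f t X serv C ∅ := by
  classical
  obtain ⟨V, M, ⟨j, f, t, X, serv, hp, -⟩, hVM⟩ := h.exists_partial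
  induction hM : M.card generalizing V M j f t X serv with
  | zero =>
    obtain rfl : M = ∅ := Finset.card_eq_zero.mp hM
    rw [Finset.union_empty] at hVM
    exact ⟨j, f, t, X, serv, hVM ▸ hp⟩
  | succ N ih =>
    obtain ⟨q, hq⟩ : M.Nonempty := Finset.card_pos.mp (by omega)
    obtain ⟨i, hi, hiq, hX⟩ := hp.pair q hq
    have hqV : q ∉ V := fun h' => Finset.disjoint_left.mp hp.disj h' hq
    have hqC : q ∈ C := hVM ▸ Finset.mem_union_right _ hq
    have hun : V ∪ {q} ∪ M.erase q = V ∪ M := by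
      ext x
      simp only [Finset.mem_union, Finset.mem_singleton, Finset.mem_erase]
      by_cases hxq : x = q
      · simp [hxq, hq]
      · simp [hxq]
    have hp' := hp.push (f₀ := i) (t₀ := 2 * L q) (a := P.R i) (N := {q}) (M' := M.erase q)
      (h.sample_lt i hi) (fun _ => rfl) hi.le (fun h => absurd hi h) (by simpa using hqV) (by simp)
      ?_ hun.ge (by rw [hiq]; simp) hX (fun q' hq' => ?_) (fun x hx hc => ?_)
      (by simpa using h.load q hqC) ?_
    · exact ih (V ∪ {q}) (M.erase q) (hun.trans hVM) _ _ _ _ _ hp'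
        (by rw [Finset.card_erase_of_mem hq, hM]; rfl)
    · rw [Finset.disjoint_union_left]
      exact ⟨hp.disj.mono_right (Finset.erase_subset _ _), by simp⟩
    · obtain ⟨i', h1, h2, h3⟩ := hp.pair q' (Finset.mem_of_mem_erase hq')
      refine ⟨i', h1, h2, fun hR => Finset.ne_of_mem_erase hq' ?_, h3⟩
      rw [← h2, ← hR, hiq]
    · have := h.dd_le (h.sample_lt i hi) hx (hiq.trans (Finset.mem_singleton.mp hc).symm)
      rwa [hiq] at this
    · have : ∑ x ∈ M, L x = L q + ∑ x ∈ M.erase q, L x := (Finset.add_sum_erase _ _ hq).symm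
      simp only [Finset.sum_singleton]
      omega

/-- By induction the same points are uncovered before each ball. By `fresh` there is an uncovered
point whenever the last one is asked for; otherwise `Placed` would leave the choice open. -/
theorem Plan.unique {j : ℕ} {f t X serv : ℕ → ℕ} {V M : Finset ℕ}
    (hp : P.Plan unit cl L j f t X serv V M) {X' : ℕ → ℕ} {r' : ℕ → ℝ}
    (h : P.Placed unit f t X' r' j) : ∀ b < j, X' b = X b := by
  intro b
  induction b using Nat.strong_induction_on with
  | _ b ih =>
    intro hb
    have hu : ∀ x, P.Uncov X' r' b x ↔ P.Uncov X (fun b => t b * unit) b x := by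
      intro x
      refine forall₂_congr fun b' hb' => ?_
      rw [ih b' hb' (by omega), h.rad b' (by omega)]
    by_cases hs : f b < P.m
    · rw [h.sample b hb hs, hp.placed.sample b hb hs]
    · have h1 := hp.fresh b hb hs
      have h2 := h.uncov b hb hs (X b) (hp.placed.lt b hb) ((hu _).mpr h1)
      have h3 := hp.placed.uncov b hb hs (X' b) (h.lt b hb) ((hu _).mp h2.1)
      exact le_antisymm h3.2 h2.2

/-- Mixed radix notation, in which the first ball has the least significant digits. -/
theorem exists_digits (P : Par) (f t : ℕ → ℕ) (j : ℕ) (hf : ∀ b < j, f b < P.m + 1)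
    (ht : ∀ b < j, t b < P.T) :
    ∃ q < ((P.m + 1) * P.T) ^ j, ∀ b < j, (fun y => y / (P.m + 1) / P.T)^[b] q % (P.m + 1) = f b ∧
      (fun y => y / (P.m + 1) / P.T)^[b] q / (P.m + 1) % P.T = t b := by
  induction j generalizing f t with
  | zero => exact ⟨0, by simp, by simp⟩
  | succ j ih =>
    obtain ⟨q, hq, hd⟩ := ih (fun b => f (b + 1)) (fun b => t (b + 1))
      (fun b hb => hf _ (by omega)) (fun b hb => ht _ (by omega))
    have hf0 := hf 0 (by omega)
    have ht0 := ht 0 (by omega)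
    have e1 : (f 0 + (P.m + 1) * (t 0 + P.T * q)) / (P.m + 1) = t 0 + P.T * q := by
      rw [Nat.add_mul_div_left _ _ (by omega), Nat.div_eq_of_lt hf0, zero_add]
    have e2 : (t 0 + P.T * q) / P.T = q := by
      rw [Nat.add_mul_div_left _ _ (by omega), Nat.div_eq_of_lt ht0, zero_add]
    refine ⟨f 0 + (P.m + 1) * (t 0 + P.T * q), ?_, fun b hb => ?_⟩
    · have h1 : t 0 + P.T * q + 1 ≤ P.T * (q + 1) := by rw [mul_add]; omega
      have h2 : P.T * (q + 1) ≤ P.T * ((P.m + 1) * P.T) ^ j := Nat.mul_le_mul_left _ hq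
      calc f 0 + (P.m + 1) * (t 0 + P.T * q) < (P.m + 1) * (t 0 + P.T * q + 1) := by
            rw [Nat.mul_add_one]; omega
        _ ≤ (P.m + 1) * (P.T * ((P.m + 1) * P.T) ^ j) := Nat.mul_le_mul_left _ (h1.trans h2)
        _ = _ := by ring
    · cases b with
      | zero =>
        simp only [Function.iterate_zero, id, e1]
        exact ⟨by rw [Nat.add_mul_mod_self_left, Nat.mod_eq_of_lt hf0],
          by rw [Nat.add_mul_mod_self_left, Nat.mod_eq_of_lt ht0]⟩
      | succ b =>
        rw [Function.iterate_succ_apply]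
        rw [e1, e2]
        exact hd b (by omega)

theorem exists_guess_digits (P : Par) (f t : ℕ → ℕ) {j : ℕ} (hj : j ≤ P.k)
    (hf : ∀ b < j, f b ≤ P.m) (ht : ∀ b < j, t b < P.T) (hT : 0 < P.T) :
    ∃ g < P.G, P.kk g = j ∧ ∀ b < j, P.sel g b = f b ∧ P.len g b = t b := by
  obtain ⟨q, hq, hd⟩ := exists_digits P f t j (fun b hb => Nat.lt_succ_of_le (hf b hb)) ht
  have hrest : ∀ g b, P.rest g b = (fun y => y / (P.m + 1) / P.T)^[b] (g / (P.k + 1)) := by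
    intro g b
    induction b with
    | zero => rfl
    | succ b ih => rw [Function.iterate_succ_apply', ← ih]; rfl
  have e1 : (P.k - j + (P.k + 1) * q) / (P.k + 1) = q := by
    rw [Nat.add_mul_div_left _ _ (by omega), Nat.div_eq_of_lt (by omega), zero_add]
  -- The lowest digit is `k - j`, because `kk` subtracts it from `k`.
  refine ⟨P.k - j + (P.k + 1) * q, ?_, ?_, fun b hb => ?_⟩
  · have : q + 1 ≤ ((P.m + 1) * P.T) ^ P.k :=
      hq.trans_le (Nat.pow_le_pow_right (Nat.mul_pos (by omega) hT) hj)
    calc P.k - j + (P.k + 1) * q < (P.k + 1) * (q + 1) := by rw [mul_add, mul_one]; omega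
      _ ≤ _ := Nat.mul_le_mul_left _ this
  · rw [kk, Nat.add_mul_mod_self_left, Nat.mod_eq_of_lt (by omega)]
    omega
  · rw [sel, len, hrest, e1]
    exact hd b hb

/-- Some guess leads to a solution of at most four times the cost. -/
theorem Clusters.exists_guess (h : P.Clusters unit cl C L) :
    ∃ g < P.G, ∀ X r, P.Placed unit (P.sel g) (P.len g) X r (P.kk g) →
      Balls.Feas ⟨P, X, r, P.kk g⟩ ∧
        ∑ b ∈ Finset.range (P.kk g), r b ≤ 4 * ∑ q ∈ C, L q * unit := by
  obtain ⟨j, f, t, X₀, serv, hp⟩ := h.exists_plan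
  have hcost : ∑ b ∈ Finset.range j, t b ≤ 4 * ∑ q ∈ C, L q := by simpa using hp.cost
  have hsum := h.sum_lt
  obtain ⟨g, hg, hkk, hd⟩ := P.exists_guess_digits f t (hp.count.trans h.card_le) hp.le
    (fun b hb => (Finset.single_le_sum (f := t) (fun _ _ => Nat.zero_le _)
      (Finset.mem_range.mpr hb)).trans_lt (hcost.trans_lt hsum)) (by omega)
  refine ⟨g, hg, fun X r hpl => ?_⟩
  rw [hkk] at hpl ⊢
  have hpl' : P.Placed unit f t X r j := by
    refine ⟨hpl.lt, fun b hb => ?_, fun b hb => ?_, fun b hb => ?_⟩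
    · rw [hpl.rad b hb, (hd b hb).2]
    · rw [← (hd b hb).1]; exact hpl.sample b hb
    · rw [← (hd b hb).1]; exact hpl.uncov b hb
  have hX := hp.unique hpl'
  refine ⟨⟨fun b hb b' hb' hbb => ?_, fun x => serv (cl x), fun x hx => ?_, fun b hb => ?_⟩, ?_⟩
  · simp only at hb hb' hbb
    rw [hX b hb, hX b' hb'] at hbb
    exact hp.inj b hb b' hb' hbb
  · obtain ⟨h1, h2⟩ := hp.serve x hx (h.mem x hx)
    refine ⟨h1, ?_⟩
    change P.dd (X (serv (cl x))) x ≤ r (serv (cl x))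
    rw [hX _ h1, hpl'.rad _ h1]
    exact h2
  · refine (Finset.card_le_card fun x hx => ?_).trans (hp.load b hb)
    simp only [Finset.mem_filter, Finset.mem_range] at hx ⊢
    exact ⟨hx.1, h.mem x hx.1, hx.2⟩
  · rw [Finset.sum_congr rfl fun b hb => hpl'.rad b (Finset.mem_range.mp hb), ← Finset.sum_mul,
      ← Finset.sum_mul, ← mul_assoc]
    refine mul_le_mul_of_nonneg_right ?_ h.unit_nonneg
    exact_mod_cast hcost

end Par

end Structured

namespace Structured

namespace Par

/-! ### The scales -/

/-- The farthest-first traversal. -/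
def trav (P : Par) : ℕ → ℕ
  | 0 => 0
  | s + 1 => amax (P.md s) P.n

variable {P : Par}

theorem trav_lt (hn : 0 < P.n) (s : ℕ) : P.trav s < P.n := by
  cases s with
  | zero => exact hn
  | succ s => exact amax_lt _ hn

theorem md_le (s x : ℕ) : ∀ i ≤ s, P.md s x ≤ P.dd (P.trav i) x := by
  induction s with
  | zero => intro i hi; obtain rfl : i = 0 := by omega
            exact le_rfl
  | succ s ih =>
    intro i hi
    rcases (show i ≤ s ∨ i = s + 1 by omega) with hi | rfl
    · exact (min_le_left _ _).trans (ih i hi)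
    · exact min_le_right _ _

theorem exists_md (s x : ℕ) : ∃ i ≤ s, P.md s x = P.dd (P.trav i) x := by
  induction s with
  | zero => exact ⟨0, le_rfl, rfl⟩
  | succ s ih =>
    rcases le_total (P.md s x) (P.dd (P.trav (s + 1)) x) with h | h
    · obtain ⟨i, hi, e⟩ := ih
      exact ⟨i, by omega, (min_eq_left h).trans e⟩
    · exact ⟨s + 1, le_rfl, min_eq_right h⟩

theorem md_le_scale {s x : ℕ} (hx : x < P.n) : P.md s x ≤ P.scale s := le_amax _ hx

theorem scale_antitone (hn : 0 < P.n) : Antitone P.scale :=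
  antitone_nat_of_succ_le fun _ =>
    (min_le_left _ _).trans (md_le_scale (amax_lt _ hn))

/-- When a point joins the traversal, its distance to all earlier ones is at least the scale at that
time, and the scales decrease. -/
theorem scale_le_dd (hn : 0 < P.n) {i j s : ℕ} (hij : i < j) (hj : j ≤ s + 1) :
    P.scale s ≤ P.dd (P.trav i) (P.trav j) := by
  obtain ⟨j, rfl⟩ : ∃ j', j = j' + 1 := ⟨j - 1, by omega⟩
  exact (scale_antitone hn (show j ≤ s by omega)).trans (md_le j _ i (by omega))

/-- Let `r` be the distance of `c` and `x`, and `s` the first index whose scale is below `r / 4`;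
there is one, for otherwise the traversal would have `n + 1` distinct points. Then `c` and `x` are
within `r / 4` of traversal points with indices up to `s`. These points are different and at
distance at most `2 * r`, which bounds the preceding scale from above; from below it is at least `r
/ 4` by the choice of `s`. -/
theorem exists_scale (hn : 0 < P.n) (self : ∀ x, P.dd x x = 0)
    (symm : ∀ x y, P.dd x y = P.dd y x) (tri : ∀ x y z, P.dd x z ≤ P.dd x y + P.dd y z)
    {c x : ℕ} (hc : c < P.n) (hx : x < P.n) (hpos : 0 < P.dd c x) :
    ∃ s < P.n, P.dd c x / 4 ≤ P.scale s ∧ P.scale s ≤ 2 * P.dd c x := by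
  classical
  have hex : ∃ s, s < P.n ∧ P.scale s < P.dd c x / 4 := by
    by_contra hno
    push Not at hno
    have hlast := hno (P.n - 1) (by omega)
    have hinj : ∀ i j, i < j → j < P.n + 1 → P.trav i ≠ P.trav j := by
      intro i j hij hj he
      have := scale_le_dd hn hij (show j ≤ P.n - 1 + 1 by omega)
      rw [he, self] at this
      linarith
    have := Finset.card_le_card_of_injOn (s := Finset.range (P.n + 1)) (t := Finset.range P.n) P.trav
      (fun i _ => by simpa using trav_lt hn i) (fun i hi j hj he => by
        simp only [Finset.coe_range, Set.mem_Iio] at hi hj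
        rcases lt_trichotomy i j with h | h | h
        · exact absurd he (hinj i j h hj)
        · exact h
        · exact absurd he.symm (hinj j i h hi))
    simp at this
  obtain ⟨hs, hlt⟩ := Nat.find_spec hex
  have hmin := fun s => Nat.find_min hex (m := s)
  set s := Nat.find hex
  obtain ⟨i, hi, ei⟩ := P.exists_md s c
  obtain ⟨i', hi', ei'⟩ := P.exists_md s x
  have hci : P.dd (P.trav i) c < P.dd c x / 4 := ei ▸ (md_le_scale hc).trans_lt hlt
  have hxi : P.dd (P.trav i') x < P.dd c x / 4 := ei' ▸ (md_le_scale hx).trans_lt hlt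
  have hne : i ≠ i' := by
    rintro rfl
    have := tri c (P.trav i) x
    rw [symm c (P.trav i)] at this
    linarith
  have h15 : P.dd (P.trav i) (P.trav i') ≤ 2 * P.dd c x := by
    have h1 := tri (P.trav i) c (P.trav i')
    have h2 := tri c x (P.trav i')
    rw [symm x] at h2
    linarith
  have hs0 : s ≠ 0 := by omega
  refine ⟨s - 1, by omega, ?_, ?_⟩
  · have := hmin (s - 1) (by omega)
    push Not at this
    exact this (by omega)
  · rcases Nat.lt_or_gt_of_ne hne with h | h
    · exact (scale_le_dd hn h (by omega)).trans h15
    · rw [symm] at h15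
      exact (scale_le_dd hn h (by omega)).trans h15

/-- The sample contains sufficiently many points of the large clusters. -/
def Sampled (P : Par) (cl : ℕ → ℕ) (C : Finset ℕ) : Prop :=
  ∀ q ∈ C, P.U < P.k * ((Finset.range P.n).filter (fun x => cl x = q)).card →
    (∃ i < P.m, cl (P.R i) = q) ∧
    (2 ≤ ((Finset.range P.n).filter (fun x => cl x = q)).card →
      ∃ i < P.m, ∃ i' < P.m, cl (P.R i) = q ∧ cl (P.R i') = q ∧ P.R i ≠ P.R i')

/-- For each solution some scale and guess lead to one of almost at most four times the cost. -/
theorem exists_scale_guess {e : ℕ} (he : 0 < e) (hn : 0 < P.n) (hk : 0 < P.k) (hu : P.u = e * P.k)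
    (hT : P.T = 4 * P.k * (4 * (e * P.k) + 1) + 1)
    (self : ∀ x, P.dd x x = 0) (nonneg : ∀ x y, 0 ≤ P.dd x y)
    (symm : ∀ x y, P.dd x y = P.dd y x) (tri : ∀ x y z, P.dd x z ≤ P.dd x y + P.dd y z)
    (hR : ∀ i < P.m, P.R i < P.n) {cl : ℕ → ℕ} {r : ℕ → ℝ} (hcl : ∀ x < P.n, cl x < P.n)
    (hcard : ((Finset.range P.n).image cl).card ≤ P.k)
    (hr : ∀ q < P.n, r q = 0 ∨ ∃ x < P.n, r q = P.dd q x)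
    (hle : ∀ x < P.n, P.dd (cl x) x ≤ r (cl x))
    (hload : ∀ q < P.n, ((Finset.range P.n).filter (fun x => cl x = q)).card ≤ P.U)
    (hs : P.Sampled cl ((Finset.range P.n).image cl)) :
    ∃ s < P.n, ∃ g < P.G, ∀ X r', P.Placed (P.scale s / P.u) (P.sel g) (P.len g) X r' (P.kk g) →
      Balls.Feas ⟨P, X, r', P.kk g⟩ ∧ ∑ b ∈ Finset.range (P.kk g), r' b ≤
        (4 + 8 / e) * ∑ q ∈ (Finset.range P.n).image cl, r q := by
  set C := (Finset.range P.n).image cl with hC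
  have hCn : ∀ q ∈ C, q < P.n := by
    intro q hq
    obtain ⟨x, hx, rfl⟩ := Finset.mem_image.mp hq
    exact hcl x (Finset.mem_range.mp hx)
  have hr0 : ∀ q < P.n, 0 ≤ r q := by
    intro q hq
    rcases hr q hq with h | ⟨x, _, h⟩
    · exact h.ge
    · rw [h]; exact nonneg _ _
  have hscale : ∀ s, 0 ≤ P.scale s := by
    intro s
    obtain ⟨i, _, h⟩ := P.exists_md s (amax (P.md s) P.n)
    rw [scale, h]; exact nonneg _ _
  have hu0 : 0 < (P.u : ℝ) := by rw [hu]; positivity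
  have key : ∃ s < P.n, ∃ L : ℕ → ℕ, (∀ q ∈ C, r q ≤ L q * (P.scale s / P.u)) ∧
      (∀ q ∈ C, L q ≤ 4 * (e * P.k) + 1) ∧
      4 * ∑ q ∈ C, L q * (P.scale s / P.u) ≤ (4 + 8 / e) * ∑ q ∈ C, r q := by
    -- If all radii vanish, no positive distance singles out a scale, but then lengths of zero units
    -- are right for every scale.
    by_cases hall : ∀ q ∈ C, r q = 0
    · refine ⟨0, hn, fun _ => 0, fun q hq => by simp [hall q hq], fun q hq => Nat.zero_le _, ?_⟩
      rw [Finset.sum_eq_zero hall]; simp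
    push Not at hall
    obtain ⟨q₁, hq₁, hne⟩ := hall
    obtain ⟨q, hq, hmax⟩ := Finset.exists_max_image C r ⟨q₁, hq₁⟩
    have hrq : 0 < r q := ((hr0 q₁ (hCn _ hq₁)).lt_of_ne' hne).trans_le (hmax q₁ hq₁)
    obtain ⟨x, hx, hqx⟩ := (hr q (hCn q hq)).resolve_left hrq.ne'
    obtain ⟨s, hs, h1, h2⟩ := exists_scale hn self symm tri (hCn q hq) hx (hqx ▸ hrq)
    rw [← hqx] at h1 h2
    have hsc : 0 < P.scale s := by linarith
    have hunit : 0 < P.scale s / P.u := by positivity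
    -- The largest radius is at most four scales, that is `4 * (e * k)` units. Rounding up adds at
    -- most one unit per cluster, in total at most `scale / e`, which is at most `2 / e` times the
    -- sum of the radii.
    refine ⟨s, hs, fun q' => ⌈r q' / (P.scale s / P.u)⌉₊, fun q' hq' => ?_, fun q' hq' => ?_, ?_⟩
    · rw [← div_le_iff₀ hunit]; exact Nat.le_ceil _
    · have : r q' / (P.scale s / P.u) ≤ ((4 * (e * P.k) : ℕ) : ℝ) := by
        rw [div_le_iff₀ hunit, ← hu]
        have := hmax q' hq'
        push_cast
        rw [mul_assoc, mul_div_cancel₀ _ hu0.ne']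
        linarith
      exact (Nat.ceil_le.mpr this).trans (by omega)
    · have h3 : ∀ q' ∈ C, (⌈r q' / (P.scale s / P.u)⌉₊ : ℝ) * (P.scale s / P.u) ≤
          r q' + P.scale s / P.u := by
        intro q' hq'
        have := (Nat.ceil_lt_add_one (div_nonneg (hr0 q' (hCn q' hq')) hunit.le)).le
        calc (⌈r q' / (P.scale s / P.u)⌉₊ : ℝ) * (P.scale s / P.u)
            ≤ (r q' / (P.scale s / P.u) + 1) * (P.scale s / P.u) :=
              mul_le_mul_of_nonneg_right this hunit.le
          _ = _ := by rw [add_mul, div_mul_cancel₀ _ hunit.ne', one_mul]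
      have h4 := Finset.sum_le_sum h3
      rw [Finset.sum_add_distrib, Finset.sum_const, nsmul_eq_mul] at h4
      have h5 : (C.card : ℝ) * (P.scale s / P.u) ≤ P.scale s / e := by
        have hkc : (C.card : ℝ) ≤ P.k := by exact_mod_cast hcard
        have he' : (0 : ℝ) < e := by exact_mod_cast he
        have hk' : (0 : ℝ) < P.k := by exact_mod_cast hk
        calc (C.card : ℝ) * (P.scale s / P.u) ≤ P.k * (P.scale s / P.u) :=
              mul_le_mul_of_nonneg_right hkc hunit.le
          _ = P.scale s / e := by rw [hu]; push_cast; field_simp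
      have h6 : r q ≤ ∑ q ∈ C, r q :=
        Finset.single_le_sum (fun q' hq' => hr0 q' (hCn q' hq')) hq
      have h7 : P.scale s / e ≤ 2 * (∑ q ∈ C, r q) / e := by gcongr; linarith
      have h8 : (4 + 8 / (e : ℝ)) * ∑ q ∈ C, r q =
          4 * (∑ q ∈ C, r q + 2 * (∑ q ∈ C, r q) / e) := by ring
      rw [h8]
      linarith
  obtain ⟨s, hsn, L, k1, k2, k3⟩ := key
  have hcls : P.Clusters (P.scale s / P.u) cl C L :=
    { symm := symm
      tri := tri
      unit_nonneg := div_nonneg (hscale s) hu0.le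
      k_pos := hk
      mem := fun x hx => Finset.mem_image_of_mem _ (Finset.mem_range.mpr hx)
      lt := hCn
      nonempty := fun q hq => by
        obtain ⟨x, hx, h⟩ := Finset.mem_image.mp hq
        exact ⟨x, Finset.mem_range.mp hx, h⟩
      card_le := hcard
      rad := fun x hx => (hle x hx).trans
        (k1 _ (Finset.mem_image_of_mem _ (Finset.mem_range.mpr hx)))
      load := fun q hq => hload q (hCn q hq)
      sample_lt := hR
      sample := hs
      sum_lt := by
        have h1 : ∑ q ∈ C, L q ≤ C.card • (4 * (e * P.k) + 1) := Finset.sum_le_card_nsmul _ _ _ k2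
        have h2 : C.card • (4 * (e * P.k) + 1) ≤ P.k * (4 * (e * P.k) + 1) :=
          Nat.mul_le_mul_right _ hcard
        rw [hT, mul_assoc]
        omega }
  obtain ⟨g, hg, h⟩ := hcls.exists_guess
  exact ⟨s, hsn, g, hg, fun X r' hp => ⟨(h X r' hp).1, (h X r' hp).2.trans k3⟩⟩

end Par

end Structured

namespace RAM

/-! ### Randomized runs -/

/-- `run` appends steps at the end, whereas outcomes are composed by splitting off the first step.
-/
theorem run_succ_left (M : Program) (s : State) (t : ℕ) :
    run M s (t + 1) = (step M s).bind (fun s' => run M s' t) := by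
  induction t with
  | zero => simp [run, PMF.pure_bind]
  | succ t ih =>
    rw [run, ih, PMF.bind_bind]
    rfl

/-- All words in the runs from `s` are at most `W`, the runs halt after at most `B` steps, and the
probability that the final state is not in `A` is at most `φ`. -/
structure Outcome (M : Program) (W : ℕ) (A : Set State) (s : State) (B : ℕ) (φ : ENNReal) :
    Prop where
  bdd : ∀ t, ∀ s' ∈ (run M s t).support, Bdd W s'
  halted : ∀ t, B ≤ t → ∀ s' ∈ (run M s t).support, Halted M s'
  prob : ∀ t, B ≤ t → (run M s t).toOuterMeasure Aᶜ ≤ φ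

variable {M : Program} {W : ℕ} {A : Set State}

theorem Outcome.mono {s : State} {B B' : ℕ} {φ φ' : ENNReal} (h : Outcome M W A s B φ)
    (hB : B ≤ B') (hφ : φ ≤ φ') : Outcome M W A s B' φ' :=
  ⟨h.bdd, fun t ht => h.halted t (hB.trans ht), fun t ht => (h.prob t (hB.trans ht)).trans hφ⟩

/-- The alternative `1 ≤ φ` is for samples that miss some set: nothing is claimed about success, but
the run still has to halt with bounded words. -/
theorem Outcome.of_halted {s : State} (hs : Halted M s) (hb : Bdd W s) {φ : ENNReal}
    (hφ : s ∈ A ∨ 1 ≤ φ) : Outcome M W A s 0 φ := by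
  have hstep : step M s = PMF.pure s := by
    rcases hs with h | h
    · simp [step, h]
    · simp [step, h, exec]
  have hrun : ∀ t, run M s t = PMF.pure s := by
    intro t
    induction t with
    | zero => rfl
    | succ t ih => rw [run, ih, PMF.pure_bind, hstep]
  refine ⟨fun t s' h => ?_, fun t _ s' h => ?_, fun t _ => ?_⟩
  · rw [hrun, PMF.support_pure, Set.mem_singleton_iff] at h
    exact h ▸ hb
  · rw [hrun, PMF.support_pure, Set.mem_singleton_iff] at h
    exact h ▸ hs
  · rw [hrun, PMF.toOuterMeasure_pure_apply]
    rcases hφ with h | h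
    · simp [h]
    · split
      · exact h
      · exact zero_le

/-- The law of total probability for the first step; deterministic steps are the case of a point
mass. -/
theorem Outcome.of_step {s : State} {B : ℕ} {p : PMF ℕ} {f : ℕ → State} {φ : ℕ → ENNReal}
    (hs : step M s = p.map f) (hb : Bdd W s)
    (h : ∀ v ∈ p.support, Outcome M W A (f v) B (φ v)) :
    Outcome M W A s (B + 1) (∑' v, p v * φ v) := by
  have hrun : ∀ t, run M s (t + 1) = p.bind (fun v => run M (f v) t) := by
    intro t
    rw [run_succ_left, hs, PMF.bind_map]
    rfl
  refine ⟨fun t s' hs' => ?_, fun t ht s' hs' => ?_, fun t ht => ?_⟩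
  · cases t with
    | zero =>
      rw [run, PMF.support_pure, Set.mem_singleton_iff] at hs'
      exact hs' ▸ hb
    | succ t =>
      rw [hrun, PMF.mem_support_bind_iff] at hs'
      obtain ⟨v, hv, hs'⟩ := hs'
      exact (h v hv).bdd t s' hs'
  · obtain ⟨t, rfl⟩ : ∃ t', t = t' + 1 := ⟨t - 1, by omega⟩
    rw [hrun, PMF.mem_support_bind_iff] at hs'
    obtain ⟨v, hv, hs'⟩ := hs'
    exact (h v hv).halted t (by omega) s' hs'
  · obtain ⟨t, rfl⟩ : ∃ t', t = t' + 1 := ⟨t - 1, by omega⟩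
    rw [hrun, PMF.toOuterMeasure_bind_apply]
    refine ENNReal.tsum_le_tsum fun v => ?_
    by_cases hv : v ∈ p.support
    · gcongr
      exact (h v hv).prob t (by omega)
    · rw [PMF.mem_support_iff, not_not] at hv
      simp [hv]

theorem Outcome.of_run {s s' : State} {m B : ℕ} {φ : ENNReal} (hr : Run M W s m s') (hb : Bdd W s)
    (h : Outcome M W A s' B φ) : Outcome M W A s (B + m) φ := by
  induction m generalizing s with
  | zero => cases hr; exact h
  | succ m ih =>
    obtain ⟨s₁, h₁, h₂, h₃⟩ := hr
    have := Outcome.of_step (s := s) (p := PMF.pure 0) (f := fun _ => s₁) (φ := fun _ => φ)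
      (by rw [h₁, PMF.pure_map]) hb (fun _ _ => ih h₃ h₂)
    refine this.mono (by omega) ?_
    rw [ENNReal.tsum_mul_right, PMF.tsum_coe, one_mul]

theorem uniformBelow_apply {n : ℕ} (hn : 0 < n) (v : ℕ) :
    uniformBelow n v = if v < n then (n : ENNReal)⁻¹ else 0 := by
  rw [uniformBelow, dif_pos hn, PMF.uniformOfFinset_apply]
  simp

theorem Outcome.of_rand {s : State} {n B : ℕ} (hn : 0 < n) {f : ℕ → State} {φ : ℕ → ENNReal}
    (hs : step M s = (uniformBelow n).map f) (hb : Bdd W s)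
    (h : ∀ v < n, Outcome M W A (f v) B (φ v)) :
    Outcome M W A s (B + 1) ((n : ENNReal)⁻¹ * ∑ v ∈ Finset.range n, φ v) := by
  have := Outcome.of_step (φ := φ) hs hb fun v hv => h v (by
    rw [PMF.mem_support_iff, uniformBelow_apply hn] at hv
    by_contra hlt
    simp [hlt] at hv)
  refine this.mono le_rfl (le_of_eq ?_)
  rw [tsum_eq_sum (s := Finset.range n), Finset.mul_sum]
  · refine Finset.sum_congr rfl fun v hv => ?_
    rw [uniformBelow_apply hn, if_pos (Finset.mem_range.mp hv)]
  · intro v hv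
    rw [uniformBelow_apply hn, if_neg (by simpa using hv), zero_mul]

/-- A bound on the probability that `j` further samples miss one of the sets in `F` that have not
been hit. -/
def missBound (F : Finset (Finset ℕ)) (β : ENNReal) (m j : ℕ) (R : ℕ → ℕ) : ENNReal :=
  open scoped Classical in ∑ _ ∈ F.filter (fun S => ∀ i < j, R i ∉ S), β ^ (m - j)

/-- A set that has not been hit so far is missed by the next sample with probability at most `β`,
and this is the factor by which its term changes. So the bound does not increase on average. -/
theorem missBound_step {F : Finset (Finset ℕ)} {β : ENNReal} {n m j : ℕ}
    (hj : j < m) {R : ℕ → ℕ}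
    (hF : ∀ S ∈ F, (n : ENNReal)⁻¹ * ((Finset.range n).filter (fun v => v ∉ S)).card ≤ β) :
    (n : ENNReal)⁻¹ * ∑ v ∈ Finset.range n, missBound F β m (j + 1) (Function.update R j v) ≤
      missBound F β m j R := by
  classical
  have h1 : ∀ v, missBound F β m (j + 1) (Function.update R j v) =
      ∑ S ∈ F.filter (fun S => ∀ i < j, R i ∉ S), if v ∉ S then β ^ (m - (j + 1)) else 0 := by
    intro v
    rw [missBound, ← Finset.sum_filter, Finset.filter_filter]
    refine Finset.sum_congr (Finset.filter_congr fun S hS => ?_) fun _ _ => rfl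
    constructor
    · intro h
      refine ⟨fun i hi => ?_, ?_⟩
      · have := h i (by omega)
        rwa [Function.update_of_ne hi.ne] at this
      · have := h j (by omega)
        rwa [Function.update_self] at this
    · rintro ⟨h1, h2⟩ i hi
      rcases (show i < j ∨ i = j by omega) with hi | rfl
      · rw [Function.update_of_ne hi.ne]; exact h1 i hi
      · rwa [Function.update_self]
  simp only [h1]
  rw [Finset.sum_comm, Finset.mul_sum, missBound]
  refine Finset.sum_le_sum fun S hS => ?_
  have := hF S (Finset.mem_filter.mp hS).1
  rw [← Finset.sum_filter, Finset.sum_const, nsmul_eq_mul, ← mul_assoc]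
  obtain ⟨l, hl⟩ : ∃ l, m - j = l + 1 := ⟨m - j - 1, by omega⟩
  rw [show m - (j + 1) = l by omega, hl, pow_succ']
  gcongr

end RAM

/-! ### The drawing of the sample. -/

namespace Structured

open RAM

/-- The store represented by a state. -/
def ofState (s : State) : Store where
  v := s.word
  rv := s.real
  A := fun a i => s.wordMem (wad (s.word 0) a i)
  B := fun a i => s.realMem (rad (s.word 0) a i)

theorem rel_ofState (s : State) : Rel (ofState s) s :=
  ⟨fun _ _ => rfl, fun _ _ => rfl, fun _ _ _ _ => rfl, fun _ _ _ _ => rfl⟩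

/-- Code that draws the sample; `v 3` is the size of the sample. -/
def sampleCode (b : ℕ) : List Instr :=
  let l := (Cmd.put 1 (.v 9) (.v 16)).code (b + 3)
  let l' := (Cmd.set 9 ((E.v 9).add (.c 1))).code (b + 3 + l.length)
  [.jumpLt 9 3 (b + 2), .jump (b + 3 + l.length + l'.length + 1), .rand 16 0] ++
    (l ++ (l' ++ [.jump b]))

/-- The store after the sample `v` has been drawn. -/
def drawn (σ : Store) (j v : ℕ) : Store := ((σ.setV 16 v).setA 1 j v).setV 9 (j + 1)

/-- The store after `j` samples. -/
structure Sampling (σ₁ : Store) (j : ℕ) (R : ℕ → ℕ) (σ : Store) : Prop where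
  v : ∀ x, x ≠ 9 → x ≠ 16 → σ.v x = σ₁.v x
  v9 : σ.v 9 = j
  v16 : σ.v 16 ≤ σ.v 0
  B : σ.B = σ₁.B
  A : ∀ a, a ≠ 1 → σ.A a = σ₁.A a
  A1 : ∀ i, σ.A 1 i = if i < j then R i else σ₁.A 1 i
  R : ∀ i < j, R i < σ₁.v 0

theorem Sampling.drawn {σ₁ σ : Store} {j v : ℕ} {R : ℕ → ℕ} (h : Sampling σ₁ j R σ)
    (hv : v < σ₁.v 0) : Sampling σ₁ (j + 1) (Function.update R j v) (drawn σ j v) := by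
  have hb : ∀ i, i < j + 1 → i < j ∨ i = j := fun i hi => by omega
  refine ⟨fun x h1 h2 => ?_, by simp [Structured.drawn], ?_, h.B, fun a ha => ?_, fun i => ?_,
    fun i hi => ?_⟩
  · simp [Structured.drawn, h1, h2, h.v x h1 h2]
  · have := h.v 0 (by omega) (by omega)
    simp [Structured.drawn, this, hv.le]
  · funext i; simp [Structured.drawn, ha, h.A a ha]
  · by_cases hij : i = j
    · subst hij; simp [Structured.drawn]
    · have : (i < j + 1) ↔ i < j := by omega
      simp [Structured.drawn, hij, h.A1 i, this]
  · rcases hb i hi with hi | rfl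
    · rw [Function.update_of_ne hi.ne]; exact h.R i hi
    · simpa using hv

/-- The summand `3` stands for the test, the draw and the jump back. The lengths of the two pieces
of code do not depend on their position. -/
def drawSteps : ℕ :=
  ((Cmd.put 1 (.v 9) (.v 16)).code 0).length + ((Cmd.set 9 ((E.v 9).add (.c 1))).code 0).length + 3

/-- By induction on the number of samples that are still to be drawn; the failure probability at
each stage is bounded by `missBound` for the samples drawn so far. The two extra steps leave the
loop. -/
theorem sample_outcome {M : Program} {W : ℕ} {A : Set State} {b B m : ℕ} {σ₁ : Store}
    {F : Finset (Finset ℕ)} {β : ENNReal} (hc : CodeAt M b (sampleCode b)) (hn : 0 < σ₁.v 0)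
    (hm : σ₁.v 3 = m) (hW : 2 * σ₁.v 0 + 16 * m + 16 ≤ W)
    (hF : ∀ S ∈ F, (σ₁.v 0 : ENNReal)⁻¹ * ((Finset.range (σ₁.v 0)).filter (fun v => v ∉ S)).card ≤ β)
    (hend : ∀ R σ s, Sampling σ₁ m R σ → Rel σ s → Bdd W s → s.pc = b + (sampleCode b).length →
      Outcome M W A s B (missBound F β m m R)) {j : ℕ} (hj : j ≤ m) {R : ℕ → ℕ} {σ : Store}
    {s : State} (hσ : Sampling σ₁ j R σ) (hr : Rel σ s) (hb : Bdd W s) (hpc : s.pc = b) :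
    Outcome M W A s (B + 2 + (m - j) * drawSteps) (missBound F β m j R) := by
  induction hd : m - j generalizing j R σ s with
  | zero =>
    obtain rfl : j = m := by omega
    have e9 : s.word 9 = j := by rw [hr.word 9 (by omega), hσ.v9]
    have e3 : s.word 3 = j := by
      rw [hr.word 3 (by omega), hσ.v 3 (by omega) (by omega), hm]
    have hs₁ : step M s = PMF.pure s.next := by
      rw [step_of_get (hpc ▸ hc.get), exec, if_neg (by omega)]
    have hlen : (sampleCode b).length = ((Cmd.put 1 (.v 9) (.v 16)).code (b + 3)).length +
        ((Cmd.set 9 ((E.v 9).add (.c 1))).code (b + 3 +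
          ((Cmd.put 1 (.v 9) (.v 16)).code (b + 3)).length)).length + 4 := by
      simp [sampleCode]; omega
    have hs₂ : step M s.next = PMF.pure { s.next with pc := b + (sampleCode b).length } := by
      rw [step_of_get (i := .jump (b + (sampleCode b).length))]
      · rfl
      · have : s.next.pc = b + 1 := by simp [State.next, hpc]
        rw [this, hc.tail.get, hlen]
        congr 2
    have hrun : Run M W s 2 { s.next with pc := b + (sampleCode b).length } :=
      ⟨_, hs₁, hb, _, hs₂, hb, rfl⟩
    exact (Outcome.of_run hrun hb
      (hend R σ _ hσ ((hr.setPc (s.pc + 1)).setPc _) hb rfl)).mono (by omega) le_rfl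
  | succ d ih =>
    have e9 : s.word 9 = j := by rw [hr.word 9 (by omega), hσ.v9]
    have e3 : s.word 3 = m := by
      rw [hr.word 3 (by omega), hσ.v 3 (by omega) (by omega), hm]
    have v0 : σ.v 0 = σ₁.v 0 := hσ.v 0 (by omega) (by omega)
    have e0 : s.word 0 = σ₁.v 0 := by rw [hr.word 0 (by omega), v0]
    have hs₁ : step M s = PMF.pure { s with pc := b + 2 } := by
      rw [step_of_get (hpc ▸ hc.get), exec, if_pos (by omega), hpc]
    set s₁ : State := { s with pc := b + 2 } with hs₁'
    have hs₂ : step M s₁ = (uniformBelow (σ₁.v 0)).map (fun v => (s₁.setWord 16 v).next) := by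
      rw [step_of_get (i := .rand 16 0)]
      · show (uniformBelow (s₁.word 0)).map _ = _
        rw [← e0]
      · exact hc.tail.tail.get
    have hrun : Run M W s 1 s₁ := Run.of_step hs₁ hb
    have hc' : CodeAt M (b + 3) ((Cmd.put 1 (.v 9) (.v 16)).code (b + 3) ++
        ((Cmd.set 9 ((E.v 9).add (.c 1))).code (b + 3 +
          ((Cmd.put 1 (.v 9) (.v 16)).code (b + 3)).length) ++ [.jump b])) := hc.tail.tail.tail
    -- Two of the steps of this iteration, the test and the draw, lie before these states.
    have key : ∀ v < σ₁.v 0, Outcome M W A (s₁.setWord 16 v).next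
        (B + 2 + d * drawSteps + (drawSteps - 2)) (missBound F β m (j + 1) (Function.update R j v)) := by
      intro v hv
      have hb₂ : Bdd W (s₁.setWord 16 v).next := Bdd.setWord (s := s₁) hb 16 (by omega)
      have hr₂ : Rel (σ.setV 16 v) (s₁.setWord 16 v).next :=
        Rel.setV (s := s₁) (hr.setPc (b + 2)) (by omega) v
      obtain ⟨s₃, p1, p2, p3, -⟩ := Cmd.code_spec (W := W) (Cmd.put 1 (.v 9) (.v 16)) (b + 3) _ _
        hc'.left rfl hr₂ hb₂ (by simpa [v0] using hn) (by
          simp [Cmd.Ok, E.Ok, E.ev, v0, hσ.v9]; omega)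
      have hb₃ := p1.bdd hb₂
      obtain ⟨s₄, q1, q2, q3, -⟩ := Cmd.code_spec (W := W) (Cmd.set 9 ((E.v 9).add (.c 1))) _ s₃ _
        hc'.right.left p2 p3 hb₃ (by simpa [Cmd.eval, v0] using hn) (by
          simp [Cmd.Ok, E.Ok, E.ev, Cmd.eval, WordOp.eval, v0, hσ.v9]; omega)
      have hb₄ := q1.bdd hb₃
      have hs₅ : step M s₄ = PMF.pure { s₄ with pc := b } := by
        rw [step_of_get (q2 ▸ hc'.right.right.get)]
        rfl
      have hrun' := (p1.trans q1).trans (Run.of_step (W := W) hs₅ hb₄)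
      have hst : (Cmd.put 1 (.v 9) (.v 16)).eval (σ.setV 16 v) = ((σ.setV 16 v).setA 1 j v) := by
        simp [Cmd.eval, E.ev, wix, hσ.v9]
      have hst' : (Cmd.set 9 ((E.v 9).add (.c 1))).eval ((Cmd.put 1 (.v 9) (.v 16)).eval
          (σ.setV 16 v)) = drawn σ j v := by
        rw [hst]
        simp [Cmd.eval, E.ev, WordOp.eval, Structured.drawn, hσ.v9]
      rw [hst'] at q3
      have := ih (j := j + 1) (by omega) (hσ.drawn hv) (s := { s₄ with pc := b }) (q3.setPc b)
        hb₄ rfl (by omega)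
      refine (Outcome.of_run hrun' hb₂ this).mono (le_of_eq ?_) le_rfl
      have e1 : (Cmd.put 1 (.v 9) (.v 16)).steps (σ.setV 16 v) +
          (Cmd.set 9 ((E.v 9).add (.c 1))).steps ((Cmd.put 1 (.v 9) (.v 16)).eval (σ.setV 16 v)) + 1 =
          drawSteps - 2 := by
        simp [Cmd.steps, drawSteps, Cmd.code]
        omega
      omega
    have := Outcome.of_run hrun hb (Outcome.of_rand hn hs₂ hb key)
    refine this.mono ?_ (missBound_step (by omega) hF)
    have : 2 ≤ drawSteps := by simp [drawSteps]
    rw [Nat.succ_mul]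
    omega

end Structured

/-! ### The parameters and the setup of the constants. -/

namespace Structured

open RAM Cmd

/-- The parameters of the program, where the scale is divided into `e * k` units. -/
def mkPar (n k U e : ℕ) (R : ℕ → ℕ) (dd : ℕ → ℕ → ℝ) : Par where
  n := n
  k := k
  U := U
  m := 12 * k * k * k
  T := 4 * k * (4 * (e * k) + 1) + 1
  u := e * k
  R := R
  dd := dd

/-- The number of guesses. -/
def guesses (k e : ℕ) : ℕ :=
  (k + 1) * ((12 * k * k * k + 1) * (4 * k * (4 * (e * k) + 1) + 1)) ^ k

namespace Prog

def setup (e : ℕ) : Cmd := seq (prologue e) (set 9 (.c 0))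

def setupLoop : Cmd := loop 9 1 (set 6 ((E.v 6).mul ((E.v 4).mul (.v 5))))

/-- The store after the straight part of the setup. -/
def constants (k U e : ℕ) (σ : Store) : Store :=
  ((((((σ.setV 2 U).setV 3 (12 * k * k * k)).setV 4 (12 * k * k * k + 1)).setV 8 (e * k)).setV 5
    (4 * k * (4 * (e * k) + 1) + 1)).setV 7 (k + 1)).setV 6 (k + 1)

theorem iter_setup (k U e : ℕ) (σ : Store) (i : ℕ) :
    (iter (set 6 ((E.v 6).mul ((E.v 4).mul (.v 5)))).eval 9 (constants k U e σ) i).v 6 =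
      (k + 1) * ((12 * k * k * k + 1) * (4 * k * (4 * (e * k) + 1) + 1)) ^ i := by
  induction i with
  | zero => simp [iter, constants]
  | succ i ih =>
    have h4 := Cmd.iter_v (c := set 6 ((E.v 6).mul ((E.v 4).mul (.v 5)))) (x := 9) (y := 4)
      (constants k U e σ) (by omega) (by decide) i
    have h5 := Cmd.iter_v (c := set 6 ((E.v 6).mul ((E.v 4).mul (.v 5)))) (x := 9) (y := 5)
      (constants k U e σ) (by omega) (by decide) i
    rw [iter]
    generalize iter (set 6 ((E.v 6).mul ((E.v 4).mul (.v 5)))).eval 9 (constants k U e σ) i = τ at *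
    have e4 : (constants k U e σ).v 4 = 12 * k * k * k + 1 := by simp [constants]
    have e5 : (constants k U e σ).v 5 = 4 * k * (4 * (e * k) + 1) + 1 := by simp [constants]
    simp only [eval, E.ev, WordOp.eval, Store.setV_v]
    norm_num
    rw [ih, h4, h5, e4, e5]
    ring

/-- All intermediate values are at most a factor or a partial product of the number of guesses, so
apart from the addresses the number of guesses bounds them all. -/
theorem setup_spec {σ : Store} {n k U e W : ℕ} (hn : σ.v 0 = n) (hn1 : 1 ≤ n) (h1 : σ.v 1 = k)
    (hk : 1 ≤ k) (he : 1 ≤ e) (hA : σ.A 0 0 = U) (hW : 64 * (n + U + guesses k e) ≤ W) :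
    (setup e).Ok W σ ∧ (setup e).steps σ ≤ 200 * (k + 1) ∧
    ((setup e).eval σ).v 6 = guesses k e ∧
    (∀ x, x ≠ 6 → x ≠ 9 → ((setup e).eval σ).v x = (constants k U e σ).v x) ∧
    ((setup e).eval σ).v 9 = 0 ∧ ((setup e).eval σ).A = σ.A ∧ ((setup e).eval σ).B = σ.B := by
  have hpow : ∀ i ≤ k, (k + 1) * ((12 * k * k * k + 1) * (4 * k * (4 * (e * k) + 1) + 1)) ^ i ≤
      guesses k e := fun i hi => Nat.mul_le_mul_left _ (Nat.pow_le_pow_right (by positivity) hi)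
  have p1 := hpow 1 hk
  rw [pow_one] at p1
  set m := 12 * k * k * k with hm
  set T := 4 * k * (4 * (e * k) + 1) + 1 with hT
  have hT0 : 1 ≤ T := by omega
  have hmT : (m + 1) * T ≤ guesses k e := (Nat.le_mul_of_pos_left _ (by omega)).trans p1
  have hm1 : m + 1 ≤ guesses k e := (Nat.le_mul_of_pos_right _ hT0).trans hmT
  have hT1 : T ≤ guesses k e := (Nat.le_mul_of_pos_left _ (by omega)).trans hmT
  have hk1 : k + 1 ≤ guesses k e := (Nat.le_mul_of_pos_right _ (by positivity)).trans p1
  have b2 : 12 * k * k ≤ m := Nat.le_mul_of_pos_right _ hk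
  have b1 : 12 * k ≤ m := (Nat.le_mul_of_pos_right _ hk).trans b2
  have b3 : 4 * k * (4 * (e * k) + 1) < T := by omega
  have b4 : 4 * (e * k) + 1 < T := (Nat.le_mul_of_pos_left _ (by omega)).trans_lt b3
  have b5 : 4 * k < T := (Nat.le_mul_of_pos_right _ (by omega)).trans_lt b3
  have b6 : e ≤ e * k := Nat.le_mul_of_pos_right _ hk
  have hX : (set 6 (E.v 7)).eval ((set 7 ((E.v 1).add (.c 1))).eval ((set 5 ((((E.c 4).mul (.v 1)).mul
    (((E.c 4).mul (.v 8)).add (.c 1))).add (.c 1))).eval ((set 8 ((E.c e).mul (.v 1))).eval ((set 4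
    ((E.v 3).add (.c 1))).eval ((set 3 ((((E.c 12).mul (.v 1)).mul (.v 1)).mul (.v 1))).eval
    ((set 2 (.arr 0 (.c 0))).eval σ)))))) = constants k U e σ := by
    simp [eval, E.ev, WordOp.eval, h1, hA, wix, constants, ← hm, hn]
  have hs : (prologue e).eval σ = setupLoop.eval (constants k U e σ) := by
    rw [← hX]; rfl
  have c0 : (constants k U e σ).v 0 = n := by simp [constants, hn]
  have c1 : (constants k U e σ).v 1 = k := by simp [constants, h1]
  have hagree := eval_agree setupLoop (constants k U e σ)
  have hlast : setupLoop.Ok W (constants k U e σ) := by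
    refine ⟨by decide, by decide, by decide, by decide, by decide, by decide, by omega,
      fun i hi => ?_⟩
    rw [c1] at hi
    have h4 := Cmd.iter_v (c := set 6 ((E.v 6).mul ((E.v 4).mul (.v 5)))) (x := 9) (y := 4)
      (constants k U e σ) (by omega) (by decide) i
    have h5 := Cmd.iter_v (c := set 6 ((E.v 6).mul ((E.v 4).mul (.v 5)))) (x := 9) (y := 5)
      (constants k U e σ) (by omega) (by decide) i
    have h6 := iter_setup k U e σ i
    rw [← hm, ← hT] at h6
    generalize iter (set 6 ((E.v 6).mul ((E.v 4).mul (.v 5)))).eval 9 (constants k U e σ) i = τ at *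
    have e4 : (constants k U e σ).v 4 = m + 1 := by simp [constants, hm]
    have e5 : (constants k U e σ).v 5 = T := by simp [constants, hT]
    have := hpow (i + 1) hi
    simp only [Ok, E.Ok, E.ev, WordOp.eval, Store.setV_v]
    norm_num
    rw [h6, h4, h5, e4, e5, mul_assoc, ← pow_succ]
    omega
  have hsteps : setupLoop.steps (constants k U e σ) ≤ 50 * k + 3 := by
    simp only [setupLoop, steps, c1, Finset.sum_const, Finset.card_range, smul_eq_mul]
    simp [E.code]
    omega
  refine ⟨?_, ?_, ?_, ?_, ?_, ?_, ?_⟩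
  · refine ⟨?_, by decide, by decide, Nat.zero_le _⟩
    simp only [prologue, Ok]
    refine ⟨?_, ?_, ?_, ?_, ?_, ?_, ?_, ?_⟩
    · simp [E.Ok, E.ev, hn]; omega
    · simp [E.Ok, E.ev, eval, WordOp.eval, h1, ← hm]; omega
    · simp [E.Ok, E.ev, eval, WordOp.eval, h1, ← hm]; omega
    · simp [E.Ok, E.ev, eval, WordOp.eval, h1, ← hm]; omega
    · simp [E.Ok, E.ev, eval, WordOp.eval, h1, ← hm]; omega
    · simp [E.Ok, E.ev, eval, WordOp.eval, h1, ← hm]; omega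
    · simp [E.Ok]
    · rw [← hX] at hlast
      exact hlast
  · have hst : (setup e).steps σ ≤ 140 + setupLoop.steps (constants k U e σ) := by
      rw [← hX, show (setup e).steps σ = (set 2 (.arr 0 (.c 0))).steps σ +
        ((set 3 ((((E.c 12).mul (.v 1)).mul (.v 1)).mul (.v 1))).steps σ +
        ((set 4 ((E.v 3).add (.c 1))).steps σ + ((set 8 ((E.c e).mul (.v 1))).steps σ +
        ((set 5 ((((E.c 4).mul (.v 1)).mul (((E.c 4).mul (.v 8)).add (.c 1))).add (.c 1))).steps σ +
        ((set 7 ((E.v 1).add (.c 1))).steps σ + ((set 6 (E.v 7)).steps σ + setupLoop.steps (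
        (set 6 (E.v 7)).eval ((set 7 ((E.v 1).add (.c 1))).eval ((set 5 ((((E.c 4).mul (.v 1)).mul
    (((E.c 4).mul (.v 8)).add (.c 1))).add (.c 1))).eval ((set 8 ((E.c e).mul (.v 1))).eval ((set 4
    ((E.v 3).add (.c 1))).eval ((set 3 ((((E.c 12).mul (.v 1)).mul (.v 1)).mul (.v 1))).eval
    ((set 2 (.arr 0 (.c 0))).eval σ))))))))))))) +
        (set 9 (.c 0)).steps σ from rfl]
      simp [steps, E.code, E.addrCode]
      omega
    omega
  · have : ((setup e).eval σ).v 6 = ((prologue e).eval σ).v 6 := by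
      simp [setup, eval, E.ev]
    rw [this, hs, setupLoop, eval, c1, Store.setV_v, if_neg (by omega), iter_setup k U e σ]
    rfl
  · intro x h6 h9
    have : ((setup e).eval σ).v x = ((prologue e).eval σ).v x := by
      simp [setup, eval, E.ev, h9]
    rw [this, hs]
    refine hagree.v x ?_
    simp [setupLoop, modV, Ne.symm h6, Ne.symm h9]
  · simp [setup, eval, E.ev]
  · have : ((setup e).eval σ).A = ((prologue e).eval σ).A := by simp [setup, eval, E.ev]
    rw [this, hs]
    funext a
    exact hagree.A a rfl
  · have : ((setup e).eval σ).B = ((prologue e).eval σ).B := by simp [setup, eval, E.ev]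
    rw [this, hs]
    funext a
    exact hagree.B a rfl

end Prog

end Structured

/-! ### The outcome of the whole program. -/

namespace Structured

open RAM Cmd

theorem guess_bounds {k e : ℕ} (hk : 1 ≤ k) :
    k + 1 ≤ guesses k e ∧ 12 * k * k * k + 1 ≤ guesses k e ∧
      4 * k * (4 * (e * k) + 1) + 1 ≤ guesses k e := by
  have p1 : (k + 1) * ((12 * k * k * k + 1) * (4 * k * (4 * (e * k) + 1) + 1)) ≤ guesses k e :=
    Nat.mul_le_mul_left _ (Nat.le_self_pow (by omega) _)
  set m := 12 * k * k * k
  set T := 4 * k * (4 * (e * k) + 1) + 1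
  have hmT : (m + 1) * T ≤ guesses k e := (Nat.le_mul_of_pos_left _ (by omega)).trans p1
  exact ⟨(Nat.le_mul_of_pos_right _ (by positivity)).trans p1,
    (Nat.le_mul_of_pos_right _ (by omega)).trans hmT,
    (Nat.le_mul_of_pos_left _ (by omega)).trans hmT⟩

/-- When all samples have been drawn, every set that was missed contributes `β ^ 0 = 1`. -/
theorem missBound_hit {F : Finset (Finset ℕ)} {β : ENNReal} {m : ℕ} {R : ℕ → ℕ} :
    (∀ S ∈ F, ∃ i < m, R i ∈ S) ∨ 1 ≤ missBound F β m m R := by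
  classical
  by_contra! h
  obtain ⟨⟨S, hS, h1⟩, h2⟩ := h
  refine h2.not_ge ?_
  rw [missBound]
  have := Finset.single_le_sum (f := fun _ : Finset ℕ => β ^ (m - m)) (fun _ _ => zero_le)
    (Finset.mem_filter (p := fun S : Finset ℕ => ∀ i < m, R i ∉ S).mpr ⟨hS, h1⟩)
  simpa using this

namespace Prog

/-- The program that divides the scale into `e * k` units. -/
def program (e : ℕ) : Program :=
  let l := (setup e).code 0
  let l' := sampleCode l.length
  l ++ (l' ++ (main.code (l.length + l'.length) ++ [.halt]))

/-- A bound on the number of steps of the program. -/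
def timeBound (n k e : ℕ) : ℕ :=
  2000 * (n ^ 3 * (k + 1) ^ 2 * guesses k e) + 2 + 12 * k * k * k * drawSteps + 200 * (k + 1)

/-- Success is required only if the sample hits every set in `F`; for the other samples the failure
bound is at least `1`. Time and word bounds hold for every sample. -/
theorem program_outcome {A : Set State} {F : Finset (Finset ℕ)} {β : ENNReal} {s : State}
    {n k U e : ℕ} {dd : ℕ → ℕ → ℝ} (hpc : s.pc = 0) (h0 : s.word 0 = n) (h1 : s.word 1 = k)
    (hw : ∀ x, 2 ≤ x → s.word x = 0) (hM0 : s.wordMem 0 = U) (hM : ∀ a, s.wordMem a ≤ U)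
    (hdd : ∀ i < n, ∀ j < n, s.realMem (i * n + j) = dd i j) (hn : 1 ≤ n) (hk : 1 ≤ k) (he : 1 ≤ e)
    (hF : ∀ S ∈ F, (n : ENNReal)⁻¹ * ((Finset.range n).filter (fun v => v ∉ S)).card ≤ β)
    (hA : ∀ R : ℕ → ℕ, (∀ i < 12 * k * k * k, R i < n) →
      (∀ S ∈ F, ∃ i < 12 * k * k * k, R i ∈ S) → ∀ σ, Fits (mkPar n k U e R dd) σ → σ.v 24 = 0 →
      ∀ s', Rel (main.eval σ) s' → s' ∈ A) :
    Outcome (program e) (64 * (n + U + guesses k e) ^ 3) A s (timeBound n k e)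
      (missBound F β (12 * k * k * k) 0 (fun _ => 0)) := by
  obtain ⟨g1, g2, g3⟩ := guess_bounds (e := e) hk
  have g4 : e * k ≤ 4 * k * (4 * (e * k) + 1) + 1 := by
    have : 1 * (4 * (e * k) + 1) ≤ 4 * k * (4 * (e * k) + 1) := Nat.mul_le_mul_right _ (by omega)
    omega
  set G := guesses k e with hG
  set m := 12 * k * k * k with hm
  set Z := n + U + G with hZ
  have hZ2 : 2 ≤ Z := by omega
  have hZ3 : Z ≤ Z ^ 3 := Nat.le_self_pow (by omega) _
  have hb : Bdd (64 * Z ^ 3) s := by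
    intro a
    refine ⟨?_, (hM a).trans (by omega)⟩
    rcases (show a = 0 ∨ a = 1 ∨ 2 ≤ a by omega) with rfl | rfl | h
    · omega
    · omega
    · rw [hw a h]; exact Nat.zero_le _
  have hv0 : (ofState s).v 0 = n := h0
  have c1 : CodeAt (program e) 0 ((setup e).code 0 ++ (sampleCode ((setup e).code 0).length ++
      (main.code (((setup e).code 0).length + (sampleCode ((setup e).code 0).length).length) ++
        [.halt]))) := ⟨[], [], by simp [program], rfl⟩
  have c2 := c1.right
  rw [zero_add] at c2
  have c3 := c2.right
  obtain ⟨o1, o2, o3, o4, o5, o6, o7⟩ := setup_spec (σ := ofState s) (W := 64 * Z ^ 3) hv0 hn h1 hk he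
    (show s.wordMem (wad _ 0 0) = U by simpa [wad] using hM0) (by omega)
  obtain ⟨s₁, r1, r2, r3, r4⟩ := Cmd.code_spec (setup e) 0 s (ofState s) c1.left hpc
    (rel_ofState s) hb (by rw [hv0]; exact hn) o1
  rw [zero_add] at r2
  set σ₁ := (setup e).eval (ofState s) with hσ₁
  have w0 : σ₁.v 0 = n := r4.trans hv0
  have w1 : σ₁.v 1 = k := by
    rw [o4 1 (by omega) (by omega)]
    exact (show (constants k U e (ofState s)).v 1 = (ofState s).v 1 by simp [constants]).trans h1
  have w2 : σ₁.v 2 = U := by rw [o4 2 (by omega) (by omega)]; simp [constants]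
  have w3 : σ₁.v 3 = m := by rw [o4 3 (by omega) (by omega)]; simp [constants, hm]
  have w4 : σ₁.v 4 = m + 1 := by rw [o4 4 (by omega) (by omega)]; simp [constants, hm]
  have w5 : σ₁.v 5 = 4 * k * (4 * (e * k) + 1) + 1 := by
    rw [o4 5 (by omega) (by omega)]; simp [constants]
  have w7 : σ₁.v 7 = k + 1 := by rw [o4 7 (by omega) (by omega)]; simp [constants]
  have w8 : σ₁.v 8 = e * k := by rw [o4 8 (by omega) (by omega)]; simp [constants]
  have wx : ∀ x, 10 ≤ x → σ₁.v x = 0 := by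
    intro x hx
    have e1 : (ofState s).v x = 0 := hw x (by omega)
    rw [o4 x (by omega) (by omega)]
    simp only [constants, Store.setV_v]
    rw [if_neg, if_neg, if_neg, if_neg, if_neg, if_neg, if_neg, e1] <;> omega
  have hA0 : ∀ a i, σ₁.A a i ≤ U := by
    intro a i; rw [o6]; exact hM _
  have hsamp : Sampling σ₁ 0 (fun _ => 0) σ₁ :=
    ⟨fun _ _ _ => rfl, o5, by rw [wx 16 (by omega)]; exact Nat.zero_le _, rfl, fun _ _ => rfl,
      fun _ => rfl, fun i hi => absurd hi (by omega)⟩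
  have key : Outcome (program e) (64 * Z ^ 3) A s₁
      (2000 * (n ^ 3 * (k + 1) ^ 2 * G) + 2 + (m - 0) * drawSteps)
      (missBound F β m 0 (fun _ => 0)) := by
    refine sample_outcome c2.left (by omega) w3 (by omega) (by rw [w0]; exact hF) ?_ (Nat.zero_le _)
      hsamp r3 (r1.bdd hb) r2
    intro R σ s₂ hS hr hb₂ hpc₂
    have hRn : ∀ i < m, R i < n := fun i hi => w0 ▸ hS.R i hi
    have hfit : Fits (mkPar n k U e R dd) σ := by
      refine ⟨?_, ?_, ?_, ?_, ?_, ?_, ?_, ?_, ?_, fun i hi => ?_, fun i hi j hj => ?_⟩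
      · rw [hS.v _ (by omega) (by omega), w0]; rfl
      · rw [hS.v _ (by omega) (by omega), w1]; rfl
      · rw [hS.v _ (by omega) (by omega), w2]; rfl
      · rw [hS.v _ (by omega) (by omega), w3]; rfl
      · rw [hS.v _ (by omega) (by omega), w4]; rfl
      · rw [hS.v _ (by omega) (by omega), w5]; rfl
      · rw [hS.v _ (by omega) (by omega), o3]; rfl
      · rw [hS.v _ (by omega) (by omega), w7]; rfl
      · rw [hS.v _ (by omega) (by omega), w8]; rfl
      · exact (hS.A1 i).trans (if_pos (show i < m from hi))
      · rw [hS.B, o7]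
        exact hdd i hi j hj
    have h24 : σ.v 24 = 0 := by rw [hS.v _ (by omega) (by omega), wx 24 (by omega)]
    -- The bounds belong to the classes in `cls`; the sum `Z` of `n`, `U` and the number of guesses
    -- bounds all the rest.
    have hbnd : Bnd cls (fun i => if i = 1 then n else if i = 2 then k + 1 else if i = 3 then G
        else Z) σ := by
      refine ⟨fun x => ?_, fun a i => ?_⟩
      · by_cases h9 : x = 9
        · subst h9; rw [hS.v9]; simp [cls]; omega
        by_cases h16 : x = 16
        · subst h16
          have := hS.v16
          rw [hS.v 0 (by omega) (by omega), w0] at this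
          simp [cls]; omega
        rw [hS.v x h9 h16]
        by_cases hx : 10 ≤ x
        · rw [wx x hx]; exact Nat.zero_le _
        · have : x < 9 := by omega
          interval_cases x <;> simp [cls] <;> omega
      · simp only [if_neg (show ¬ (0 : ℕ) = 1 by omega), if_neg (show ¬ (0 : ℕ) = 2 by omega),
          if_neg (show ¬ (0 : ℕ) = 3 by omega)]
        by_cases ha : a = 1
        · subst ha
          rw [hS.A1]
          split
          · next h => have := hRn i h; omega
          · have := hA0 1 i; omega
        · rw [hS.A a ha]; have := hA0 a i; omega
    obtain ⟨-, k2, k3⟩ := chk_spec (fun i => by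
        show (if i = 1 then n else if i = 2 then k + 1 else if i = 3 then G else Z) ≤ Z
        split_ifs <;> omega)
      (by simpa using hZ2) main σ hbnd main_chk
    obtain ⟨s₃, t1, t2, t3, -⟩ := Cmd.code_spec main _ s₂ σ c3.left hpc₂ hr hb₂
      (by rw [hfit.h0]; exact hn) k2
    refine (Outcome.of_run t1 hb₂ (Outcome.of_halted (Or.inr ?_) (t1.bdd hb₂) ?_)).mono
      ((Nat.zero_add _).trans_le (k3.trans (main_time _ _ _ _ hn (by omega)))) le_rfl
    · rw [t2]; exact c3.right.get
    · exact missBound_hit.imp_left fun hit => hA R hRn hit σ hfit h24 s₃ t3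
  refine (Outcome.of_run r1 hb key).mono ?_ le_rfl
  rw [timeBound, ← hG, ← hm, Nat.sub_zero]
  omega

end Prog

end Structured

/-! ### Optimal assignments and their tight radii. -/

namespace CSRInstance

variable {X : Type*} [MetricSpace X] (I : CSRInstance X)

theorem d_nonneg (p q : Fin I.n) : 0 ≤ I.d p q := dist_nonneg

theorem d_comm (p q : Fin I.n) : I.d p q = I.d q p := dist_comm _ _

/-- The least radius of `q` that covers the points assigned to `q`. -/
def tightRadius (hn : 1 ≤ I.n) (μ : Fin I.n → Fin I.n) (q : Fin I.n) : ℝ :=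
  Finset.univ.sup' ⟨⟨0, hn⟩, Finset.mem_univ _⟩ (fun p => if μ p = q then I.d q p else 0)

theorem tightRadius_eq (hn : 1 ≤ I.n) (μ : Fin I.n → Fin I.n) (q : Fin I.n) :
    I.tightRadius hn μ q = 0 ∨ ∃ p, I.tightRadius hn μ q = I.d q p := by
  obtain ⟨p, -, h⟩ := Finset.exists_mem_eq_sup' (s := Finset.univ) ⟨⟨0, hn⟩, Finset.mem_univ _⟩
    (fun p => if μ p = q then I.d q p else 0)
  rw [tightRadius, h]
  split
  · exact Or.inr ⟨p, rfl⟩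
  · exact Or.inl rfl

theorem le_tightRadius (hn : 1 ≤ I.n) (μ : Fin I.n → Fin I.n) (p : Fin I.n) :
    I.d (μ p) p ≤ I.tightRadius hn μ (μ p) := by
  have := Finset.le_sup' (fun p' => if μ p' = μ p then I.d (μ p) p' else 0) (Finset.mem_univ p)
  simpa [tightRadius] using this

theorem tightRadius_le (hn : 1 ≤ I.n) {C : Finset (Fin I.n)} {r : Fin I.n → ℝ}
    {μ : Fin I.n → Fin I.n} (h : I.IsSolution C r μ) {q : Fin I.n} (hq : q ∈ C) :
    I.tightRadius hn μ q ≤ r q := by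
  refine Finset.sup'_le _ _ fun p _ => ?_
  split
  · next e => rw [d_comm, ← e]; exact h.dist_le p
  · exact h.radius_nonneg q hq

/-- A feasible instance has an optimal assignment, with tight radii. -/
theorem exists_optimal (hn : 1 ≤ I.n) (hf : I.Feasible) :
    ∃ μ : Fin I.n → Fin I.n, (Finset.univ.image μ).card ≤ I.k ∧
      (∀ q, (Finset.univ.filter (fun p => μ p = q)).card ≤ I.cap q) ∧
      ∑ q ∈ Finset.univ.image μ, I.tightRadius hn μ q ≤ I.opt := by
  classical
  have hsol : ∀ {C r μ}, I.IsSolution C r μ → ((Finset.univ.image μ).card ≤ I.k ∧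
      ∀ q, (Finset.univ.filter (fun p => μ p = q)).card ≤ I.cap q) ∧
      ∑ q ∈ Finset.univ.image μ, I.tightRadius hn μ q ≤ I.cost C r := by
    intro C r μ h
    have hsub : Finset.univ.image μ ⊆ C := by
      intro q hq
      obtain ⟨p, -, rfl⟩ := Finset.mem_image.mp hq
      exact h.assign_mem p
    refine ⟨⟨(Finset.card_le_card hsub).trans h.card_centers.le, fun q => ?_⟩, ?_⟩
    · by_cases hq : q ∈ C
      · exact h.load_le q hq
      · rw [Finset.filter_false_of_mem]
        · simp
        · rintro p - rfl
          exact hq (h.assign_mem p)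
    · exact (Finset.sum_le_sum fun q hq => I.tightRadius_le hn h (hsub hq)).trans
        (Finset.sum_le_sum_of_subset_of_nonneg hsub fun q hq _ => h.radius_nonneg q hq)
  obtain ⟨C₀, r₀, μ₀, h₀⟩ := hf
  -- Radii range over a continuum, but with tight radii only finitely many assignments compete, so
  -- the infimum is attained.
  obtain ⟨μ, hμ, hmin⟩ := Finset.exists_min_image (Finset.univ.filter (fun μ : Fin I.n → Fin I.n =>
      (Finset.univ.image μ).card ≤ I.k ∧
        ∀ q, (Finset.univ.filter (fun p => μ p = q)).card ≤ I.cap q))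
    (fun μ => ∑ q ∈ Finset.univ.image μ, I.tightRadius hn μ q)
    ⟨μ₀, Finset.mem_filter.mpr ⟨Finset.mem_univ _, (hsol h₀).1⟩⟩
  have hμ' := (Finset.mem_filter.mp hμ).2
  refine ⟨μ, hμ'.1, hμ'.2, le_csInf ⟨_, C₀, r₀, μ₀, h₀, rfl⟩ ?_⟩
  rintro c ⟨C, r, ν, h, rfl⟩
  exact (hmin ν (Finset.mem_filter.mpr ⟨Finset.mem_univ _, (hsol h).1⟩)).trans (hsol h).2

theorem k_le (hf : I.Feasible) : I.k ≤ I.n := by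
  obtain ⟨C, r, μ, h⟩ := hf
  rw [← h.card_centers]
  simpa using Finset.card_le_univ C

/-- The distance of the points with the numbers `i` and `j`. -/
def dn (hn : 1 ≤ I.n) (i j : ℕ) : ℝ :=
  dist (if h : i < I.n then I.pt ⟨i, h⟩ else I.pt ⟨0, hn⟩)
    (if h : j < I.n then I.pt ⟨j, h⟩ else I.pt ⟨0, hn⟩)

theorem dn_val (hn : 1 ≤ I.n) (p q : Fin I.n) : I.dn hn p q = I.d p q := by
  simp [dn, d]

end CSRInstance

theorem image_range_eq_map {n : ℕ} {f : ℕ → ℕ} {μ : Fin n → Fin n} (h : ∀ p : Fin n, f p = μ p) :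
    (Finset.range n).image f = (Finset.univ.image μ).map Fin.valEmbedding := by
  ext q
  simp only [Finset.mem_image, Finset.mem_range, Finset.mem_map, Finset.mem_univ, true_and,
    Fin.valEmbedding_apply, exists_exists_eq_and]
  constructor
  · rintro ⟨x, hx, rfl⟩
    exact ⟨⟨x, hx⟩, (h ⟨x, hx⟩).symm⟩
  · rintro ⟨p, rfl⟩
    exact ⟨p, p.2, h p⟩

theorem card_filter_range_eq {n : ℕ} {f : ℕ → ℕ} {μ : Fin n → Fin n} (h : ∀ p : Fin n, f p = μ p)
    (q : Fin n) : ((Finset.range n).filter (fun x => f x = q)).card =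
      (Finset.univ.filter (fun p => μ p = q)).card := by
  rw [← Finset.card_map Fin.valEmbedding]
  congr 1
  ext x
  simp only [Finset.mem_filter, Finset.mem_range, Finset.mem_map, Finset.mem_univ, true_and,
    Fin.valEmbedding_apply]
  constructor
  · rintro ⟨hx, e⟩
    exact ⟨⟨x, hx⟩, Fin.ext ((h ⟨x, hx⟩).symm.trans e), rfl⟩
  · rintro ⟨p, rfl, rfl⟩
    exact ⟨p.2, h p⟩

/-! ### From the final store to an approximate solution. -/

namespace Structured

open RAM Cmd

variable {X : Type*} [MetricSpace X] {I : CSRInstance X}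

/-- Every radius in the output is zero or the distance to an assigned point. Hence it is at most the
radius in the solution for `O`, vanishes at the centers without points, and is an integer if all
distances are. -/
theorem outputsApprox {U e : ℕ} {R : ℕ → ℕ} {O : ℕ → ℕ} {τ : Store} {s : State} {α : ℝ}
    (hU : I.UniformCap U) (hn : 1 ≤ I.n)
    (hS : (mkPar I.n I.k U e R (I.dn hn)).Sol O (α * I.opt))
    (hO : Prog.Output (mkPar I.n I.k U e R (I.dn hn)) O τ) (hr : Rel τ s) (h0 : τ.v 0 = I.n) :
    I.OutputsApprox α s := by
  obtain ⟨r, r0, hOr, hcard, hcost, hload⟩ := hS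
  obtain ⟨o1, o2, o3, o4, o5, o6⟩ := hO
  simp only [mkPar] at o1 o2 o3 o4 o5 o6 hOr hcard hcost hload
  have hw : ∀ i < 2 * I.n, s.wordMem i = τ.A 0 i := by
    intro i hi
    simpa [wad] using hr.mem 0 (by omega) i (fun _ => by rw [h0]; exact hi)
  have hreal : ∀ i < I.n, s.realMem i = τ.B 0 i := by
    intro i hi
    have : I.n ≤ I.n * I.n := Nat.le_mul_of_pos_left _ hn
    simpa [rad] using hr.rmem 0 (by omega) i (fun _ => by rw [h0]; omega)
  have hcen : ∀ q : Fin I.n, q ∈ I.outCenters s ↔ τ.A 0 q = 1 := by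
    intro q
    rw [CSRInstance.outCenters, Finset.mem_filter, hw q (by omega)]
    simp
  have hrad : ∀ q : Fin I.n, I.outRadius s q = τ.B 0 q := fun q => hreal q q.2
  set μ : Fin I.n → Fin I.n := fun p => ⟨O p, (hOr p p.2).1⟩ with hμ
  have hμO : ∀ p : Fin I.n, O p = μ p := fun p => rfl
  have hsub : Finset.univ.image μ ⊆ I.outCenters s := by
    intro q hq
    obtain ⟨p, -, rfl⟩ := Finset.mem_image.mp hq
    exact (hcen _).mpr (o3 p p.2)
  refine ⟨μ, fun p => ?_, ⟨?_, fun q _ => ?_, fun p => ?_, fun p => ?_, fun q _ => ?_⟩, ?_, ?_⟩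
  · rw [hw _ (by omega)]
    exact o2 p p.2
  · rw [← o1, ← Finset.card_map Fin.valEmbedding]
    congr 1
    ext x
    simp only [Prog.mem_ones, Finset.mem_map, hcen, Fin.valEmbedding_apply]
    constructor
    · rintro ⟨p, h, rfl⟩
      exact ⟨p.2, h⟩
    · rintro ⟨hx, h⟩
      exact ⟨⟨x, hx⟩, h, rfl⟩
  · rw [hrad]; exact o4 q q.2
  · exact hsub (Finset.mem_image_of_mem _ (Finset.mem_univ _))
  · rw [hrad, I.d_comm, ← I.dn_val hn]
    exact o5 p p.2
  · rw [hU q, ← card_filter_range_eq hμO]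
    exact hload q q.2
  · rw [CSRInstance.cost, ← Finset.sum_subset hsub]
    · rw [image_range_eq_map hμO, Finset.sum_map] at hcost
      refine (Finset.sum_le_sum fun q _ => ?_).trans hcost
      rw [hrad]
      rcases o6 q q.2 with h | ⟨x, hx, h, h'⟩
      · rw [h]; exact r0 _
      · rw [h']
        have := (hOr x hx).2
        rwa [h] at this
    · intro q _ hq
      rw [hrad]
      rcases o6 q q.2 with h | ⟨x, hx, h, h'⟩
      · exact h
      · exact absurd (Finset.mem_image.mpr ⟨⟨x, hx⟩, Finset.mem_univ _, Fin.ext h⟩) hq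
  · intro hint q _
    rw [hrad]
    rcases o6 q q.2 with h | ⟨x, hx, h, h'⟩
    · exact ⟨0, by simp [h]⟩
    · obtain ⟨m, hm⟩ := hint q ⟨x, hx⟩
      exact ⟨m, by rw [h', ← hm, ← I.dn_val hn]⟩

/-- If the sample is good for some optimal assignment, then the program is successful. -/
theorem outputsApprox_of_sampled {U e : ℕ} {ε : ℝ} {R : ℕ → ℕ} {σ : Store} {s : State}
    (hU : I.UniformCap U) (hn : 1 ≤ I.n) (hk : 1 ≤ I.k) (hf : I.Feasible) (he : 1 ≤ e)
    (hε : 8 / e ≤ ε) {μ : Fin I.n → Fin I.n} {cl : ℕ → ℕ} (hcl : ∀ p : Fin I.n, cl p = μ p)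
    (hcard : (Finset.univ.image μ).card ≤ I.k)
    (hload : ∀ q, (Finset.univ.filter (fun p => μ p = q)).card ≤ I.cap q)
    (hopt : ∑ q ∈ Finset.univ.image μ, I.tightRadius hn μ q ≤ I.opt)
    (hR : ∀ i < 12 * I.k * I.k * I.k, R i < I.n)
    (hs : (mkPar I.n I.k U e R (I.dn hn)).Sampled cl ((Finset.range I.n).image cl))
    (hfit : Fits (mkPar I.n I.k U e R (I.dn hn)) σ) (h24 : σ.v 24 = 0)
    (hr : Rel (Prog.main.eval σ) s) : I.OutputsApprox (4 + ε) s := by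
  set P := mkPar I.n I.k U e R (I.dn hn) with hP
  set r : ℕ → ℝ := fun q => if h : q < I.n then I.tightRadius hn μ ⟨q, h⟩ else 0 with hrdef
  have hrv : ∀ q : Fin I.n, r q = I.tightRadius hn μ q := fun q => by simp [hrdef]
  have hcl' : ∀ x (hx : x < I.n), cl x = μ ⟨x, hx⟩ := fun x hx => hcl ⟨x, hx⟩
  have hsum : ∑ q ∈ (Finset.range I.n).image cl, r q =
      ∑ q ∈ Finset.univ.image μ, I.tightRadius hn μ q := by
    rw [image_range_eq_map hcl, Finset.sum_map]
    exact Finset.sum_congr rfl fun q _ => hrv q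
  have hnonneg : ∀ q, 0 ≤ I.tightRadius hn μ q := by
    intro q
    rcases I.tightRadius_eq hn μ q with h | ⟨p, h⟩
    · exact h.ge
    · rw [h]; exact I.d_nonneg _ _
  obtain ⟨i, hi, g, hg, hgood⟩ := Par.exists_scale_guess (P := P) (e := e) (cl := cl) (r := r) he
    hn hk rfl rfl (fun x => dist_self _) (fun x y => dist_nonneg) (fun x y => dist_comm _ _)
    (fun x y z => dist_triangle _ _ _) hR
    (fun x hx => by rw [hcl' x hx]; exact (μ ⟨x, hx⟩).2)
    (by
      show ((Finset.range I.n).image cl).card ≤ _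
      rw [image_range_eq_map hcl, Finset.card_map]; exact hcard)
    (fun q hq => by
      rcases I.tightRadius_eq hn μ ⟨q, hq⟩ with h | ⟨p, h⟩
      · exact Or.inl ((hrv ⟨q, hq⟩).trans h)
      · exact Or.inr ⟨p, p.2, (hrv ⟨q, hq⟩).trans (h.trans (I.dn_val hn ⟨q, hq⟩ p).symm)⟩)
    (fun x hx => by
      rw [hcl' x hx, hrv]
      exact (I.dn_val hn _ ⟨x, hx⟩).trans_le (I.le_tightRadius hn μ ⟨x, hx⟩))
    (fun q hq => (card_filter_range_eq hcl ⟨q, hq⟩).trans_le ((hload _).trans (hU _).le))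
    hs
  obtain ⟨O, hS, hO⟩ := Prog.main_spec hfit hn (I.k_le hf) hR (fun x _ y _ => dist_nonneg) h24 hi hg
    hgood
  refine outputsApprox hU hn ?_ hO hr ?_
  · obtain ⟨r', h1, h2, h3, h4, h5⟩ := hS
    refine ⟨r', h1, h2, h3, h4.trans ?_, h5⟩
    rw [show P.n = I.n from rfl, hsum]
    have h0 : 0 ≤ ∑ q ∈ Finset.univ.image μ, I.tightRadius hn μ q :=
      Finset.sum_nonneg fun q _ => hnonneg q
    have he' : (0 : ℝ) ≤ 8 / e := by positivity
    exact mul_le_mul (by linarith) hopt h0 (by linarith)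
  · rw [(eval_agree Prog.main σ).v 0 (by decide)]
    exact hfit.h0

end Structured

/-! ### The probability of success. -/

namespace Structured

open RAM Cmd

/-- Sets that the sample has to hit: for each large cluster two disjoint parts of it. -/
theorem exists_family {n k U e : ℕ} {dd : ℕ → ℕ → ℝ} {cl : ℕ → ℕ}
    (hcard : ((Finset.range n).image cl).card ≤ k)
    (hload : ∀ q ∈ (Finset.range n).image cl,
      ((Finset.range n).filter (fun x => cl x = q)).card ≤ U) :
    ∃ F : Finset (Finset ℕ), F.card ≤ 2 * k ∧
      (∀ S ∈ F, S ⊆ Finset.range n ∧ n ≤ 3 * k ^ 2 * S.card) ∧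
      ∀ R : ℕ → ℕ, (∀ S ∈ F, ∃ i < 12 * k * k * k, R i ∈ S) →
        (mkPar n k U e R dd).Sampled cl ((Finset.range n).image cl) := by
  classical
  set C := (Finset.range n).image cl with hC
  set S : ℕ → Finset ℕ := fun q => (Finset.range n).filter (fun x => cl x = q) with hS
  -- At most `k` clusters of at most `U` points contain all points; thus a cluster with more than `U
  -- / k` points has at least `n / k ^ 2` of them.
  have hnk : n ≤ k * U := by
    have h1 := Finset.card_eq_sum_card_image cl (Finset.range n)
    rw [Finset.card_range] at h1
    calc n = ∑ q ∈ C, (S q).card := h1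
      _ ≤ C.card * U := by
        rw [← smul_eq_mul]; exact Finset.sum_le_card_nsmul _ _ _ hload
      _ ≤ k * U := Nat.mul_le_mul_right _ hcard
  have hhalf : ∀ q, ∃ A ⊆ S q, A.card = (S q).card / 2 := fun q =>
    Finset.exists_subset_card_eq (Nat.div_le_self _ _)
  choose A hAS hAc using hhalf
  -- A cluster of at least two points is split into halves, each with at least a third of its
  -- points; hitting both yields two different sample points. For a single point the empty half is
  -- replaced by the whole cluster.
  refine ⟨(C.filter (fun q => U < k * (S q).card)).biUnion
    (fun q => {S q \ A q, if 2 ≤ (S q).card then A q else S q}), ?_, ?_, ?_⟩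
  · refine (Finset.card_biUnion_le_card_mul _ _ 2 fun q _ => Finset.card_le_two).trans ?_
    rw [mul_comm]
    exact Nat.mul_le_mul_left _ ((Finset.card_filter_le _ _).trans hcard)
  · intro T hT
    obtain ⟨q, hq, hT⟩ := Finset.mem_biUnion.mp hT
    obtain ⟨hqC, hq⟩ := Finset.mem_filter.mp hq
    have hSr : S q ⊆ Finset.range n := Finset.filter_subset _ _
    have hlarge : ∀ T : Finset ℕ, (S q).card ≤ 3 * T.card → n ≤ 3 * k ^ 2 * T.card := by
      intro T hT
      calc n ≤ k * U := hnk
        _ ≤ k * (k * (3 * T.card)) :=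
          Nat.mul_le_mul_left _ (hq.le.trans (Nat.mul_le_mul_left _ hT))
        _ = _ := by ring
    have hsd : (S q \ A q).card = (S q).card - (S q).card / 2 := by
      rw [Finset.card_sdiff_of_subset (hAS q), hAc]
    rw [Finset.mem_insert, Finset.mem_singleton] at hT
    rcases hT with rfl | rfl
    · exact ⟨Finset.sdiff_subset.trans hSr, hlarge _ (by omega)⟩
    · split
      · exact ⟨(hAS q).trans hSr, hlarge _ (by rw [hAc]; omega)⟩
      · exact ⟨hSr, hlarge _ (by omega)⟩
  · intro R hR q hq hlt
    have hmem : ∀ T, T ∈ ({S q \ A q, if 2 ≤ (S q).card then A q else S q} : Finset (Finset ℕ)) →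
        ∃ i < 12 * k * k * k, R i ∈ T := fun T hT =>
      hR T (Finset.mem_biUnion.mpr ⟨q, Finset.mem_filter.mpr ⟨hq, hlt⟩, hT⟩)
    obtain ⟨i, hi, h1⟩ := hmem _ (Finset.mem_insert_self _ _)
    obtain ⟨h1, h2⟩ := Finset.mem_sdiff.mp h1
    have hci : cl (R i) = q := (Finset.mem_filter.mp h1).2
    refine ⟨⟨i, hi, hci⟩, fun h => ?_⟩
    obtain ⟨j, hj, h3⟩ := hmem _ (Finset.mem_insert_of_mem (Finset.mem_singleton_self _))
    rw [if_pos (show 2 ≤ (S q).card from h)] at h3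
    exact ⟨i, hi, j, hj, hci, (Finset.mem_filter.mp (hAS q h3)).2, 
      fun (he : R i = R j) => h2 (he ▸ h3)⟩

/-- The probability that a random point is not in a set of at least `n / (3 * k ^ 2)` points. -/
def missProb (k : ℕ) : ENNReal := ENNReal.ofReal (1 - 1 / (3 * k ^ 2))

theorem miss_le {n k : ℕ} (hn : 1 ≤ n) (hk : 1 ≤ k) {S : Finset ℕ} (hS : S ⊆ Finset.range n)
    (hc : n ≤ 3 * k ^ 2 * S.card) :
    (n : ENNReal)⁻¹ * ((Finset.range n).filter (fun v => v ∉ S)).card ≤ missProb k := by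
  have hn' : (0 : ℝ) < n := by exact_mod_cast hn
  have hk' : (0 : ℝ) < k := by exact_mod_cast hk
  have h1 : ((Finset.range n).filter (fun v => v ∉ S)).card + S.card = n := by
    have := Finset.card_filter_add_card_filter_not (s := Finset.range n) (fun v => v ∈ S)
    rw [Finset.filter_mem_eq_inter, Finset.inter_eq_right.mpr hS, Finset.card_range] at this
    omega
  set c := ((Finset.range n).filter (fun v => v ∉ S)).card
  have h2 : (n : ENNReal)⁻¹ * c = ENNReal.ofReal ((n : ℝ)⁻¹ * c) := by
    rw [ENNReal.ofReal_mul (by positivity), ENNReal.ofReal_inv_of_pos hn', ENNReal.ofReal_natCast,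
      ENNReal.ofReal_natCast]
  rw [h2, missProb]
  refine ENNReal.ofReal_le_ofReal ?_
  have h3 : (c : ℝ) = n - S.card := by rw [eq_sub_iff_add_eq]; exact_mod_cast h1
  have h4 : (n : ℝ) ≤ 3 * k ^ 2 * S.card := by exact_mod_cast hc
  rw [h3, inv_mul_eq_div, sub_div, div_self hn'.ne', sub_le_sub_iff_left, div_le_div_iff₀
    (by positivity) hn']
  linarith

/-- With `t = 3 * k ^ 2` one has `(1 - 1 / t) ^ t ≤ exp (-1) ≤ 1 / 2`, and `12 * k ^ 3 = 4 * k * t`.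
So each of the `2 * k` sets is missed with probability at most `2 ^ (-4 * k)`, and `4 * k ≤ 2 ^ (4 *
k)`. -/
theorem missProb_pow {k : ℕ} (hk : 1 ≤ k) : 2 * k * missProb k ^ (12 * k * k * k) ≤ 1 / 2 := by
  have hk' : (1 : ℝ) ≤ k := by exact_mod_cast hk
  have h0 : (0 : ℝ) ≤ 1 - 1 / (3 * k ^ 2) := by
    rw [sub_nonneg, div_le_one (by positivity)]
    nlinarith
  have h1 : (1 - 1 / (3 * (k : ℝ) ^ 2)) ^ (3 * k ^ 2) ≤ 1 / 2 := by
    calc (1 - 1 / (3 * (k : ℝ) ^ 2)) ^ (3 * k ^ 2) ≤ Real.exp (-(1 / (3 * (k : ℝ) ^ 2))) ^ (3 * k ^ 2) :=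
          pow_le_pow_left₀ h0 (Real.one_sub_le_exp_neg _) _
      _ = Real.exp (-1) := by
        rw [← Real.exp_nat_mul]
        congr 1
        push_cast
        field_simp
      _ ≤ 1 / 2 := by
        rw [Real.exp_neg, one_div]
        exact inv_anti₀ (by norm_num) (by linarith [Real.add_one_le_exp (1 : ℝ)])
  have h2 : (1 - 1 / (3 * (k : ℝ) ^ 2)) ^ (12 * k * k * k) ≤ (1 / 2) ^ (4 * k) := by
    rw [show 12 * k * k * k = 3 * k ^ 2 * (4 * k) by ring, pow_mul]
    exact pow_le_pow_left₀ (pow_nonneg h0 _) h1 _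
  have h3 : (2 * k : ENNReal) * missProb k ^ (12 * k * k * k) =
      ENNReal.ofReal (2 * k * (1 - 1 / (3 * (k : ℝ) ^ 2)) ^ (12 * k * k * k)) := by
    rw [ENNReal.ofReal_mul (by positivity), ENNReal.ofReal_mul (by positivity),
      ENNReal.ofReal_pow h0, ENNReal.ofReal_natCast, missProb]
    simp
  have h4 : (1 / 2 : ENNReal) = ENNReal.ofReal (1 / 2) := by
    rw [ENNReal.ofReal_div_of_pos (by norm_num)]; simp
  rw [h3, h4]
  refine ENNReal.ofReal_le_ofReal ?_
  have h5 : ((4 * k : ℕ) : ℝ) ≤ 2 ^ (4 * k) := by exact_mod_cast (Nat.lt_two_pow_self).le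
  push_cast at h5
  calc 2 * k * (1 - 1 / (3 * (k : ℝ) ^ 2)) ^ (12 * k * k * k) ≤ 2 * k * (1 / 2) ^ (4 * k) := by
        gcongr
    _ ≤ 1 / 2 := by
      rw [one_div, inv_pow, ← div_eq_mul_inv, div_le_iff₀ (by positivity)]
      linarith

theorem missBound_le {F : Finset (Finset ℕ)} {k : ℕ} {R : ℕ → ℕ} (hk : 1 ≤ k)
    (hF : F.card ≤ 2 * k) : missBound F (missProb k) (12 * k * k * k) 0 R ≤ 1 / 2 := by
  refine le_trans ?_ (missProb_pow hk)
  rw [missBound, Finset.sum_const, nsmul_eq_mul, Nat.sub_zero]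
  gcongr
  exact_mod_cast (Finset.card_filter_le _ _).trans hF

theorem half_le_of_compl {S : Type*} {p : PMF S} {A : Set S} (h : p.toOuterMeasure Aᶜ ≤ 1 / 2) :
    1 / 2 ≤ p.toOuterMeasure A := by
  have h1 : (1 : ENNReal) ≤ p.toOuterMeasure A + p.toOuterMeasure Aᶜ := by
    rw [← (p.toOuterMeasure_apply_eq_one_iff Set.univ).mpr (Set.subset_univ _),
      ← Set.union_compl_self A]
    exact MeasureTheory.measure_union_le _ _
  have h2 : (1 / 2 : ENNReal) + 1 / 2 ≤ p.toOuterMeasure A + 1 / 2 := by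
    rw [ENNReal.add_halves]
    exact h1.trans (by gcongr)
  exact (ENNReal.add_le_add_iff_right (by simp)).mp h2

open CSRInstance in
/-- The program bounds all words and its time, and is successful with probability `1 / 2`. -/
theorem program_spec {X : Type*} [MetricSpace X] {I : CSRInstance X} {U e : ℕ} {ε : ℝ}
    (hU : I.UniformCap U) (hn : 1 ≤ I.n) (hk : 1 ≤ I.k) (he : 1 ≤ e) (hε : 8 / e ≤ ε) :
    (∀ t, ∀ s ∈ (run (Prog.program e) I.input t).support,
      Bdd (64 * (I.n + U + guesses I.k e) ^ 3) s) ∧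
    (∀ t, Prog.timeBound I.n I.k e ≤ t → (∀ s ∈ (run (Prog.program e) I.input t).support,
      Halted (Prog.program e) s) ∧ (I.Feasible → (1 / 2 : ENNReal) ≤
        (run (Prog.program e) I.input t).toOuterMeasure {s | I.OutputsApprox (4 + ε) s})) := by
  have outcome : ∀ {A : Set State} {F : Finset (Finset ℕ)}, _ → _ → _ :=
    fun {A} {F} => Prog.program_outcome (A := A) (F := F) (β := missProb I.k) (s := I.input)
      (n := I.n) (k := I.k) (U := U) (e := e) (dd := I.dn hn) rfl rfl rfl
      (fun x hx => by
        show (if x = 0 then _ else if x = 1 then _ else _) = _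
        rw [if_neg (by omega), if_neg (by omega)])
      (by
        show (if h : 0 < I.n then I.cap ⟨0, h⟩ else 0) = U
        rw [dif_pos (by omega), hU])
      (fun a => by
        show (if h : a < I.n then I.cap ⟨a, h⟩ else 0) ≤ U
        split
        · rw [hU]
        · exact Nat.zero_le _)
      (fun i hi j hj => by
        have h1 : (i * I.n + j) / I.n = i := by
          rw [mul_comm, Nat.mul_add_div (by omega), Nat.div_eq_of_lt hj, add_zero]
        have h2 : (i * I.n + j) % I.n = j := by
          rw [mul_comm, Nat.mul_add_mod, Nat.mod_eq_of_lt hj]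
        show (if h : _ then I.d ⟨(i * I.n + j) / I.n, _⟩ ⟨(i * I.n + j) % I.n, _⟩ else 0) = _
        rw [dif_pos ⟨by rw [h1]; exact hi, by rw [h2]; exact hj⟩, ← I.dn_val hn]
        simp only [h1, h2])
      hn hk he
  -- Infeasible instances have no optimal clusters; the trivial event and the empty family give the
  -- bounds on words and time for all instances.
  have triv := outcome (A := Set.univ) (F := ∅) (by simp) (fun _ _ _ _ _ _ _ _ => trivial)
  refine ⟨triv.bdd, fun t ht => ⟨triv.halted t ht, fun hf => ?_⟩⟩
  obtain ⟨μ, hcard, hload, hopt⟩ := I.exists_optimal hn hf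
  set cl : ℕ → ℕ := fun x => if h : x < I.n then μ ⟨x, h⟩ else 0 with hcldef
  have hcl : ∀ p : Fin I.n, cl p = μ p := fun p => by simp [hcldef]
  obtain ⟨F, f1, f2, f3⟩ := exists_family (n := I.n) (k := I.k) (U := U) (e := e) (dd := I.dn hn)
    (cl := cl) (by rw [image_range_eq_map hcl, Finset.card_map]; exact hcard) (fun q hq => by
      obtain ⟨x, hx, rfl⟩ := Finset.mem_image.mp hq
      rw [hcl ⟨x, Finset.mem_range.mp hx⟩, card_filter_range_eq hcl, ← hU]
      exact hload _)
  have := outcome (A := {s | I.OutputsApprox (4 + ε) s}) (F := F)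
    (fun S hS => miss_le hn hk (f2 S hS).1 (f2 S hS).2)
    (fun R hR hhit σ hfit h24 s hr => outputsApprox_of_sampled hU hn hk hf he hε hcl hcard hload hopt
      hR (f3 R hhit) hfit h24 hr)
  exact half_le_of_compl ((this.prob t ht).trans (missBound_le hk f1))

end Structured

theorem fptFactor_eq {C k : ℕ} {ε x : ℝ} (hx : x = 2 + k / min ε 1) (h0 : 0 < x) :
    fptFactor C k ε = x ^ (C * k) := by
  rw [fptFactor, ← hx, mul_comm, Real.rpow_mul (by norm_num), Real.rpow_logb (by norm_num)
    (by norm_num) h0, ← Nat.cast_mul, Real.rpow_natCast]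

/-! ### Numerical bounds on time and word size. -/

namespace Structured

variable {k e : ℕ} {x : ℝ}

/-- Since `x ≥ 3`, constants are absorbed by additional powers of `x`; here `x` stands for `2 + k /
min ε 1`, whose power `C * k` is `fptFactor`. -/
theorem const_mul_pow_le (hx : 3 ≤ x) {c : ℝ} {i j l : ℕ} (hc : c ≤ 3 ^ l) (hj : i + l ≤ j) :
    c * x ^ i ≤ x ^ j := by
  have h0 : 0 < x := by linarith
  calc c * x ^ i ≤ 3 ^ l * x ^ i := by gcongr
    _ ≤ x ^ l * x ^ i := by gcongr
    _ = x ^ (i + l) := by rw [← pow_add, add_comm]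
    _ ≤ x ^ j := pow_le_pow_right₀ (by linarith) hj

theorem guesses_le (hk : 1 ≤ k) (hx : 3 ≤ x) (h1 : (k : ℝ) + 1 ≤ x) (h2 : (e : ℝ) * k ≤ 9 * x) :
    (guesses k e : ℝ) ≤ x ^ (14 * k) := by
  have h0 : 0 < x := by linarith
  have hkx : (k : ℝ) ≤ x := by linarith
  have hm : (12 * k * k * k + 1 : ℝ) ≤ x ^ 6 := by
    calc (12 * k * k * k + 1 : ℝ) ≤ 12 * x * x * x + 1 := by gcongr
      _ ≤ 13 * x ^ 3 := by nlinarith [one_le_pow₀ (show (1 : ℝ) ≤ x by linarith) (n := 3)]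
      _ ≤ x ^ 6 := const_mul_pow_le hx (l := 3) (by norm_num) (by norm_num)
  have hT : (4 * k * (4 * (e * k) + 1) + 1 : ℝ) ≤ x ^ 7 := by
    calc (4 * k * (4 * (e * k) + 1) + 1 : ℝ) ≤ 4 * x * (4 * (9 * x) + 1) + 1 := by gcongr
      _ ≤ 149 * x ^ 2 := by nlinarith
      _ ≤ x ^ 7 := const_mul_pow_le hx (l := 5) (by norm_num) (by norm_num)
  rw [guesses]
  push_cast
  calc (k + 1 : ℝ) * ((12 * k * k * k + 1) * (4 * k * (4 * (e * k) + 1) + 1)) ^ k ≤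
        x ^ k * (x ^ 6 * x ^ 7) ^ k := by
        gcongr
        exact h1.trans (le_self_pow₀ (by linarith) (by omega))
    _ = x ^ (14 * k) := by rw [← pow_add, ← pow_mul, ← pow_add]; congr 1; ring

theorem timeBound_le {n : ℕ} (hn : 1 ≤ n) (hk : 1 ≤ k) (hx : 3 ≤ x) (h1 : (k : ℝ) + 1 ≤ x)
    (h2 : (e : ℝ) * k ≤ 9 * x) : (Prog.timeBound n k e : ℝ) ≤ x ^ (100 * k) * n ^ 3 := by
  have hG := guesses_le hk hx h1 h2
  have h0 : 0 < x := by linarith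
  have hkx : (k : ℝ) ≤ x := by linarith
  have hx1 : 1 ≤ x := by linarith
  have hn3 : (1 : ℝ) ≤ n ^ 3 := one_le_pow₀ (by exact_mod_cast hn)
  have hd : drawSteps ≤ 60 := by decide
  have hd' : (drawSteps : ℝ) ≤ 60 := by exact_mod_cast hd
  have a1 : (2000 * (n ^ 3 * (k + 1) ^ 2 * guesses k e) : ℝ) ≤ x ^ (30 * k) * n ^ 3 := by
    calc (2000 * (n ^ 3 * (k + 1) ^ 2 * guesses k e) : ℝ)
        ≤ 2000 * (n ^ 3 * x ^ 2 * x ^ (14 * k)) := by gcongr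
      _ = (2000 * x ^ (2 + 14 * k)) * n ^ 3 := by rw [pow_add]; ring
      _ ≤ x ^ (30 * k) * n ^ 3 := by
        gcongr
        exact const_mul_pow_le hx (l := 7) (by norm_num) (by omega)
  have a2 : (12 * k * k * k * drawSteps : ℝ) ≤ x ^ (30 * k) := by
    calc (12 * k * k * k * drawSteps : ℝ) ≤ 12 * x * x * x * 60 := by gcongr
      _ = 720 * x ^ 3 := by ring
      _ ≤ _ := const_mul_pow_le hx (l := 6) (by norm_num) (by omega)
  have a3 : (200 * (k + 1) : ℝ) ≤ x ^ (30 * k) := by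
    calc (200 * (k + 1) : ℝ) ≤ 200 * x ^ 1 := by rw [pow_one]; gcongr
      _ ≤ _ := const_mul_pow_le hx (l := 5) (by norm_num) (by omega)
  have a4 : (2 : ℝ) ≤ x ^ (30 * k) := by
    calc (2 : ℝ) = 2 * x ^ 0 := by simp
      _ ≤ _ := const_mul_pow_le hx (l := 1) (by norm_num) (by omega)
  have a5 : x ^ (30 * k) ≤ x ^ (30 * k) * n ^ 3 := le_mul_of_one_le_right (by positivity) hn3
  rw [Prog.timeBound]
  push_cast
  calc _ ≤ 4 * (x ^ (30 * k) * n ^ 3 : ℝ) := by linarith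
    _ = (4 * x ^ (30 * k)) * n ^ 3 := by ring
    _ ≤ _ := by
      gcongr
      exact const_mul_pow_le hx (l := 2) (by norm_num) (by omega)

theorem word_le {n U : ℕ} (hn : 1 ≤ n) (hk : 1 ≤ k) (hx : 3 ≤ x) (h1 : (k : ℝ) + 1 ≤ x)
    (h2 : (e : ℝ) * k ≤ 9 * x) :
    ((64 * (n + U + guesses k e) ^ 3 : ℕ) : ℝ) ≤ x ^ (100 * k) * ((n : ℝ) + U) ^ 100 := by
  have hG := guesses_le hk hx h1 h2
  have h0 : 0 < x := by linarith
  have hG1 : (1 : ℝ) ≤ x ^ (14 * k) := one_le_pow₀ (by linarith)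
  have hn1 : (1 : ℝ) ≤ n + U := by
    have : (1 : ℝ) ≤ n := by exact_mod_cast hn
    have : (0 : ℝ) ≤ U := by positivity
    linarith
  push_cast
  calc (64 * ((n : ℝ) + U + guesses k e) ^ 3) ≤ 64 * (2 * (x ^ (14 * k) * ((n : ℝ) + U))) ^ 3 := by
        gcongr
        nlinarith
    _ = (512 * x ^ (42 * k)) * ((n : ℝ) + U) ^ 3 := by
      rw [mul_pow, mul_pow, ← pow_mul, show 14 * k * 3 = 42 * k by ring]; ring
    _ ≤ x ^ (100 * k) * ((n : ℝ) + U) ^ 100 := by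
      gcongr
      · exact const_mul_pow_le hx (l := 6) (by norm_num) (by omega)
      · norm_num

end Structured

end

open Structured in
theorem theorem2 :
    ∃ C : ℕ, ∀ ε : ℝ, 0 < ε → ∃ M : RAM.Program,
      ∀ (X : Type*) [MetricSpace X] (I : CSRInstance X) (U : ℕ),
        I.UniformCap U → 1 ≤ I.n → 1 ≤ I.k →
        -- every word that occurs in a run has `O(k log (k / ε) + log (n + U))` bits
        (∀ t : ℕ, ∀ s ∈ (RAM.run M I.input t).support, ∀ a : ℕ,
          (s.word a : ℝ) ≤ fptFactor C I.k ε * ((I.n : ℝ) + U) ^ C ∧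
          (s.wordMem a : ℝ) ≤ fptFactor C I.k ε * ((I.n : ℝ) + U) ^ C) ∧
        ∃ t : ℕ, (t : ℝ) ≤ fptFactor C I.k ε * (I.n : ℝ) ^ 3 ∧
          -- every run halts within `t` steps
          (∀ s ∈ (RAM.run M I.input t).support, RAM.Halted M s) ∧
          (I.Feasible →
            (1 / 2 : ENNReal) ≤
              (RAM.run M I.input t).toOuterMeasure {s | I.OutputsApprox (4 + ε) s}) := by
  refine ⟨100, fun ε hε => ?_⟩
  have hm : 0 < min ε 1 := lt_min hε one_pos
  have hm1 : 1 ≤ 1 / min ε 1 := by rw [le_div_iff₀ hm, one_mul]; exact min_le_right _ _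
  -- Rounding to units contributes `8 / e` to the approximation factor, which has to be at most `ε`.
  set e := ⌈8 / min ε 1⌉₊ with he
  have h8 : 8 / min ε 1 ≤ e := Nat.le_ceil _
  have e0 : 0 < e := Nat.ceil_pos.mpr (by positivity)
  have he9 : (e : ℝ) ≤ 9 * (1 / min ε 1) := by
    have := (Nat.ceil_lt_add_one (show 0 ≤ 8 / min ε 1 by positivity)).le
    rw [← he] at this
    have h : 8 / min ε 1 = 8 * (1 / min ε 1) := by ring
    linarith
  have heε : 8 / (e : ℝ) ≤ ε := by
    rw [div_le_iff₀ hm] at h8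
    rw [div_le_iff₀ (by exact_mod_cast e0), mul_comm]
    exact h8.trans (mul_le_mul_of_nonneg_left (min_le_left _ _) (by positivity))
  refine ⟨Prog.program e, fun X _ I U hU hn hk => ?_⟩
  obtain ⟨p1, p2⟩ := program_spec hU hn hk e0 heε
  obtain ⟨x, hx⟩ : ∃ x : ℝ, x = 2 + I.k / min ε 1 := ⟨_, rfl⟩
  have hkR : (1 : ℝ) ≤ I.k := by exact_mod_cast hk
  have hxk : x = 2 + I.k * (1 / min ε 1) := by rw [hx]; ring
  have hk1 : (I.k : ℝ) ≤ I.k * (1 / min ε 1) := le_mul_of_one_le_right (by linarith) hm1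
  have x3 : 3 ≤ x := by linarith
  have x1 : (I.k : ℝ) + 1 ≤ x := by linarith
  have x2 : (e : ℝ) * I.k ≤ 9 * x := by
    have := mul_le_mul_of_nonneg_right he9 (show (0 : ℝ) ≤ I.k by linarith)
    linarith
  rw [fptFactor_eq hx (by linarith)]
  have hw := word_le (U := U) hn hk x3 x1 x2
  refine ⟨fun t s hs a => ?_, Prog.timeBound I.n I.k e, timeBound_le hn hk x3 x1 x2, p2 _ le_rfl⟩
  have hb := p1 t s hs a
  exact ⟨(Nat.cast_le.mpr hb.1).trans hw, (Nat.cast_le.mpr hb.2).trans hw⟩
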